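/- **Setting.** For each $m\in\mathbb N$ consider a finite population of $n=n^{(m)}$ units with fixed potential outcomes $y_i(1),y_i(0)\in\mathbb R$ and fixed covariates $x_i\in\mathbb R^{p-1}$ ($p=p^{(m)}\ge1$), normalized so that $\sum_i x_i=0$. Put $z_i=(1,x_i')'$ and let $Z$ be the matrix with rows $z_i'$; $Z'Z$ is assumed invertible. A set of $n_1$ units, $0<n_1<n$, drawn uniformly at random without replacement, is treated; $T_i\in\{0,1\}$ is the treatment indicator, $n_0=n-n_1$, $\pi=n_1/n$, and $Y_i=y_i(T_i)$ is observed. Let $\tau=n^{-1}\sum_i\{y_i(1)-y_i(0)\}$, $\Sigma=n^{-1}Z'Z$, $P=Z(Z'Z)^{-1}Z'$, $\beta_t=(Z'Z)^{-1}Z'Y(t)$ with $Y(t)=(y_1(t),\dots,y_n(t))'$, $e_i(t)=y_i(t)-z_i'\beta_t$, and $$\kappa=\max_iP_{ii},\qquad \mathcal E_2=\max_{t\in\{0,1\}}n^{-1}\sum_ie_i(t)^2,\qquad \mathcal E_\infty=\max_{t\in\{0,1\}}\max_i|e_i(t)|.$$ **Estimators.** Let $\hat\tau^{\mathrm{adj}}$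 be the OLS coefficient on $T_i$ in the regression of $Y_i$ on $(1,T_i,x_i',T_ix_i')$. Let $\hat\beta_t$ be the OLS coefficient of $Y_i$ on $z_i$ over the units with $T_i=t$, and $\hat\beta_t^{(i)}$ the same with unit $i$ left out. Let $\hat e_i=Y_i-z_i'\hat\beta_{T_i}$, $\hat\mu^{\mathrm{adj}}_t=n^{-1}\sum_iz_i'\hat\beta_t$, $\hat\Delta_t=n_t^{-1}\sum_{i:T_i=t}P_{ii}\hat e_i$, and $$\hat\tau^{\mathrm{bc}}=\Big(\hat\mu_1^{\mathrm{adj}}+\tfrac{n_0}{n_1}\hat\Delta_1\Big)-\Big(\hat\mu_0^{\mathrm{adj}}+\tfrac{n_1}{n_0}\hat\Delta_0\Big),$$ $$\hat\tau^{\mathrm{cf}}=\frac1n\sum_i\Big\{\frac{T_i}{\pi}Y_i-\Big(\frac{T_i}{\pi}-1\Big)z_i'\hat\beta_1^{(i)}\Big\}-\frac1n\sum_i\Big\{\frac{1-T_i}{1-\pi}Y_i-\Big(\frac{1-T_i}{1-\pi}-1\Big)z_i'\hat\beta_0^{(i)}\Big\}.$$ **Assumptions.** As $m\to\infty$, $n\to\infty$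 ($p$ may grow) and: (i) $n/n_1=O(1)$ and $n/n_0=O(1)$; (ii) $\kappa\log p=o(1)$; (iii) for some constant $\eta>0$, $\sum_ie_i(1)e_i(0)\big/\sqrt{\sum_ie_i(1)^2\sum_ie_i(0)^2}>-1+\eta$ for all large $m$; (iv) $\mathcal E_\infty^2/(n\mathcal E_2)=o(1)$. (In (iii) and (iv), $0/0$ is read as $0$.) **Expansion terms.** Let $$L_i=\Big(\frac{T_i}{\pi}-1\Big)\Big(e_i(1)+\frac{\pi}{1-\pi}e_i(0)\Big),$$ $$W_{ij}=-\Big(\frac{T_i}{\pi}-1\Big)\Big(\frac{T_j}{\pi}-1\Big)z_i'\Sigma^{-1}z_j\{e_i(1)+e_j(1)\}+\Big(\frac{1-T_i}{1-\pi}-1\Big)\Big(\frac{1-T_j}{1-\pi}-1\Big)z_i'\Sigma^{-1}z_j\{e_i(0)+e_j(0)\},$$ $$B^{\mathrm{adj}}=-\frac1n\sum_i\Big(\frac{T_i}{\pi}-1\Big)^2P_{ii}e_i(1)+\frac1n\sum_i\Big(\frac{1-T_i}{1-\pi}-1\Big)^2P_{ii}e_i(0),$$ $$\begin{aligned}B^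{\mathrm{bc}}=&-\frac1n\sum_i\Big\{\Big(\frac{T_i}{\pi}-1\Big)^2-\frac{n_0}{n_1}\frac{T_i}{\pi}\Big\}P_{ii}e_i(1)\\&-\frac{n_0}{n_1}\Big(\frac1{n_1}\sum_iT_iP_{ii}z_i\Big)'\Big(\frac1{n_1}\sum_iT_iz_iz_i'\Big)^{-1}\Big(\frac1{n_1}\sum_iT_iz_ie_i(1)\Big)\\&+\frac1n\sum_i\Big\{\Big(\frac{1-T_i}{1-\pi}-1\Big)^2-\frac{n_1}{n_0}\frac{1-T_i}{1-\pi}\Big\}P_{ii}e_i(0)\\&+\frac{n_1}{n_0}\Big(\frac1{n_0}\sum_i(1-T_i)P_{ii}z_i\Big)'\Big(\frac1{n_0}\sum_i(1-T_i)z_iz_i'\Big)^{-1}\Big(\frac1{n_0}\sum_i(1-T_i)z_ie_i(0)\Big),\end{aligned}$$ and $B^{\mathrm{cf}}=0$. **Theorem.** Under these assumptions: (i) for $a\in\{\mathrm{adj},\mathrm{bc}\}$, $$\hat\tau^a-\tau=B^a+\frac1n\sum_iL_i+\frac1{n^2}\sum_{i<j}W_{ij}+O_p\big(n^{-1/2}\{\mathcal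 E_2(\kappa^2p+\kappa^3p(\log p)^2)\}^{1/2}\big),$$ and $$\hat\tau^{\mathrm{cf}}-\tau=B^{\mathrm{cf}}+\frac1n\sum_iL_i+\frac1{n^2}\sum_{i<j}W_{ij}+O_p\big(n^{-1/2}\{\mathcal E_2(\kappa^2p^{1/2}+\kappa^3p(\log p)^2)\}^{1/2}\big);$$ (ii) $B^{\mathrm{adj}}=O_p(n^{-1/2}(\mathcal E_2\kappa p)^{1/2})$, $B^{\mathrm{bc}}=O_p(n^{-1/2}(\mathcal E_2\kappa^2p)^{1/2})$, and $B^{\mathrm{cf}}=0$. Here $X_m=O_p(a_m)$ means that for every $\varepsilon>0$ there is $M$ with $\mathbb P(|X_m|>Ma_m)\le\varepsilon$ for all large $m$. (Where a matrix to be inverted is singular, its inverse is set to $0$; such assignments have probability tending to $0$.) -/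

import Mathlib

open Filter Topology Asymptotics MeasureTheory
open scoped Matrix

/-- Stochastic boundedness `X m = O_p(a m)` as `m → ∞`, where the `m`-th random variable `X m` lives
on its own probability space `(Ω m, μ m)`: for every `ε > 0` there is a constant `M` such that
`P(|X m| > M * a m) ≤ ε` for all large `m`. -/
def IsBigOp {Ω : ℕ → Type*} [∀ m, MeasurableSpace (Ω m)] (μ : ∀ m, Measure (Ω m))
    (X : ∀ m, Ω m → ℝ) (a : ℕ → ℝ) : Prop :=
  ∀ ε : ℝ, 0 < ε → ∃ M : ℝ, 0 < M ∧ ∀ᶠ m in atTop, (μ m).real {ω | M * a m < |X m ω|} ≤ ε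

/-- The design matrix `Z`, whose `i`-th row is `z_i = (1, x_i')'`. -/
def designMatrix {n d : ℕ} (x : Fin n → Fin d → ℝ) : Matrix (Fin n) (Fin (d + 1)) ℝ :=
  Matrix.of fun i => Matrix.vecCons 1 (x i)

/-- The finite population of a completely randomized treatment-control experiment: `n` units, of
which `n₁` are treated and `n - n₁` are controls (both groups nonempty), `d = p - 1` covariates
`x i` normalized to have mean zero, and the two fixed potential outcomes `y 1 i`, `y 0 i`.
The matrix `Z'Z` is invertible, so that population least squares is defined. -/
structure RCT where
  n : ℕ
  n₁ : ℕ
  d : ℕ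
  x : Fin n → Fin d → ℝ
  y : Fin 2 → Fin n → ℝ
  n₁_pos : 0 < n₁
  n₁_lt : n₁ < n
  x_centered : ∀ k, ∑ i, x i k = 0
  gram_isUnit : IsUnit ((designMatrix x)ᵀ * designMatrix x)

namespace RCT

noncomputable section

/-! ### Population quantities -/

/-- The number `p` of regressors, counting the intercept. -/
def p (E : RCT) : ℕ := E.d + 1

/-- The size of the control group. -/
def n₀ (E : RCT) : ℕ := E.n - E.n₁

/-- The fraction of treated units. -/
def π (E : RCT) : ℝ := (E.n₁ : ℝ) / E.n

/-- The matrix `Z`. -/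
def Z (E : RCT) : Matrix (Fin E.n) (Fin (E.d + 1)) ℝ := designMatrix E.x

/-- The regressor `z_i = (1, x_i')'`. -/
def z (E : RCT) (i : Fin E.n) : Fin (E.d + 1) → ℝ := E.Z i

/-- `Σ = n⁻¹ Z'Z`. -/
def Sig (E : RCT) : Matrix (Fin (E.d + 1)) (Fin (E.d + 1)) ℝ := (1 / (E.n : ℝ)) • (E.Zᵀ * E.Z)

/-- The projection matrix `P = Z (Z'Z)⁻¹ Z'`. -/
def P (E : RCT) : Matrix (Fin E.n) (Fin E.n) ℝ := E.Z * (E.Zᵀ * E.Z)⁻¹ * E.Zᵀ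

/-- The mean `μ_t` of the potential outcomes under `t`. -/
def mu (E : RCT) (t : Fin 2) : ℝ := (1 / (E.n : ℝ)) * ∑ i, E.y t i

/-- The average treatment effect `τ = μ_1 - μ_0`. -/
def tau (E : RCT) : ℝ := E.mu 1 - E.mu 0

/-- The population least squares coefficient `β_t = (Z'Z)⁻¹ Z' Y(t)`. -/
def beta (E : RCT) (t : Fin 2) : Fin (E.d + 1) → ℝ :=
  (E.Zᵀ * E.Z)⁻¹.mulVec (E.Zᵀ.mulVec (E.y t))

/-- The potential residual `e_i(t) = y_i(t) - z_i' β_t`. -/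
def e (E : RCT) (t : Fin 2) (i : Fin E.n) : ℝ := E.y t i - E.z i ⬝ᵥ E.beta t

/-- `κ = max_i P_ii`, a maximum over a finite nonempty set. -/
def kappa (E : RCT) : ℝ := ⨆ i, E.P i i

/-- `ℰ₂ = max_t n⁻¹ ∑_i e_i(t)²`. -/
def E2 (E : RCT) : ℝ :=
  max ((1 / (E.n : ℝ)) * ∑ i, E.e 1 i ^ 2) ((1 / (E.n : ℝ)) * ∑ i, E.e 0 i ^ 2)

/-- `ℰ_∞ = max_t max_i |e_i(t)|`, with maxima over finite nonempty sets. -/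
def Einf (E : RCT) : ℝ := max (⨆ i, |E.e 1 i|) (⨆ i, |E.e 0 i|)

/-! ### Random assignment

An assignment is the set `S` of the treated units; it is drawn uniformly at random from the subsets
of size `n₁` (sampling without replacement). -/

/-- The possible sets of treated units. -/
abbrev Assignment (E : RCT) : Type := Finset (Fin E.n)

/-- The uniform distribution on the sets of `n₁` treated units. -/
def law (E : RCT) : Measure E.Assignment :=
  ProbabilityTheory.uniformOn {S : E.Assignment | S.card = E.n₁}

/-- The treatment indicator `T_i`. -/
def T (E : RCT) (S : E.Assignment) (i : Fin E.n) : ℝ :=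
  if i ∈ S then 1 else 0

/-- The observed outcome `Y_i = y_i(T_i)`. -/
def Y (E : RCT) (S : E.Assignment) (i : Fin E.n) : ℝ :=
  if i ∈ S then E.y 1 i else E.y 0 i

/-- The indicator of membership in arm `t`: it is `T_i` for `t = 1` and `1 - T_i` for `t = 0`. -/
def ind (E : RCT) (t : Fin 2) (S : E.Assignment) (i : Fin E.n) : ℝ :=
  if t = 1 then E.T S i else 1 - E.T S i

/-- The number of units in arm `t`: `n₁` for `t = 1` and `n₀` for `t = 0`. -/
def armSize (E : RCT) (t : Fin 2) : ℝ := if t = 1 then (E.n₁ : ℝ) else (E.n₀ : ℝ)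

/-- The fraction of units in arm `t`: `π` for `t = 1` and `1 - π` for `t = 0`. -/
def share (E : RCT) (t : Fin 2) : ℝ := if t = 1 then E.π else 1 - E.π

/-! ### Estimators -/

/-- The least squares coefficient of the outcome `v` on the columns of `D`, `(D'D)⁻¹ D'v`. -/
def ols {ι k : Type*} [Fintype ι] [Fintype k] [DecidableEq k] (D : Matrix ι k ℝ) (v : ι → ℝ) :
    k → ℝ :=
  (Dᵀ * D)⁻¹.mulVec (Dᵀ.mulVec v)

/-- The design matrix of the interacted regression: the `i`-th row lists the regressors
`(1, x_i')` followed by `(T_i, T_i x_i')`. -/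
def interacted (E : RCT) (S : E.Assignment) :
    Matrix (Fin E.n) (Fin (E.d + 1) ⊕ Fin (E.d + 1)) ℝ :=
  Matrix.of fun i => Sum.elim (E.z i) (E.T S i • E.z i)

/-- The regression adjustment estimator: the least squares coefficient on `T_i` in the regression
of `Y_i` on `(1, T_i, x_i', T_i x_i')`. -/
def tauAdj (E : RCT) (S : E.Assignment) : ℝ := ols (E.interacted S) (E.Y S) (Sum.inr 0)

/-- The least squares estimator `β̂_t` from the units in arm `t`. -/
def betaHat (E : RCT) (t : Fin 2) (S : E.Assignment) : Fin (E.d + 1) → ℝ :=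
  (∑ j, E.ind t S j • Matrix.vecMulVec (E.z j) (E.z j))⁻¹.mulVec
    (∑ j, (E.ind t S j * E.Y S j) • E.z j)

/-- The leave-one-out least squares estimator `β̂_t^{(i)}` from the units other than `i` in
arm `t`. -/
def betaLoo (E : RCT) (t : Fin 2) (S : E.Assignment) (i : Fin E.n) : Fin (E.d + 1) → ℝ :=
  (∑ j ∈ Finset.univ.erase i, E.ind t S j • Matrix.vecMulVec (E.z j) (E.z j))⁻¹.mulVec
    (∑ j ∈ Finset.univ.erase i, (E.ind t S j * E.Y S j) • E.z j)

/-- `μ̂_t^adj = n⁻¹ ∑_i z_i' β̂_t`. -/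
def muAdj (E : RCT) (t : Fin 2) (S : E.Assignment) : ℝ :=
  (1 / (E.n : ℝ)) * ∑ i, E.z i ⬝ᵥ E.betaHat t S

/-- The residual `ê_i`, from the regression in the arm of unit `i`. -/
def eHat (E : RCT) (S : E.Assignment) (i : Fin E.n) : ℝ :=
  if i ∈ S then E.Y S i - E.z i ⬝ᵥ E.betaHat 1 S
  else E.Y S i - E.z i ⬝ᵥ E.betaHat 0 S

/-- `Δ̂_t`, the average over arm `t` of `P_ii ê_i`. -/
def deltaHat (E : RCT) (t : Fin 2) (S : E.Assignment) : ℝ :=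
  (1 / E.armSize t) * ∑ i, E.ind t S i * E.P i i * E.eHat S i

/-- The analytically bias-corrected estimator of Lei and Ding. -/
def tauBc (E : RCT) (S : E.Assignment) : ℝ :=
  (E.muAdj 1 S + (E.n₀ : ℝ) / E.n₁ * E.deltaHat 1 S)
    - (E.muAdj 0 S + (E.n₁ : ℝ) / E.n₀ * E.deltaHat 0 S)

/-- `μ̂_t^cf`, the cross-fitted estimator of `μ_t`. -/
def muCf (E : RCT) (t : Fin 2) (S : E.Assignment) : ℝ :=
  (1 / (E.n : ℝ)) * ∑ i, (E.ind t S i / E.share t * E.Y S i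
    - (E.ind t S i / E.share t - 1) * (E.z i ⬝ᵥ E.betaLoo t S i))

/-- The cross-fitted estimator of the average treatment effect. -/
def tauCf (E : RCT) (S : E.Assignment) : ℝ := E.muCf 1 S - E.muCf 0 S

/-! ### Terms of the stochastic expansions -/

/-- The linear term `L_i`. -/
def L (E : RCT) (S : E.Assignment) (i : Fin E.n) : ℝ :=
  (E.T S i / E.π - 1) * (E.e 1 i + E.π / (1 - E.π) * E.e 0 i)

/-- The quadratic term `W_ij`. -/
def W (E : RCT) (S : E.Assignment) (i j : Fin E.n) : ℝ :=
  -((E.T S i / E.π - 1) * (E.T S j / E.π - 1) * (E.z i ⬝ᵥ E.Sig⁻¹.mulVec (E.z j))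
      * (E.e 1 i + E.e 1 j))
    + ((1 - E.T S i) / (1 - E.π) - 1) * ((1 - E.T S j) / (1 - E.π) - 1)
      * (E.z i ⬝ᵥ E.Sig⁻¹.mulVec (E.z j)) * (E.e 0 i + E.e 0 j)

/-- `n⁻¹ ∑_i L_i + n⁻² ∑_{i<j} W_ij`. -/
def stochasticPart (E : RCT) (S : E.Assignment) : ℝ :=
  (1 / (E.n : ℝ)) * ∑ i, E.L S i + (1 / (E.n : ℝ) ^ 2) * ∑ i, ∑ j ∈ Finset.Ioi i, E.W S i j

/-- The bias term `B^adj`. -/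
def biasAdj (E : RCT) (S : E.Assignment) : ℝ :=
  -((1 / (E.n : ℝ)) * ∑ i, (E.T S i / E.π - 1) ^ 2 * E.P i i * E.e 1 i)
    + (1 / (E.n : ℝ)) * ∑ i, ((1 - E.T S i) / (1 - E.π) - 1) ^ 2 * E.P i i * E.e 0 i

/-- The bias term `B^bc`. -/
def biasBc (E : RCT) (S : E.Assignment) : ℝ :=
  -((1 / (E.n : ℝ)) * ∑ i, ((E.T S i / E.π - 1) ^ 2 - (E.n₀ : ℝ) / E.n₁ * (E.T S i / E.π))
      * E.P i i * E.e 1 i)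
    - (E.n₀ : ℝ) / E.n₁ *
      (((1 / (E.n₁ : ℝ)) • ∑ i, (E.T S i * E.P i i) • E.z i) ⬝ᵥ
        ((1 / (E.n₁ : ℝ)) • ∑ i, E.T S i • Matrix.vecMulVec (E.z i) (E.z i))⁻¹.mulVec
          ((1 / (E.n₁ : ℝ)) • ∑ i, (E.T S i * E.e 1 i) • E.z i))
    + (1 / (E.n : ℝ)) * ∑ i, (((1 - E.T S i) / (1 - E.π) - 1) ^ 2
        - (E.n₁ : ℝ) / E.n₀ * ((1 - E.T S i) / (1 - E.π))) * E.P i i * E.e 0 i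
    + (E.n₁ : ℝ) / E.n₀ *
      (((1 / (E.n₀ : ℝ)) • ∑ i, ((1 - E.T S i) * E.P i i) • E.z i) ⬝ᵥ
        ((1 / (E.n₀ : ℝ)) • ∑ i, (1 - E.T S i) • Matrix.vecMulVec (E.z i) (E.z i))⁻¹.mulVec
          ((1 / (E.n₀ : ℝ)) • ∑ i, ((1 - E.T S i) * E.e 0 i) • E.z i))

/-- The bias term `B^cf`, which vanishes identically. -/
def biasCf (E : RCT) (_S : E.Assignment) : ℝ := 0

end

end RCT

/-!
Regression adjustment in a completely randomized experiment with a growing number of covariates.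

After a change of coordinates the regressors are rows `u_i` of a matrix with orthonormal columns
(`RCT.orthoDesign`), so that `P_ij = u_i' u_j`. In arm `t` put `w_i = 1{T_i = t} / P(T_i = t) - 1`.
The normal equations for the error `b` of the least squares coefficient become `(1 + X) b = g` with
`X = ∑ w_i u_i u_i'` and `g = ∑ w_i e_i u_i` (`RCT.fitError_eq`). Everything happens on the event
that `X` has operator norm at most one half; there the Gram matrices are invertible, and `b` can be
expanded in powers of `X`.

* Regression adjustment and bias correction. As the intercept is among the regressors, the error of
  `μ̂_t^adj` equals `n⁻¹ (∑ w_i e_i - s'b)` with `s = ∑ w_i u_i`, and `s'b = s'g - s'X b`. The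
  double sum `s'g` consists of the contributions of the arm to the quadratic term and to `B^adj`,
  and `|s'X b| ≤ 2 |s| |X g|` (`abs_fitted_mean_sub_le`), which is of the order
  `√p · κ · √(n ℰ₂)`. The correction in `τ̂^bc` replaces the bias term of the expansion by `B^bc`
  without any further error (`RCT.tauBc_remainder_eq`).
* Cross-fitting. The Sherman-Morrison formula expresses the leave-one-out fits by `b`, by
  `u_i'(1 + X)⁻¹ u_i` and by `e_i` (`RCT.z_dotProduct_betaLoo`). In the expansion the terms that are
  responsible for the rate `κ² p` are sums over coinciding indices, and leaving out unit `i` removes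
  them: what remains are homogeneous polynomials of degrees one to three in the weights of distinct
  units, of order `κ √(n ℰ₂)`, and terms of order `κ √(κ p) (1 + log p) √(n ℰ₂)`
  (`cf_leading_terms_eq`, `abs_cf_remainder_le`).

Two probabilistic facts about sampling without replacement carry the orders.

* Monomials of degree `k` in the weights of distinct units are nearly orthogonal: the mean of a
  product in which `r` weights occur to the first power is `O(n^{-⌈r/2⌉})`, by exchangeability and
  `∑ w_i = 0`. The Schur test then bounds the second moment of a homogeneous polynomial by the sum
  of its squared coefficients (`IsSamplingWeight.srsMean_chaos_sq_le`).
* The operator norm of `X` is `O_p(√(κ (1 + log p)))`. This is a matrix Khintchine inequality,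
  proved by Stein's method: `S` and its image under a random transposition of units form an
  exchangeable pair for which the drift of `X` is linear and the squared increments add up to at
  most a multiple of the identity, so that a mean value inequality for traces bounds the trace moments of
  `X` recursively (`IsSamplingWeight.srsMean_trace_pow_step`). A moment of order about `2 log p`
  costs a factor `p^{1/(2 log p)} = O(1)` in passing to the operator norm.

Finally `IsBigOp.of_controlled` turns deterministic inequalities between norms, valid on an event of
probability tending to one, into statements about stochastic orders.
-/

/-! ### Averages over simple random samples -/

open scoped BigOperators in
/-- The mean of `f S` when `S` is a simple random sample of `n₁` of the `n` units, drawn without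
replacement. -/
noncomputable def srsMean (n n₁ : ℕ) (f : Finset (Fin n) → ℝ) : ℝ :=
  𝔼 S ∈ Finset.powersetCard n₁ Finset.univ, f S

section srsMean

variable {n n₁ : ℕ}

lemma srsMean_add (f g : Finset (Fin n) → ℝ) :
    srsMean n n₁ (fun S => f S + g S) = srsMean n n₁ f + srsMean n n₁ g :=
  Finset.expect_add_distrib _ _ _

lemma srsMean_sum {ι : Type*} (s : Finset ι) (f : ι → Finset (Fin n) → ℝ) :
    srsMean n n₁ (fun S => ∑ i ∈ s, f i S) = ∑ i ∈ s, srsMean n n₁ (f i) :=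
  Finset.expect_sum_comm _ _ _

lemma srsMean_const_mul (c : ℝ) (f : Finset (Fin n) → ℝ) :
    srsMean n n₁ (fun S => c * f S) = c * srsMean n n₁ f :=
  (Finset.mul_expect _ _ _).symm

lemma srsMean_congr {f g : Finset (Fin n) → ℝ} (h : ∀ S, S.card = n₁ → f S = g S) :
    srsMean n n₁ f = srsMean n n₁ g :=
  Finset.expect_congr rfl fun S hS => h S (Finset.mem_powersetCard.1 hS).2

lemma srsMean_mono {f g : Finset (Fin n) → ℝ} (h : ∀ S, S.card = n₁ → f S ≤ g S) :
    srsMean n n₁ f ≤ srsMean n n₁ g :=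
  Finset.expect_le_expect fun S hS => h S (Finset.mem_powersetCard.1 hS).2

lemma srsMean_nonneg {f : Finset (Fin n) → ℝ} (h : ∀ S, S.card = n₁ → 0 ≤ f S) :
    0 ≤ srsMean n n₁ f :=
  Finset.expect_nonneg fun S hS => h S (Finset.mem_powersetCard.1 hS).2

lemma srsMean_const (h : n₁ ≤ n) (c : ℝ) : srsMean n n₁ (fun _ => c) = c :=
  Finset.expect_const (Finset.powersetCard_nonempty.2 (by simpa using h)) c

lemma abs_srsMean_le {f : Finset (Fin n) → ℝ} {c : ℝ} (hc : 0 ≤ c)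
    (h : ∀ S, S.card = n₁ → |f S| ≤ c) : |srsMean n n₁ f| ≤ c := by
  refine (Finset.abs_expect_le _ _).trans ?_
  rcases (Finset.powersetCard n₁ (Finset.univ : Finset (Fin n))).eq_empty_or_nonempty with h0 | h0
  · simp [h0, hc]
  · exact Finset.expect_le h0 fun S hS => h S (Finset.mem_powersetCard.1 hS).2

/-- The sampling law is invariant under relabelling of the units. -/
lemma srsMean_map (σ : Equiv.Perm (Fin n)) (f : Finset (Fin n) → ℝ) :
    srsMean n n₁ (fun S => f (S.map σ.toEmbedding)) = srsMean n n₁ f := by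
  refine Finset.expect_equiv (Equiv.finsetCongr σ) (fun S => ?_) (fun S _ => ?_)
  · simp [Finset.mem_powersetCard]
  · simp

end srsMean

namespace RCT

lemma law_real_eq (E : RCT) (A : Set E.Assignment) :
    E.law.real A = srsMean E.n E.n₁ (A.indicator 1) := by
  classical
  have h1 : {S : E.Assignment | S.card = E.n₁}
      = ((Finset.powersetCard E.n₁ (Finset.univ : Finset (Fin E.n)) : Finset E.Assignment)
        : Set E.Assignment) := by
    ext S; simp
  have h2 : A = ((Finset.univ.filter (· ∈ A) : Finset E.Assignment) : Set E.Assignment) := by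
    ext S; simp
  rw [Measure.real, law, h1]
  conv_lhs => rw [h2]
  rw [ProbabilityTheory.uniformOn_apply_finset, srsMean, Finset.expect_eq_sum_div_card,
    ENNReal.toReal_div]
  congr 1
  simp only [Set.indicator_apply, Pi.one_apply, ENNReal.toReal_natCast, Finset.sum_boole]
  congr 2
  ext S; simp

instance (E : RCT) : IsProbabilityMeasure E.law :=
  ProbabilityTheory.isProbabilityMeasure_uniformOn (Set.toFinite _) (by
    obtain ⟨S, hS⟩ := Finset.powersetCard_nonempty.2
      (show E.n₁ ≤ (Finset.univ : Finset (Fin E.n)).card by simpa using E.n₁_lt.le)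
    exact ⟨S, (Finset.mem_powersetCard.1 hS).2⟩)

/-- Markov's inequality. -/
lemma mul_law_real_le (E : RCT) {V : E.Assignment → ℝ} (hV : ∀ S, 0 ≤ V S) (c : ℝ) :
    c * E.law.real {S | c < V S} ≤ srsMean E.n E.n₁ V := by
  rw [law_real_eq, ← srsMean_const_mul]
  refine srsMean_mono fun S _ => ?_
  by_cases h : S ∈ {S | c < V S}
  · simpa [h] using le_of_lt h
  · simpa [h] using hV S

end RCT

/-! ### Stochastic orders -/

section IsBigOp

variable {Ω : ℕ → Type*} [∀ m, MeasurableSpace (Ω m)] {μ : ∀ m, Measure (Ω m)}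
  [∀ m, IsProbabilityMeasure (μ m)]

/-- Finitely many stochastic orders hold simultaneously, with one constant `M`, with probability
close to one. So if `|X| ≤ C(M) a` follows, on an event whose probability tends to one, from the
bounds `|V k| ≤ M r k`, then `X = O_p(a)`. -/
theorem IsBigOp.of_controlled {ι : Type*} [Fintype ι] {V : ι → ∀ m, Ω m → ℝ} {r : ι → ℕ → ℝ}
    {good : ∀ m, Set (Ω m)} (hgood : Tendsto (fun m => (μ m).real (good m)ᶜ) atTop (𝓝 0))
    (hr : ∀ k m, 0 ≤ r k m) (hV : ∀ k, IsBigOp μ (V k) (r k))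
    {X : ∀ m, Ω m → ℝ} {a : ℕ → ℝ}
    (h : ∀ M : ℝ, 1 ≤ M → ∃ C : ℝ, 0 < C ∧ ∀ᶠ m in atTop, ∀ ω ∈ good m,
      (∀ k, |V k m ω| ≤ M * r k m) → |X m ω| ≤ C * a m) :
    IsBigOp μ X a := by
  intro ε hε
  set δ : ℝ := ε / (2 * (Fintype.card ι + 1)) with hδ
  have hδpos : 0 < δ := by positivity
  choose B hB hBev using fun k => hV k δ hδpos
  set M : ℝ := 1 + ∑ k, B k with hM
  have hBM : ∀ k, B k ≤ M := fun k => by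
    have := Finset.single_le_sum (f := B) (fun i _ => (hB i).le) (Finset.mem_univ k)
    linarith
  have hM1 : 1 ≤ M := by
    have := Finset.sum_nonneg (s := Finset.univ) (f := B) (fun i _ => (hB i).le)
    linarith
  obtain ⟨C, hC, hCev⟩ := h M hM1
  refine ⟨C, hC, ?_⟩
  have hg : ∀ᶠ m in atTop, (μ m).real (good m)ᶜ < ε / 2 :=
    hgood.eventually (gt_mem_nhds (by positivity))
  filter_upwards [hCev, hg, eventually_all.2 hBev] with m h1 h2 h3
  have hsub : {ω | C * a m < |X m ω|}
      ⊆ (good m)ᶜ ∪ ⋃ k ∈ (Finset.univ : Finset ι), {ω | B k * r k m < |V k m ω|} := by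
    intro ω hω
    by_contra hcon
    simp only [Set.mem_union, Set.mem_compl_iff, Set.mem_iUnion, not_or, not_not, not_exists,
      Set.mem_ofPred_eq, not_lt, Finset.mem_univ, true_imp_iff] at hcon
    refine absurd (h1 ω hcon.1 fun k => (hcon.2 k).trans ?_) (not_le.2 hω)
    exact mul_le_mul_of_nonneg_right (hBM k) (hr k m)
  calc (μ m).real {ω | C * a m < |X m ω|}
      ≤ (μ m).real ((good m)ᶜ ∪ ⋃ k ∈ (Finset.univ : Finset ι), {ω | B k * r k m < |V k m ω|}) :=
        measureReal_mono hsub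
    _ ≤ (μ m).real (good m)ᶜ
        + (μ m).real (⋃ k ∈ (Finset.univ : Finset ι), {ω | B k * r k m < |V k m ω|}) :=
        measureReal_union_le _ _
    _ ≤ ε / 2 + ∑ k : ι, δ := by
        refine add_le_add h2.le ((measureReal_biUnion_finset_le _ _).trans ?_)
        exact Finset.sum_le_sum fun k _ => h3 k
    _ ≤ ε := by
        rw [Finset.sum_const, Finset.card_univ, nsmul_eq_mul, hδ]
        have : (Fintype.card ι : ℝ) * (ε / (2 * (Fintype.card ι + 1))) ≤ ε / 2 := by
          rw [mul_div_assoc', div_le_div_iff₀ (by positivity) (by norm_num)]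
          nlinarith
        linarith

lemma IsBigOp.sub {X Y : ∀ m, Ω m → ℝ} {a : ℕ → ℝ} (ha : ∀ m, 0 ≤ a m)
    (hX : IsBigOp μ X a) (hY : IsBigOp μ Y a) : IsBigOp μ (fun m ω => X m ω - Y m ω) a := by
  refine IsBigOp.of_controlled (V := fun k : Bool => if k then X else Y) (r := fun _ => a)
    (good := fun _ => Set.univ) (by simp) (fun _ => ha) (fun k => by cases k <;> simpa)
    (fun M hM => ⟨2 * M, by linarith, Eventually.of_forall fun m ω _ hb => ?_⟩)
  have h1 := hb true
  have h2 := hb false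
  simp only [if_true, Bool.false_eq_true, if_false] at h1 h2
  calc |X m ω - Y m ω| ≤ |X m ω| + |Y m ω| := abs_sub _ _
    _ ≤ 2 * M * a m := by linarith

end IsBigOp

/-- Chebyshev's inequality: a bound on second moments gives a stochastic order. -/
lemma isBigOp_of_srsMean_sq_le {E : ℕ → RCT} {X : ∀ m, (E m).Assignment → ℝ} {a : ℕ → ℝ} {C : ℝ}
    (h : ∀ᶠ m in atTop, srsMean (E m).n (E m).n₁ (fun S => X m S ^ 2) ≤ C * a m ^ 2)
    (ha : ∀ m, 0 ≤ a m) :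
    IsBigOp (fun m => (E m).law) X a := by
  intro ε hε
  set M : ℝ := √((|C| + 1) / ε) with hM
  have hMpos : 0 < M := Real.sqrt_pos.2 (by positivity)
  have hM2 : M ^ 2 = (|C| + 1) / ε := Real.sq_sqrt (by positivity)
  refine ⟨M, hMpos, ?_⟩
  filter_upwards [h] with m hm
  rcases (ha m).eq_or_lt with h0 | h0
  · -- for `a m = 0` the second moment vanishes, so `X m` vanishes on all assignments
    have hz : srsMean (E m).n (E m).n₁ (fun S => X m S ^ 2) = 0 :=
      le_antisymm (by simpa [← h0] using hm) (srsMean_nonneg fun S _ => sq_nonneg _)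
    have hz' := (Finset.expect_eq_zero_iff_of_nonneg (fun S _ => sq_nonneg (X m S))).1 hz
    rw [RCT.law_real_eq]
    refine le_trans (le_of_eq ?_) hε.le
    refine Finset.expect_eq_zero fun S hS => ?_
    have : X m S = 0 := by simpa using hz' S hS
    simp [this, ← h0]
  · have hset : {S | M * a m < |X m S|} ⊆ {S | M ^ 2 * a m ^ 2 < X m S ^ 2} := by
      intro S hS
      have : (M * a m) ^ 2 < |X m S| ^ 2 := by
        exact pow_lt_pow_left₀ hS (by positivity) (by norm_num)
      simpa [mul_pow] using this
    have h1 := (E m).mul_law_real_le (V := fun S => X m S ^ 2) (fun S => sq_nonneg _)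
      (M ^ 2 * a m ^ 2)
    have h2 : M ^ 2 * a m ^ 2 * (E m).law.real {S | M ^ 2 * a m ^ 2 < X m S ^ 2}
        ≤ M ^ 2 * a m ^ 2 * ε := by
      refine (h1.trans hm).trans ?_
      have : M ^ 2 * a m ^ 2 * ε = (|C| + 1) * a m ^ 2 := by rw [hM2]; field_simp
      rw [this]
      exact mul_le_mul_of_nonneg_right (by linarith [le_abs_self C]) (sq_nonneg _)
    exact (measureReal_mono hset).trans (le_of_mul_le_mul_left h2 (by positivity))

/-! ### Polynomial chaos in the sampling weights -/

/-- Random weights `w S i` attached to the units, which are equivariant under relabelling (it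
suffices to ask this for transpositions), add up to zero and are bounded by `K`. -/
structure IsSamplingWeight (n n₁ : ℕ) (w : Finset (Fin n) → Fin n → ℝ) (K : ℝ) : Prop where
  map_swap : ∀ i j S k, w (S.map (Equiv.swap i j).toEmbedding) k = w S (Equiv.swap i j k)
  sum_eq_zero : ∀ S, S.card = n₁ → ∑ i, w S i = 0
  abs_le : ∀ S i, |w S i| ≤ K

namespace IsSamplingWeight

variable {n n₁ : ℕ} {w : Finset (Fin n) → Fin n → ℝ} {K : ℝ}

/-- A product of `b` weights of distinct units, times a bounded function of the weights of the units
of a set `A` disjoint from them, has mean of order `n ^ (-⌈b / 2⌉)`. The weight of one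
of the `b` units can be replaced by minus the sum of the weights of the other units, divided by
their number; of that sum, exchangeability leaves only the terms in `A` and in the remaining
`b - 1` units, and the latter create a square and so use up a second unit. -/
theorem abs_srsMean_prod_le (hw : IsSamplingWeight n n₁ w K) (hK : 1 ≤ K) {N : ℕ} (hN : 1 ≤ N)
    (hn : 2 * N ≤ n) (b : ℕ) :
    ∀ (A B : Finset (Fin n)) (F : Finset (Fin n) → ℝ) (L : ℝ), 0 ≤ L → B.card = b →
      Disjoint A B → A.card + b ≤ N → (∀ S, |F S| ≤ L) →
      (∀ i j, i ∉ A → j ∉ A → ∀ S, F (S.map (Equiv.swap i j).toEmbedding) = F S) →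
      |srsMean n n₁ (fun S => F S * ∏ i ∈ B, w S i)|
        ≤ L * (2 * N * K ^ 2) ^ b / (n : ℝ) ^ ((b + 1) / 2) := by
  induction b using Nat.strong_induction_on with
  | _ b ih =>
  intro A B F L hL hB hAB hAb hF hinv
  have hnpos : (0 : ℝ) < n := by
    have : 0 < n := by omega
    exact_mod_cast this
  have hn1 : (1 : ℝ) ≤ n := by
    have : 1 ≤ n := by omega
    exact_mod_cast this
  have hN1 : (1 : ℝ) ≤ N := by exact_mod_cast hN
  set D : ℝ := 2 * N * K ^ 2 with hD
  have hK2 : 1 ≤ K ^ 2 := one_le_pow₀ hK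
  have hKK : K ≤ K ^ 2 := by nlinarith
  have hD1 : 1 ≤ D := by nlinarith
  rcases B.eq_empty_or_nonempty with rfl | ⟨i, hi⟩
  · have : b = 0 := by simpa using hB.symm
    subst this
    simpa using abs_srsMean_le hL fun S _ => hF S
  obtain ⟨b', rfl⟩ : ∃ b', b = b' + 1 := by
    have := Finset.card_pos.2 ⟨i, hi⟩
    exact ⟨b - 1, by omega⟩
  set B' := B.erase i with hB'
  have hB'card : B'.card = b' := by rw [hB', Finset.card_erase_of_mem hi, hB]; rfl
  have hiB' : i ∉ B' := Finset.notMem_erase i B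
  have hAB' : Disjoint A B' := hAB.mono_right (Finset.erase_subset _ _)
  have hiA : i ∉ A := fun h => Finset.disjoint_left.1 hAB h hi
  set h : ℝ := srsMean n n₁ (fun S => F S * ∏ k ∈ B, w S k) with hh
  -- all units outside `A ∪ B'` play the same role as `i`
  have hex : ∀ j, j ∉ A ∪ B' →
      srsMean n n₁ (fun S => F S * (∏ k ∈ B', w S k) * w S j) = h := by
    intro j hj
    rw [Finset.mem_union, not_or] at hj
    rw [hh, ← srsMean_map (Equiv.swap i j)]
    refine srsMean_congr fun S _ => ?_
    rw [hinv i j hiA hj.1, hw.map_swap, Equiv.swap_apply_right, ← Finset.mul_prod_erase B _ hi,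
      mul_assoc, mul_comm (w S i)]
    congr 2
    refine Finset.prod_congr rfl fun k hk => ?_
    rw [hw.map_swap, Equiv.swap_apply_of_ne_of_ne]
    · exact fun h => hiB' (h ▸ hk)
    · exact fun h => hj.2 (h ▸ hk)
  have hdisj : Disjoint (A ∪ B')ᶜ (A ∪ B') := disjoint_compl_left
  have hzero : ∑ j, srsMean n n₁ (fun S => F S * (∏ k ∈ B', w S k) * w S j) = 0 := by
    rw [← srsMean_sum]
    have : srsMean n n₁ (fun S => ∑ j, F S * (∏ k ∈ B', w S k) * w S j)
        = srsMean n n₁ (fun _ => (0 : ℝ)) := by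
      refine srsMean_congr fun S hS => ?_
      rw [← Finset.mul_sum, hw.sum_eq_zero S hS, mul_zero]
    rw [this]; simp [srsMean]
  have hsplit : ((A ∪ B')ᶜ.card : ℝ) * h
      + (srsMean n n₁ (fun S => (F S * ∑ j ∈ A, w S j) * ∏ k ∈ B', w S k)
        + ∑ j ∈ B', srsMean n n₁ (fun S => (F S * w S j ^ 2) * ∏ k ∈ B'.erase j, w S k)) = 0 := by
    rw [← hzero, ← Finset.sum_compl_add_sum (A ∪ B'), Finset.sum_union hAB',
      Finset.sum_congr rfl fun j hj => hex j (Finset.mem_compl.1 hj), Finset.sum_const,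
      nsmul_eq_mul]
    congr 2
    · rw [← srsMean_sum]
      refine srsMean_congr fun S _ => ?_
      rw [← Finset.mul_sum]; ring
    · refine Finset.sum_congr rfl fun j hj => srsMean_congr fun S _ => ?_
      rw [← Finset.mul_prod_erase B' _ hj]; ring
  -- the number of units outside `A ∪ B'` is of order `n`
  have hcard : (n : ℝ) / 2 ≤ ((A ∪ B')ᶜ.card : ℝ) := by
    have h1 : (A ∪ B').card = A.card + b' := by rw [Finset.card_union_of_disjoint hAB', hB'card]
    have h2 : (A ∪ B')ᶜ.card = n - (A.card + b') := by
      rw [Finset.card_compl, h1, Fintype.card_fin]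
    have h3 : n ≤ 2 * (A ∪ B')ᶜ.card := by rw [h2]; omega
    have h4 : (n : ℝ) ≤ 2 * ((A ∪ B')ᶜ.card : ℝ) := by exact_mod_cast h3
    linarith
  have hwK : ∀ S j, w S j ^ 2 ≤ K ^ 2 := fun S j => by
    rw [← sq_abs]; exact pow_le_pow_left₀ (abs_nonneg _) (hw.abs_le S j) 2
  have e1 : (b' + 1 + 1) / 2 = b' / 2 + 1 := by omega
  -- the terms of `A`
  have hT1 : |srsMean n n₁ (fun S => (F S * ∑ j ∈ A, w S j) * ∏ k ∈ B', w S k)|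
      ≤ A.card * (L * K ^ 2 * D ^ b' / (n : ℝ) ^ (b' / 2)) := by
    refine (ih b' (by omega) A B' _ (L * (A.card * K)) (by positivity) hB'card hAB' (by omega)
      (fun S => ?_) (fun k l hk hl S => ?_)).trans ?_
    · rw [abs_mul]
      refine mul_le_mul (hF S) ((Finset.abs_sum_le_sum_abs _ _).trans ?_) (abs_nonneg _) hL
      rw [← nsmul_eq_mul]
      exact Finset.sum_le_card_nsmul _ _ _ fun j _ => hw.abs_le S j
    · rw [hinv k l hk hl]
      congr 1
      refine Finset.sum_congr rfl fun j hj => ?_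
      rw [hw.map_swap, Equiv.swap_apply_of_ne_of_ne]
      · exact fun h => hk (h ▸ hj)
      · exact fun h => hl (h ▸ hj)
    · calc L * (A.card * K) * D ^ b' / (n : ℝ) ^ ((b' + 1) / 2)
          ≤ L * (A.card * K ^ 2) * D ^ b' / (n : ℝ) ^ (b' / 2) := by
            gcongr
            omega
        _ = _ := by ring
  -- the terms of `B'`
  have hT2 : ∀ j ∈ B', |srsMean n n₁ (fun S => (F S * w S j ^ 2) * ∏ k ∈ B'.erase j, w S k)|
      ≤ L * K ^ 2 * D ^ b' / (n : ℝ) ^ (b' / 2) := by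
    intro j hj
    obtain ⟨c, rfl⟩ : ∃ c, b' = c + 1 := by
      have := Finset.card_pos.2 ⟨j, hj⟩
      exact ⟨b' - 1, by omega⟩
    have hjA : j ∉ A := fun h => Finset.disjoint_left.1 hAB' h hj
    refine (ih c (by omega) (insert j A) (B'.erase j) _ (L * K ^ 2) (by positivity) ?_ ?_ ?_
      (fun S => ?_) (fun k l hk hl S => ?_)).trans ?_
    · rw [Finset.card_erase_of_mem hj, hB'card]; rfl
    · rw [Finset.disjoint_insert_left]
      exact ⟨Finset.notMem_erase j B', hAB'.mono_right (Finset.erase_subset _ _)⟩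
    · rw [Finset.card_insert_of_notMem hjA]; omega
    · rw [abs_mul, abs_of_nonneg (sq_nonneg (w S j))]
      exact mul_le_mul (hF S) (hwK S j) (sq_nonneg _) hL
    · rw [Finset.mem_insert, not_or] at hk hl
      rw [hinv k l hk.2 hl.2, hw.map_swap, Equiv.swap_apply_of_ne_of_ne]
      · exact fun h => hk.1 h.symm
      · exact fun h => hl.1 h.symm
    · gcongr
      omega
  have hsum : |srsMean n n₁ (fun S => (F S * ∑ j ∈ A, w S j) * ∏ k ∈ B', w S k)
        + ∑ j ∈ B', srsMean n n₁ (fun S => (F S * w S j ^ 2) * ∏ k ∈ B'.erase j, w S k)|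
      ≤ N * (L * K ^ 2 * D ^ b' / (n : ℝ) ^ (b' / 2)) := by
    have hs2 := (Finset.abs_sum_le_sum_abs (fun j => srsMean n n₁ (fun S =>
      (F S * w S j ^ 2) * ∏ k ∈ B'.erase j, w S k)) B').trans
      (Finset.sum_le_card_nsmul _ _ _ hT2)
    rw [nsmul_eq_mul, hB'card] at hs2
    refine (abs_add_le _ _).trans ((add_le_add hT1 hs2).trans ?_)
    rw [← add_mul]
    refine mul_le_mul_of_nonneg_right ?_ (by positivity)
    have : A.card + b' ≤ N := by omega
    exact_mod_cast this
  have hfin : (n : ℝ) / 2 * |h| ≤ N * (L * K ^ 2 * D ^ b' / (n : ℝ) ^ (b' / 2)) := by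
    refine le_trans ?_ hsum
    rw [← abs_neg (_ + _), ← eq_neg_of_add_eq_zero_left hsplit, abs_mul, Nat.abs_cast]
    exact mul_le_mul_of_nonneg_right hcard (abs_nonneg _)
  rw [e1, pow_succ, pow_succ, le_div_iff₀ (by positivity)]
  rw [mul_div_assoc', le_div_iff₀ (by positivity)] at hfin
  calc |h| * ((n : ℝ) ^ (b' / 2) * n) = 2 * ((n : ℝ) / 2 * |h| * (n : ℝ) ^ (b' / 2)) := by ring
    _ ≤ 2 * (N * (L * K ^ 2 * D ^ b')) := by gcongr
    _ = L * (D ^ b' * D) := by rw [hD]; ring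

/-- The Gram matrix of the monomials of degree `k` in the weights: the entry of two tuples of
distinct units is of order `n ^ (-r)`, where `r` counts the units of the second tuple that
are not in the first. -/
lemma abs_srsMean_prod_mul_prod_le (hw : IsSamplingWeight n n₁ w K) (hK : 1 ≤ K) {k : ℕ}
    (hk : 1 ≤ k) (hn : 4 * k ≤ n) {I J : Fin k → Fin n} (hI : Function.Injective I)
    (hJ : Function.Injective J) :
    |srsMean n n₁ (fun S => (∏ r, w S (I r)) * ∏ r, w S (J r))|
      ≤ (K ^ (2 * k) * (4 * k * K ^ 2) ^ (2 * k))
        * ∏ r, (if J r ∈ Finset.univ.image I then (1 : ℝ) else 1 / n) := by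
  classical
  set P := Finset.univ.image I with hP
  set Q := Finset.univ.image J with hQ
  have hPc : P.card = k := by rw [hP, Finset.card_image_of_injective _ hI]; simp
  have hQc : Q.card = k := by rw [hQ, Finset.card_image_of_injective _ hJ]; simp
  have hk1 : (1 : ℝ) ≤ k := by exact_mod_cast hk
  have hn1 : (1 : ℝ) ≤ n := by
    have : 1 ≤ n := by omega
    exact_mod_cast this
  set A := P ∩ Q with hA
  set B := (P \ Q) ∪ (Q \ P) with hB
  set r := (Q \ P).card with hr
  have hPQ : (P \ Q).card = r := by
    have h1 := Finset.card_sdiff_add_card_inter P Q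
    have h2 := Finset.card_sdiff_add_card_inter Q P
    rw [Finset.inter_comm] at h2
    omega
  have hd : Disjoint (P \ Q) (Q \ P) := disjoint_sdiff_sdiff
  have hBc : B.card = 2 * r := by
    rw [hB, Finset.card_union_of_disjoint hd, hPQ]; omega
  have hAc : A.card + r = k := by
    have h2 := Finset.card_sdiff_add_card_inter Q P
    rw [Finset.inter_comm, ← hA] at h2
    omega
  have hprod : ∀ S, (∏ r, w S (I r)) * ∏ r, w S (J r)
      = (∏ i ∈ A, w S i ^ 2) * ∏ i ∈ B, w S i := by
    intro S
    have h1 : ∏ r, w S (I r) = ∏ i ∈ P, w S i := by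
      rw [hP, Finset.prod_image fun a _ b _ h => hI h]
    have h2 : ∏ r, w S (J r) = ∏ i ∈ Q, w S i := by
      rw [hQ, Finset.prod_image fun a _ b _ h => hJ h]
    rw [h1, h2, ← Finset.prod_inter_mul_prod_sdiff P Q, ← Finset.prod_inter_mul_prod_sdiff Q P,
      Finset.inter_comm Q P, hB, Finset.prod_union hd, Finset.prod_pow]
    ring
  have hmain := hw.abs_srsMean_prod_le hK (N := 2 * k) (by omega) (by omega) (2 * r) A B
    (fun S => ∏ i ∈ A, w S i ^ 2) (K ^ (2 * k)) (by positivity) hBc ?_ (by omega) (fun S => ?_)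
    (fun i j hi hj S => ?_)
  rotate_left
  · rw [hA, hB, Finset.disjoint_union_right]
    exact ⟨Finset.disjoint_left.2 fun x hx hx' => (Finset.mem_sdiff.1 hx').2
        (Finset.mem_inter.1 hx).2, Finset.disjoint_left.2 fun x hx hx' =>
        (Finset.mem_sdiff.1 hx').2 (Finset.mem_inter.1 hx).1⟩
  · rw [Finset.abs_prod]
    calc ∏ i ∈ A, |w S i ^ 2| ≤ ∏ _i ∈ A, K ^ 2 := by
          refine Finset.prod_le_prod (fun _ _ => abs_nonneg _) fun i _ => ?_
          rw [abs_pow]; exact pow_le_pow_left₀ (abs_nonneg _) (hw.abs_le S i) 2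
      _ = K ^ (2 * A.card) := by rw [Finset.prod_const, pow_mul]
      _ ≤ K ^ (2 * k) := pow_le_pow_right₀ hK (by omega)
  · refine Finset.prod_congr rfl fun a ha => ?_
    rw [hw.map_swap, Equiv.swap_apply_of_ne_of_ne]
    · exact fun h => hi (h ▸ ha)
    · exact fun h => hj (h ▸ ha)
  rw [srsMean_congr fun S _ => hprod S]
  refine hmain.trans ?_
  have e2 : (2 * r + 1) / 2 = r := by omega
  have hcount : ∏ s, (if J s ∈ P then (1 : ℝ) else 1 / n) = 1 / (n : ℝ) ^ r := by
    have : ∏ s, (if J s ∈ P then (1 : ℝ) else 1 / n) = ∏ j ∈ Q, (if j ∈ P then (1 : ℝ) else 1 / n) := by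
      rw [hQ, Finset.prod_image fun a _ b _ h => hJ h]
    rw [this, Finset.prod_ite, Finset.prod_const_one, one_mul, Finset.prod_const,
      ← Finset.sdiff_eq_filter, div_pow, one_pow]
  rw [hcount, e2]
  push_cast
  rw [mul_one_div]
  have hD1 : (1 : ℝ) ≤ 4 * k * K ^ 2 := by
    have : 1 ≤ K ^ 2 := one_le_pow₀ hK
    nlinarith
  calc K ^ (2 * k) * (2 * (2 * (k : ℝ)) * K ^ 2) ^ (2 * r) / (n : ℝ) ^ r
      = K ^ (2 * k) * (4 * (k : ℝ) * K ^ 2) ^ (2 * r) / (n : ℝ) ^ r := by ring_nf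
    _ ≤ _ := by
      gcongr
      omega

/-- **Second moment of a homogeneous chaos.** Up to a constant, monomials of degree `k` in the
weights of distinct units behave as if they were orthonormal: this is the Schur test for their
Gram matrix, each row of which has a bounded sum. -/
theorem srsMean_chaos_sq_le (hw : IsSamplingWeight n n₁ w K) (hK : 1 ≤ K) {k : ℕ} (hk : 1 ≤ k)
    (hn : 4 * k ≤ n) (c : (Fin k → Fin n) → ℝ) (hc : ∀ I, ¬ Function.Injective I → c I = 0) :
    srsMean n n₁ (fun S => (∑ I, c I * ∏ r, w S (I r)) ^ 2)
      ≤ (K ^ (2 * k) * (4 * k * K ^ 2) ^ (2 * k) * (k + 1) ^ k) * ∑ I, c I ^ 2 := by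
  classical
  set G : (Fin k → Fin n) → (Fin k → Fin n) → ℝ := fun I J =>
    srsMean n n₁ (fun S => (∏ r, w S (I r)) * ∏ r, w S (J r)) with hG
  set C₀ : ℝ := K ^ (2 * k) * (4 * k * K ^ 2) ^ (2 * k) with hC₀
  have hC₀pos : 0 ≤ C₀ := by positivity
  have hnpos : (0 : ℝ) < n := by
    have : 0 < n := by omega
    exact_mod_cast this
  have hsymm : ∀ I J, G I J = G J I := fun I J =>
    srsMean_congr fun S _ => mul_comm _ _
  have hrow : ∀ I, ∑ J with Function.Injective J, (if Function.Injective I then |G I J| else 0)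
      ≤ C₀ * (k + 1) ^ k := by
    intro I
    by_cases hI : Function.Injective I
    · set P := Finset.univ.image I
      have hPc : P.card = k := by rw [Finset.card_image_of_injective _ hI]; simp
      set φ : Fin n → ℝ := fun j => if j ∈ P then (1 : ℝ) else 1 / n with hφ
      have hφ0 : ∀ j, 0 ≤ φ j := fun j => by rw [hφ]; dsimp only; split_ifs <;> positivity
      have hφsum : ∑ j, φ j ≤ k + 1 := by
        rw [hφ, Finset.sum_ite, Finset.sum_const, Finset.sum_const]
        refine add_le_add (by simp [hPc]) ?_
        rw [nsmul_eq_mul, mul_one_div, div_le_one hnpos]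
        exact_mod_cast (Finset.card_le_univ _).trans (by simp)
      calc ∑ J with Function.Injective J, (if Function.Injective I then |G I J| else 0)
          ≤ ∑ J with Function.Injective J, C₀ * ∏ r : Fin k, φ (J r) := by
            refine Finset.sum_le_sum fun J hJ => ?_
            rw [if_pos hI]
            exact hw.abs_srsMean_prod_mul_prod_le hK hk hn hI (Finset.mem_filter.1 hJ).2
        _ ≤ ∑ J : Fin k → Fin n, C₀ * ∏ r : Fin k, φ (J r) :=
            Finset.sum_le_sum_of_subset_of_nonneg (Finset.filter_subset _ _) fun J _ _ =>
              mul_nonneg hC₀pos (Finset.prod_nonneg fun r _ => hφ0 _)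
        _ = C₀ * (∑ j, φ j) ^ k := by
            rw [← Finset.mul_sum]
            congr 1
            have := Finset.prod_univ_sum (fun _ : Fin k => (Finset.univ : Finset (Fin n)))
              (fun _ j => φ j)
            rw [Finset.prod_const, Finset.card_univ, Fintype.card_fin] at this
            rw [this, Fintype.piFinset_univ]
        _ ≤ C₀ * (k + 1) ^ k := by
            gcongr
    · simp only [if_neg hI, Finset.sum_const_zero]
      positivity
  have hexp : srsMean n n₁ (fun S => (∑ I, c I * ∏ r, w S (I r)) ^ 2)
      = ∑ I, ∑ J, c I * c J * G I J := by
    simp_rw [sq, Finset.sum_mul_sum]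
    rw [srsMean_sum]
    refine Finset.sum_congr rfl fun I _ => ?_
    rw [srsMean_sum]
    refine Finset.sum_congr rfl fun J _ => ?_
    rw [hG]; dsimp only
    rw [← srsMean_const_mul]
    exact srsMean_congr fun S _ => by ring
  set U : Finset (Fin k → Fin n) := Finset.univ.filter Function.Injective with hU
  have hres : ∀ f : (Fin k → Fin n) → ℝ, (∀ I, ¬ Function.Injective I → f I = 0) →
      ∑ I, f I = ∑ I ∈ U, f I := by
    intro f hf
    rw [hU, Finset.sum_filter]
    exact Finset.sum_congr rfl fun I _ => by
      by_cases h : Function.Injective I <;> simp [h, hf]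
  rw [hexp, hres _ fun I hI => by simp [hc I hI], hres (fun I => c I ^ 2) fun I hI => by
    simp [hc I hI]]
  have hstep : ∀ I ∈ U, ∑ J, c I * c J * G I J
      ≤ ∑ J ∈ U, (c I ^ 2 / 2 * |G I J| + c J ^ 2 / 2 * |G I J|) := by
    intro I _
    rw [hres _ fun J hJ => by simp [hc J hJ]]
    refine Finset.sum_le_sum fun J _ => ?_
    have h1 : c I * c J * G I J ≤ |c I| * |c J| * |G I J| := by
      rw [← abs_mul, ← abs_mul]; exact le_abs_self _
    have h2 : |c I| * |c J| ≤ c I ^ 2 / 2 + c J ^ 2 / 2 := by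
      have := two_mul_le_add_sq |c I| |c J|
      rw [sq_abs, sq_abs] at this
      linarith
    calc _ ≤ _ := h1
      _ ≤ (c I ^ 2 / 2 + c J ^ 2 / 2) * |G I J| := mul_le_mul_of_nonneg_right h2 (abs_nonneg _)
      _ = _ := add_mul _ _ _
  have hrow' : ∀ I ∈ U, ∑ J ∈ U, |G I J| ≤ C₀ * (k + 1) ^ k := fun I hI => by
    have := hrow I
    simpa [(Finset.mem_filter.1 hI).2] using this
  calc ∑ I ∈ U, ∑ J, c I * c J * G I J
      ≤ ∑ I ∈ U, ∑ J ∈ U, (c I ^ 2 / 2 * |G I J| + c J ^ 2 / 2 * |G I J|) :=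
        Finset.sum_le_sum hstep
    _ = ∑ I ∈ U, ∑ J ∈ U, c I ^ 2 / 2 * |G I J| + ∑ I ∈ U, ∑ J ∈ U, c J ^ 2 / 2 * |G I J| := by
        simp_rw [Finset.sum_add_distrib]
    _ = ∑ I ∈ U, c I ^ 2 * ∑ J ∈ U, |G I J| := by
        rw [Finset.sum_comm (f := fun I J => c J ^ 2 / 2 * |G I J|), ← Finset.sum_add_distrib]
        refine Finset.sum_congr rfl fun I _ => ?_
        rw [Finset.mul_sum, ← Finset.sum_add_distrib]
        refine Finset.sum_congr rfl fun J _ => ?_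
        rw [hsymm J I]; ring
    _ ≤ ∑ I ∈ U, c I ^ 2 * (C₀ * (k + 1) ^ k) :=
        Finset.sum_le_sum fun I hI => mul_le_mul_of_nonneg_left (hrow' I hI) (sq_nonneg _)
    _ = _ := by rw [← Finset.sum_mul, mul_comm]

/-- The constant in the second moment bound for a chaos of degree `k` in weights bounded by `K`. -/
noncomputable def chaosConst (K : ℝ) (k : ℕ) : ℝ :=
  K ^ (2 * k) * (4 * k * K ^ 2) ^ (2 * k) * (k + 1) ^ k

lemma _root_.Fin.sum_arrow_succ {M : Type*} [AddCommMonoid M] {k n : ℕ}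
    (f : (Fin (k + 1) → Fin n) → M) : ∑ I, f I = ∑ i, ∑ I, f (Fin.cons i I) := by
  rw [← Fintype.sum_prod_type']
  exact (Fintype.sum_equiv (Fin.consEquiv fun _ => Fin n) _ _ fun _ => rfl).symm

lemma srsMean_linear_sq_le (hw : IsSamplingWeight n n₁ w K) (hK : 1 ≤ K) (hn : 12 ≤ n)
    (c : Fin n → ℝ) :
    srsMean n n₁ (fun S => (∑ i, c i * w S i) ^ 2) ≤ chaosConst K 1 * ∑ i, c i ^ 2 := by
  have := hw.srsMean_chaos_sq_le hK (k := 1) le_rfl (by omega) (fun I => c (I 0))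
    (fun I hI => absurd (Function.injective_of_subsingleton I) hI)
  simpa [Fin.sum_arrow_succ, chaosConst] using this

lemma srsMean_quadratic_sq_le (hw : IsSamplingWeight n n₁ w K) (hK : 1 ≤ K) (hn : 12 ≤ n)
    (c : Fin n → Fin n → ℝ) (hc : ∀ i, c i i = 0) :
    srsMean n n₁ (fun S => (∑ i, ∑ j, c i j * (w S i * w S j)) ^ 2)
      ≤ chaosConst K 2 * ∑ i, ∑ j, c i j ^ 2 := by
  have := hw.srsMean_chaos_sq_le hK (k := 2) (by omega) (by omega) (fun I => c (I 0) (I 1))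
    (fun I hI => by
      by_contra h
      refine hI fun a b hab => ?_
      fin_cases a <;> fin_cases b <;> simp_all)
  simpa [Fin.sum_arrow_succ, chaosConst, Fin.prod_univ_two] using this

lemma srsMean_cubic_sq_le (hw : IsSamplingWeight n n₁ w K) (hK : 1 ≤ K) (hn : 12 ≤ n)
    (c : Fin n → Fin n → Fin n → ℝ) (hc₁ : ∀ i j, c i i j = 0) (hc₂ : ∀ i j, c i j j = 0)
    (hc₃ : ∀ i j, c i j i = 0) :
    srsMean n n₁ (fun S => (∑ i, ∑ j, ∑ l, c i j l * (w S i * w S j * w S l)) ^ 2)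
      ≤ chaosConst K 3 * ∑ i, ∑ j, ∑ l, c i j l ^ 2 := by
  have := hw.srsMean_chaos_sq_le hK (k := 3) (by omega) (by omega)
    (fun I => c (I 0) (I 1) (I 2))
    (fun I hI => by
      by_contra h
      refine hI fun a b hab => ?_
      fin_cases a <;> fin_cases b <;> simp_all)
  have e : ∀ x y z : Fin n, (Fin.cons x (Fin.cons y (Fin.cons z default)) : Fin 3 → Fin n) 2 = z :=
    fun _ _ _ => rfl
  simpa [Fin.sum_arrow_succ, chaosConst, Fin.prod_univ_three, e] using this

end IsSamplingWeight

/-! ### Euclidean vectors and symmetric matrices -/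

/-- The Euclidean norm of a vector of coordinates. -/
noncomputable def euNorm {ι : Type*} [Fintype ι] (v : ι → ℝ) : ℝ := ‖WithLp.toLp 2 v‖

/-- The operator norm of a matrix with respect to Euclidean norms. -/
noncomputable def euOpNorm {k : ℕ} (A : Matrix (Fin k) (Fin k) ℝ) : ℝ :=
  ‖Matrix.toEuclideanCLM (n := Fin k) (𝕜 := ℝ) A‖

section euNorm

variable {ι : Type*} [Fintype ι]

lemma euNorm_nonneg (v : ι → ℝ) : 0 ≤ euNorm v := norm_nonneg _

lemma euNorm_sq (v : ι → ℝ) : euNorm v ^ 2 = ∑ i, v i ^ 2 := by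
  rw [euNorm, EuclideanSpace.norm_sq_eq]; simp

lemma euNorm_sq' (v : ι → ℝ) : euNorm v ^ 2 = v ⬝ᵥ v := by
  rw [euNorm_sq, dotProduct]; exact Finset.sum_congr rfl fun i _ => sq _

lemma euNorm_le_of_sq_le {v : ι → ℝ} {c : ℝ} (hc : 0 ≤ c) (h : ∑ i, v i ^ 2 ≤ c ^ 2) :
    euNorm v ≤ c := by
  rw [← euNorm_sq] at h
  exact le_of_sq_le_sq h hc

lemma euNorm_add_le (v u : ι → ℝ) : euNorm (v + u) ≤ euNorm v + euNorm u := norm_add_le _ _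

lemma euNorm_sub_le (v u : ι → ℝ) : euNorm (v - u) ≤ euNorm v + euNorm u := norm_sub_le _ _

lemma abs_dotProduct_le (v u : ι → ℝ) : |v ⬝ᵥ u| ≤ euNorm v * euNorm u := by
  have := abs_real_inner_le_norm (WithLp.toLp 2 u) (WithLp.toLp 2 v)
  rw [EuclideanSpace.inner_eq_star_dotProduct] at this
  simpa [euNorm, mul_comm] using this

lemma euOpNorm_nonneg {k : ℕ} (A : Matrix (Fin k) (Fin k) ℝ) : 0 ≤ euOpNorm A := norm_nonneg _

lemma euNorm_mulVec_le {k : ℕ} (A : Matrix (Fin k) (Fin k) ℝ) (v : Fin k → ℝ) :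
    euNorm (A *ᵥ v) ≤ euOpNorm A * euNorm v :=
  (Matrix.toEuclideanCLM (n := Fin k) (𝕜 := ℝ) A).le_opNorm (WithLp.toLp 2 v)

lemma euOpNorm_le {k : ℕ} (A : Matrix (Fin k) (Fin k) ℝ) {c : ℝ} (hc : 0 ≤ c)
    (h : ∀ v, euNorm (A *ᵥ v) ≤ c * euNorm v) : euOpNorm A ≤ c :=
  ContinuousLinearMap.opNorm_le_bound _ hc fun v => h (WithLp.ofLp v)

end euNorm

section Symmetric

variable {k : ℕ}

/-- The spectral theorem for real symmetric matrices. -/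
lemma exists_spectral {X : Matrix (Fin k) (Fin k) ℝ} (hX : Xᵀ = X) :
    ∃ (V : Matrix (Fin k) (Fin k) ℝ) (a : Fin k → ℝ), Vᵀ * V = 1 ∧ V * Vᵀ = 1 ∧
      X = V * Matrix.diagonal a * Vᵀ := by
  have hH : X.IsHermitian := by rw [Matrix.IsHermitian, Matrix.conjTranspose_eq_transpose_of_trivial, hX]
  refine ⟨hH.eigenvectorUnitary, hH.eigenvalues, ?_, ?_, ?_⟩
  · have := Unitary.coe_star_mul_self hH.eigenvectorUnitary
    rwa [Matrix.star_eq_conjTranspose, Matrix.conjTranspose_eq_transpose_of_trivial] at this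
  · have := Unitary.coe_mul_star_self hH.eigenvectorUnitary
    rwa [Unitary.coe_star, Matrix.star_eq_conjTranspose,
      Matrix.conjTranspose_eq_transpose_of_trivial] at this
  · have := hH.spectral_theorem
    rw [Unitary.conjStarAlgAut_apply] at this
    rw [Matrix.star_eq_conjTranspose, Matrix.conjTranspose_eq_transpose_of_trivial] at this
    simpa using this

lemma pow_spectral {V : Matrix (Fin k) (Fin k) ℝ} {a : Fin k → ℝ} (h₁ : Vᵀ * V = 1)
    (h₂ : V * Vᵀ = 1) (q : ℕ) :
    (V * Matrix.diagonal a * Vᵀ) ^ q = V * Matrix.diagonal (a ^ q) * Vᵀ := by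
  induction q with
  | zero => simp [h₂]
  | succ q ih =>
    rw [pow_succ, ih]
    calc V * Matrix.diagonal (a ^ q) * Vᵀ * (V * Matrix.diagonal a * Vᵀ)
        = V * Matrix.diagonal (a ^ q) * (Vᵀ * V) * Matrix.diagonal a * Vᵀ := by
          simp only [Matrix.mul_assoc]
      _ = V * (Matrix.diagonal (a ^ q) * Matrix.diagonal a) * Vᵀ := by
          rw [h₁]; simp only [Matrix.mul_assoc, Matrix.one_mul]
      _ = _ := by rw [Matrix.diagonal_mul_diagonal]; congr 3

lemma trace_spectral_mul_spectral (V W : Matrix (Fin k) (Fin k) ℝ) (a b : Fin k → ℝ) :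
    (V * Matrix.diagonal a * Vᵀ * (W * Matrix.diagonal b * Wᵀ)).trace
      = ∑ i, ∑ j, (Vᵀ * W) i j ^ 2 * (a i * b j) := by
  have h : (V * Matrix.diagonal a * Vᵀ * (W * Matrix.diagonal b * Wᵀ)).trace
      = (Matrix.diagonal a * (Vᵀ * W) * (Matrix.diagonal b * (Vᵀ * W)ᵀ)).trace := by
    rw [Matrix.transpose_mul, Matrix.transpose_transpose]
    simp only [Matrix.mul_assoc]
    rw [Matrix.trace_mul_comm]
    simp only [Matrix.mul_assoc]
  rw [h, Matrix.trace]
  refine Finset.sum_congr rfl fun i _ => ?_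
  rw [Matrix.diag_apply, Matrix.mul_apply]
  refine Finset.sum_congr rfl fun j _ => ?_
  rw [Matrix.diagonal_mul, Matrix.diagonal_mul, Matrix.transpose_apply]
  ring

lemma mul_sub_pow_sub_pow_le (a b : ℝ) (q : ℕ) :
    (a - b) * (a ^ (2 * q + 1) - b ^ (2 * q + 1))
      ≤ (2 * q + 1) / 2 * ((a - b) ^ 2 * (a ^ (2 * q) + b ^ (2 * q))) := by
  have hgeom := (Commute.all a b).geom_sum₂_mul (2 * q + 1)
  set G := ∑ i ∈ Finset.range (2 * q + 1), a ^ i * b ^ (2 * q + 1 - 1 - i) with hG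
  have hrefl : G = ∑ i ∈ Finset.range (2 * q + 1), a ^ (2 * q - i) * b ^ i := by
    rw [hG, ← Finset.sum_range_reflect]
    refine Finset.sum_congr rfl fun i hi => ?_
    have := Finset.mem_range.1 hi
    congr 2
    omega
  have hterm : ∀ i ∈ Finset.range (2 * q + 1),
      a ^ i * b ^ (2 * q - i) + a ^ (2 * q - i) * b ^ i ≤ a ^ (2 * q) + b ^ (2 * q) := by
    intro i hi
    have hi' := Finset.mem_range.1 hi
    obtain ⟨j, hj⟩ : ∃ j, 2 * q = i + j := ⟨2 * q - i, by omega⟩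
    have hj' : 2 * q - i = j := by omega
    have h1 : 0 ≤ (|a| ^ i - |b| ^ i) * (|a| ^ j - |b| ^ j) := by
      rcases le_total |a| |b| with h | h
      · exact mul_nonneg_of_nonpos_of_nonpos
          (sub_nonpos.2 (pow_le_pow_left₀ (abs_nonneg _) h _))
          (sub_nonpos.2 (pow_le_pow_left₀ (abs_nonneg _) h _))
      · exact mul_nonneg
          (sub_nonneg.2 (pow_le_pow_left₀ (abs_nonneg _) h _))
          (sub_nonneg.2 (pow_le_pow_left₀ (abs_nonneg _) h _))
    have h2 : a ^ (2 * q) = |a| ^ i * |a| ^ j := by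
      rw [← pow_add, ← hj, pow_mul, pow_mul, sq_abs]
    have h3 : b ^ (2 * q) = |b| ^ i * |b| ^ j := by
      rw [← pow_add, ← hj, pow_mul, pow_mul, sq_abs]
    have h4 : a ^ i * b ^ j ≤ |a| ^ i * |b| ^ j := by
      rw [← abs_pow, ← abs_pow, ← abs_mul]; exact le_abs_self _
    have h5 : a ^ j * b ^ i ≤ |a| ^ j * |b| ^ i := by
      rw [← abs_pow, ← abs_pow, ← abs_mul]; exact le_abs_self _
    rw [hj', h2, h3]
    nlinarith
  have h2G : 2 * G ≤ (2 * q + 1) * (a ^ (2 * q) + b ^ (2 * q)) := by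
    have h1 : G + G = ∑ i ∈ Finset.range (2 * q + 1),
        (a ^ i * b ^ (2 * q - i) + a ^ (2 * q - i) * b ^ i) := by
      rw [Finset.sum_add_distrib, ← hrefl, hG]; simp
    rw [two_mul, h1]
    refine (Finset.sum_le_card_nsmul _ _ _ hterm).trans (le_of_eq ?_)
    rw [nsmul_eq_mul, Finset.card_range]; push_cast; ring
  rw [← hgeom]
  nlinarith [sq_nonneg (a - b), mul_le_mul_of_nonneg_left h2G (sq_nonneg (a - b))]

/-- A mean value inequality for the trace of odd powers. In the eigenbases of `X` and `Y` it reduces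
to the scalar inequality `mul_sub_pow_sub_pow_le`. -/
theorem trace_sub_mul_pow_sub_pow_le {X Y : Matrix (Fin k) (Fin k) ℝ} (hX : Xᵀ = X) (hY : Yᵀ = Y)
    (q : ℕ) :
    ((X - Y) * (X ^ (2 * q + 1) - Y ^ (2 * q + 1))).trace
      ≤ (2 * q + 1) / 2 * (((X - Y) ^ 2 * X ^ (2 * q)).trace + ((X - Y) ^ 2 * Y ^ (2 * q)).trace) := by
  obtain ⟨V, a, hV₁, hV₂, hXV⟩ := exists_spectral hX
  obtain ⟨W, b, hW₁, hW₂, hYW⟩ := exists_spectral hY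
  set Q := Vᵀ * W with hQ
  have key : ∀ α β : ℕ, (X ^ α * Y ^ β).trace = ∑ i, ∑ j, Q i j ^ 2 * (a i ^ α * b j ^ β) := by
    intro α β
    rw [hXV, hYW, pow_spectral hV₁ hV₂, pow_spectral hW₁ hW₂, trace_spectral_mul_spectral]
    rfl
  have hl : ((X - Y) * (X ^ (2 * q + 1) - Y ^ (2 * q + 1))).trace
      = (X ^ (2 * q + 2) * Y ^ 0).trace - (X ^ 1 * Y ^ (2 * q + 1)).trace
        - (X ^ (2 * q + 1) * Y ^ 1).trace + (X ^ 0 * Y ^ (2 * q + 2)).trace := by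
    have e : (X - Y) * (X ^ (2 * q + 1) - Y ^ (2 * q + 1))
        = X ^ (2 * q + 2) * Y ^ 0 - X ^ 1 * Y ^ (2 * q + 1) - Y * X ^ (2 * q + 1)
          + X ^ 0 * Y ^ (2 * q + 2) := by
      rw [pow_succ' X (2 * q + 1), pow_succ' Y (2 * q + 1)]; noncomm_ring
    rw [e, Matrix.trace_add, Matrix.trace_sub, Matrix.trace_sub, Matrix.trace_mul_comm Y, pow_one Y]
  have hr1 : ((X - Y) ^ 2 * X ^ (2 * q)).trace
      = (X ^ (2 * q + 2) * Y ^ 0).trace - 2 * (X ^ (2 * q + 1) * Y ^ 1).trace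
        + (X ^ (2 * q) * Y ^ 2).trace := by
    have e : (X - Y) ^ 2 * X ^ (2 * q)
        = X ^ (2 * q + 2) * Y ^ 0 - X * (Y * X ^ (2 * q)) - Y * X ^ (2 * q + 1)
          + Y ^ 2 * X ^ (2 * q) := by
      rw [pow_succ' X (2 * q + 1), pow_succ' X (2 * q)]; noncomm_ring
    rw [e, Matrix.trace_add, Matrix.trace_sub, Matrix.trace_sub, Matrix.trace_mul_comm Y,
      Matrix.trace_mul_comm (Y ^ 2), Matrix.trace_mul_comm X, Matrix.mul_assoc, ← pow_succ,
      Matrix.trace_mul_comm Y, pow_one Y]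
    ring
  have hr2 : ((X - Y) ^ 2 * Y ^ (2 * q)).trace
      = (X ^ 2 * Y ^ (2 * q)).trace - 2 * (X ^ 1 * Y ^ (2 * q + 1)).trace
        + (X ^ 0 * Y ^ (2 * q + 2)).trace := by
    have e : (X - Y) ^ 2 * Y ^ (2 * q)
        = X ^ 2 * Y ^ (2 * q) - X ^ 1 * Y ^ (2 * q + 1) - Y * (X * Y ^ (2 * q))
          + X ^ 0 * Y ^ (2 * q + 2) := by
      rw [pow_succ' Y (2 * q + 1), pow_succ' Y (2 * q)]; noncomm_ring
    rw [e, Matrix.trace_add, Matrix.trace_sub, Matrix.trace_sub, Matrix.trace_mul_comm Y,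
      Matrix.mul_assoc, ← pow_succ, pow_one X]
    ring
  rw [hl, hr1, hr2]
  simp only [key]
  simp only [Finset.mul_sum, mul_add, mul_sub, ← Finset.sum_add_distrib, ← Finset.sum_sub_distrib]
  refine Finset.sum_le_sum fun i _ => Finset.sum_le_sum fun j _ => ?_
  have := mul_le_mul_of_nonneg_left (mul_sub_pow_sub_pow_le (a i) (b j) q) (sq_nonneg (Q i j))
  calc _ = Q i j ^ 2 * ((a i - b j) * (a i ^ (2 * q + 1) - b j ^ (2 * q + 1))) := by ring
    _ ≤ _ := this
    _ = _ := by ring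

lemma trace_transpose_mul_self_nonneg {m : ℕ} (A : Matrix (Fin m) (Fin k) ℝ) :
    0 ≤ (Aᵀ * A).trace := by
  rw [Matrix.trace]
  refine Finset.sum_nonneg fun i _ => ?_
  rw [Matrix.diag_apply, Matrix.mul_apply]
  exact Finset.sum_nonneg fun j _ => mul_self_nonneg _

lemma transpose_pow_of_symm {X : Matrix (Fin k) (Fin k) ℝ} (hX : Xᵀ = X) (q : ℕ) :
    (X ^ q)ᵀ = X ^ q := by rw [Matrix.transpose_pow, hX]

lemma trace_sq_mul_pow_nonneg {X A : Matrix (Fin k) (Fin k) ℝ} (hX : Xᵀ = X) (hA : Aᵀ = A) (q : ℕ) :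
    0 ≤ (A ^ 2 * X ^ (2 * q)).trace := by
  have h : (A ^ 2 * X ^ (2 * q)).trace = ((A * X ^ q)ᵀ * (A * X ^ q)).trace := by
    rw [Matrix.transpose_mul, transpose_pow_of_symm hX, hA, two_mul, pow_add, sq,
      ← Matrix.mul_assoc, Matrix.trace_mul_comm]
    simp only [Matrix.mul_assoc]
  rw [h]; exact trace_transpose_mul_self_nonneg _

/-- The even power traces of a symmetric matrix dominate the powers of its operator norm. -/
lemma euOpNorm_pow_le_trace {X : Matrix (Fin k) (Fin k) ℝ} (hX : Xᵀ = X) {q : ℕ} (hq : q ≠ 0) :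
    euOpNorm X ^ (2 * q) ≤ (X ^ (2 * q)).trace := by
  obtain ⟨V, a, hV₁, hV₂, hXV⟩ := exists_spectral hX
  have htr : (X ^ (2 * q)).trace = ∑ i, a i ^ (2 * q) := by
    rw [hXV, pow_spectral hV₁ hV₂, Matrix.trace_mul_comm, ← Matrix.mul_assoc, hV₁, Matrix.one_mul,
      Matrix.trace_diagonal]
    rfl
  have hnn : 0 ≤ ∑ i, a i ^ (2 * q) :=
    Finset.sum_nonneg fun i _ => by rw [pow_mul]; positivity
  set t := ∑ i, a i ^ (2 * q) with ht
  set ρ : ℝ := t ^ ((1 : ℝ) / (2 * q : ℕ)) with hρ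
  have hρ0 : 0 ≤ ρ := Real.rpow_nonneg hnn _
  have hρpow : ρ ^ (2 * q) = t := by
    rw [hρ, one_div, Real.rpow_inv_natCast_pow hnn (by omega)]
  have hai : ∀ i, a i ^ 2 ≤ ρ ^ 2 := by
    intro i
    have h1 : (a i ^ 2) ^ q ≤ (ρ ^ 2) ^ q := by
      rw [← pow_mul, ← pow_mul, hρpow]
      exact Finset.single_le_sum (f := fun i => a i ^ (2 * q))
        (fun i _ => by rw [pow_mul]; positivity) (Finset.mem_univ i)
    exact le_of_pow_le_pow_left₀ hq (sq_nonneg _) h1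
  have hiso : ∀ v, euNorm (V *ᵥ v) ^ 2 = euNorm v ^ 2 := fun v => by
    rw [euNorm_sq', euNorm_sq', Matrix.dotProduct_mulVec, Matrix.vecMul_mulVec, ← Matrix.mulVec_transpose,
      Matrix.transpose_mul, Matrix.transpose_transpose, hV₁, Matrix.one_mulVec]
  have hle : euOpNorm X ≤ ρ := by
    refine euOpNorm_le X hρ0 fun v => ?_
    have h2 : euNorm (X *ᵥ v) ^ 2 ≤ (ρ * euNorm v) ^ 2 := by
      have hv : v = V *ᵥ (Vᵀ *ᵥ v) := by rw [Matrix.mulVec_mulVec, hV₂, Matrix.one_mulVec]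
      set c := Vᵀ *ᵥ v
      have e1 : X *ᵥ v = V *ᵥ (Matrix.diagonal a *ᵥ c) := by
        rw [hXV, Matrix.mul_assoc, ← Matrix.mulVec_mulVec, ← Matrix.mulVec_mulVec]
      rw [e1, hiso, mul_pow, hv, hiso, euNorm_sq, euNorm_sq, Finset.mul_sum]
      refine Finset.sum_le_sum fun i _ => ?_
      rw [Matrix.mulVec_diagonal, mul_pow]
      exact mul_le_mul_of_nonneg_right (hai i) (sq_nonneg _)
    exact le_of_sq_le_sq h2 (mul_nonneg hρ0 (euNorm_nonneg _))
  rw [htr, ← hρpow]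
  exact pow_le_pow_left₀ (euOpNorm_nonneg _) hle _

end Symmetric

/-! ### Concentration of the weighted Gram matrix -/

/-- The weighted Gram matrix `∑_i w_i u_i u_i'` of the rows `u_i` of `U`. -/
noncomputable def weightedGram {n k : ℕ} (U : Matrix (Fin n) (Fin k) ℝ) (w : Fin n → ℝ) :
    Matrix (Fin k) (Fin k) ℝ :=
  ∑ i, w i • Matrix.vecMulVec (U i) (U i)

section weightedGram

variable {n k : ℕ} (U : Matrix (Fin n) (Fin k) ℝ)

lemma weightedGram_transpose (w : Fin n → ℝ) : (weightedGram U w)ᵀ = weightedGram U w := by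
  simp [weightedGram, Matrix.transpose_sum, Matrix.transpose_vecMulVec]

lemma weightedGram_eq_mul (w : Fin n → ℝ) :
    weightedGram U w = Uᵀ * Matrix.diagonal w * U := by
  ext a b
  simp only [weightedGram, Matrix.sum_apply, Matrix.smul_apply, Matrix.vecMulVec_apply,
    smul_eq_mul]
  rw [Matrix.mul_apply]
  refine Finset.sum_congr rfl fun i _ => ?_
  rw [Matrix.mul_diagonal, Matrix.transpose_apply]
  ring

lemma weightedGram_one : weightedGram U (fun _ => 1) = Uᵀ * U := by
  rw [weightedGram_eq_mul]
  simp

lemma weightedGram_mulVec (w : Fin n → ℝ) (v : Fin k → ℝ) :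
    weightedGram U w *ᵥ v = ∑ i, (w i * (U i ⬝ᵥ v)) • U i := by
  simp only [weightedGram, Matrix.sum_mulVec, Matrix.smul_mulVec, Matrix.vecMulVec_mulVec]
  refine Finset.sum_congr rfl fun i _ => ?_
  ext a
  simp [mul_comm, mul_left_comm]

lemma trace_vecMulVec_self_mul (v : Fin k → ℝ) (M : Matrix (Fin k) (Fin k) ℝ) :
    (Matrix.vecMulVec v v * M).trace = v ⬝ᵥ M *ᵥ v := by
  rw [Matrix.vecMulVec_mul, Matrix.trace_vecMulVec, Matrix.dotProduct_mulVec, dotProduct_comm]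

end weightedGram

namespace IsSamplingWeight

variable {n n₁ k : ℕ} {w : Finset (Fin n) → Fin n → ℝ} {K : ℝ}

/-- One step of Stein's method of exchangeable pairs. The pair is `S` and its image under a random
transposition of units; the mean of the increment of the weighted Gram matrix `X` given `S` is
proportional to `X`, and the squared increments add up to at most a multiple of the identity. -/
theorem srsMean_trace_pow_step (hw : IsSamplingWeight n n₁ w K) (hn : 0 < n)
    {U : Matrix (Fin n) (Fin k) ℝ} (hU : Uᵀ * U = 1) {κ : ℝ} (hκ : ∀ i, U i ⬝ᵥ U i ≤ κ) (q : ℕ) :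
    srsMean n n₁ (fun S => (weightedGram U (w S) ^ (2 * (q + 1))).trace)
      ≤ (2 * q + 1) * (4 * K ^ 2 * κ)
        * srsMean n n₁ (fun S => (weightedGram U (w S) ^ (2 * q)).trace) := by
  set X : Finset (Fin n) → Matrix (Fin k) (Fin k) ℝ := fun S => weightedGram U (w S) with hX
  set A : Fin n → Matrix (Fin k) (Fin k) ℝ := fun i => Matrix.vecMulVec (U i) (U i) with hA
  have hXs : ∀ S, (X S)ᵀ = X S := fun S => weightedGram_transpose U _
  have hAs : ∀ i, (A i)ᵀ = A i := fun i => Matrix.transpose_vecMulVec _ _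
  have hAsum : ∑ i, A i = 1 := by
    rw [← hU, ← weightedGram_one, weightedGram]; simp [hA]
  set σ : Fin n → Fin n → Finset (Fin n) → Finset (Fin n) := fun i j S =>
    S.map (Equiv.swap i j).toEmbedding with hσ
  have hinc : ∀ i j S, X S - X (σ i j S) = (w S i - w S j) • (A i - A j) := by
    intro i j S
    have e : X (σ i j S) = ∑ l, w S l • A (Equiv.swap i j l) := by
      rw [hX, hσ]; dsimp only [weightedGram]
      rw [← Equiv.sum_comp (Equiv.swap i j)]
      refine Finset.sum_congr rfl fun l _ => ?_
      rw [hw.map_swap, Equiv.swap_apply_self]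
    rw [e]
    change ∑ l, w S l • A l - _ = _
    rw [← Finset.sum_sub_distrib]
    by_cases hij : i = j
    · subst hij; simp
    · rw [← Finset.sum_subset (Finset.subset_univ {i, j}), Finset.sum_pair hij,
        Equiv.swap_apply_left, Equiv.swap_apply_right]
      · rw [smul_sub, sub_smul, sub_smul]; abel
      · intro l _ hl
        rw [Finset.mem_insert, Finset.mem_singleton, not_or] at hl
        rw [Equiv.swap_apply_of_ne_of_ne hl.1 hl.2, sub_self]
  have hσσ : ∀ i j S, σ i j (σ i j S) = S := by
    intro i j S
    ext l
    simp [hσ]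
  have hinv : ∀ i j (f : Finset (Fin n) → ℝ),
      srsMean n n₁ (fun S => f (σ i j S)) = srsMean n n₁ f := fun i j f =>
    srsMean_map (Equiv.swap i j) f
  -- the increments add up to a multiple of `X`
  have hdrift : ∀ S, S.card = n₁ → ∑ i, ∑ j, (X S - X (σ i j S)) = (2 * n : ℝ) • X S := by
    intro S hS
    have h0 := hw.sum_eq_zero S hS
    have e : ∀ i j, X S - X (σ i j S) = w S i • A i - w S i • A j - w S j • A i + w S j • A j := by
      intro i j; rw [hinc, smul_sub, sub_smul, sub_smul]; abel
    simp only [e, Finset.sum_add_distrib, Finset.sum_sub_distrib, Finset.sum_const,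
      Finset.card_univ, Fintype.card_fin]
    rw [← Finset.smul_sum]
    simp only [← Finset.smul_sum, ← Finset.sum_smul, h0, hAsum, zero_smul,
      Finset.sum_const_zero, sub_zero]
    have : ∑ i, w S i • A i = X S := rfl
    rw [this, ← Nat.cast_smul_eq_nsmul ℝ, ← add_smul]
    congr 1; ring
  -- exchangeability
  have hpair : ∀ i j, srsMean n n₁ (fun S => ((X S - X (σ i j S)) * X S ^ (2 * q + 1)).trace)
      ≤ (2 * q + 1) / 2
        * srsMean n n₁ (fun S => ((X S - X (σ i j S)) ^ 2 * X S ^ (2 * q)).trace) := by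
    intro i j
    have h1 := hinv i j (fun S => ((X S - X (σ i j S)) * X S ^ (2 * q + 1)).trace)
    have h2 := hinv i j (fun S => ((X S - X (σ i j S)) ^ 2 * X S ^ (2 * q)).trace)
    simp only [hσσ] at h1 h2
    have h3 : srsMean n n₁ (fun S =>
        ((X S - X (σ i j S)) * (X S ^ (2 * q + 1) - X (σ i j S) ^ (2 * q + 1))).trace)
        ≤ (2 * q + 1) / 2 * srsMean n n₁ (fun S =>
          ((X S - X (σ i j S)) ^ 2 * X S ^ (2 * q)).trace
          + ((X (σ i j S) - X S) ^ 2 * X (σ i j S) ^ (2 * q)).trace) := by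
      rw [← srsMean_const_mul]
      refine srsMean_mono fun S _ => ?_
      have := trace_sub_mul_pow_sub_pow_le (hXs S) (hXs (σ i j S)) q
      rwa [← neg_sub (X S) (X (σ i j S)), neg_sq]
    rw [srsMean_add, h2] at h3
    have h4 : srsMean n n₁ (fun S =>
        ((X S - X (σ i j S)) * (X S ^ (2 * q + 1) - X (σ i j S) ^ (2 * q + 1))).trace)
        = srsMean n n₁ (fun S => ((X S - X (σ i j S)) * X S ^ (2 * q + 1)).trace)
          + srsMean n n₁ (fun S => ((X (σ i j S) - X S) * X (σ i j S) ^ (2 * q + 1)).trace) := by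
      rw [← srsMean_add]
      refine srsMean_congr fun S _ => ?_
      rw [← Matrix.trace_add]
      congr 1
      noncomm_ring
    rw [h4, h1] at h3
    linarith
  -- the squared increments
  have hAsq : ∀ i S, (A i ^ 2 * X S ^ (2 * q)).trace ≤ κ * (A i * X S ^ (2 * q)).trace := by
    intro i S
    have e : A i ^ 2 = (U i ⬝ᵥ U i) • A i := by
      rw [sq, hA]
      simp [Matrix.vecMulVec_mul_vecMulVec]
    rw [e, Matrix.smul_mul, Matrix.trace_smul, smul_eq_mul]
    refine mul_le_mul_of_nonneg_right (hκ i) ?_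
    rw [trace_vecMulVec_self_mul, two_mul, pow_add, ← Matrix.mulVec_mulVec,
      Matrix.dotProduct_mulVec, ← Matrix.mulVec_transpose, transpose_pow_of_symm (hXs S)]
    exact Finset.sum_nonneg fun _ _ => mul_self_nonneg _
  have hsq : ∀ i j S, ((X S - X (σ i j S)) ^ 2 * X S ^ (2 * q)).trace
      ≤ 8 * K ^ 2 * κ * ((A i * X S ^ (2 * q)).trace + (A j * X S ^ (2 * q)).trace) := by
    intro i j S
    have hd : ((A i - A j) ^ 2 * X S ^ (2 * q)).trace
        ≤ 2 * κ * ((A i * X S ^ (2 * q)).trace + (A j * X S ^ (2 * q)).trace) := by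
      have h1 := trace_sq_mul_pow_nonneg (hXs S) (A := A i + A j)
        (by rw [Matrix.transpose_add, hAs, hAs]) q
      have h2 : ((A i - A j) ^ 2 * X S ^ (2 * q)).trace + ((A i + A j) ^ 2 * X S ^ (2 * q)).trace
          = 2 * (A i ^ 2 * X S ^ (2 * q)).trace + 2 * (A j ^ 2 * X S ^ (2 * q)).trace := by
        rw [← Matrix.trace_add, ← add_mul]
        have : (A i - A j) ^ 2 + (A i + A j) ^ 2 = (2 : ℝ) • A i ^ 2 + (2 : ℝ) • A j ^ 2 := by
          rw [two_smul, two_smul]; noncomm_ring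
        rw [this, add_mul, Matrix.trace_add, Matrix.smul_mul, Matrix.smul_mul, Matrix.trace_smul,
          Matrix.trace_smul, smul_eq_mul, smul_eq_mul]
      linarith [hAsq i S, hAsq j S]
    have hdn : 0 ≤ ((A i - A j) ^ 2 * X S ^ (2 * q)).trace :=
      trace_sq_mul_pow_nonneg (hXs S) (by rw [Matrix.transpose_sub, hAs, hAs]) q
    have hwb : (w S i - w S j) ^ 2 ≤ 4 * K ^ 2 := by
      have h1 := _root_.abs_le.1 (hw.abs_le S i)
      have h2 := _root_.abs_le.1 (hw.abs_le S j)
      nlinarith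
    rw [hinc, smul_pow, Matrix.smul_mul, Matrix.trace_smul, smul_eq_mul]
    calc _ ≤ 4 * K ^ 2 * ((A i - A j) ^ 2 * X S ^ (2 * q)).trace :=
          mul_le_mul_of_nonneg_right hwb hdn
      _ ≤ 4 * K ^ 2 * (2 * κ * ((A i * X S ^ (2 * q)).trace + (A j * X S ^ (2 * q)).trace)) :=
          mul_le_mul_of_nonneg_left hd (by positivity)
      _ = _ := by ring
  have hAtr : ∀ S, ∑ i, (A i * X S ^ (2 * q)).trace = (X S ^ (2 * q)).trace := by
    intro S
    rw [← Matrix.trace_sum, ← Finset.sum_mul, hAsum, one_mul]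
  have hleft : (2 * n : ℝ) * srsMean n n₁ (fun S => (X S ^ (2 * (q + 1))).trace)
      = ∑ i, ∑ j, srsMean n n₁ (fun S => ((X S - X (σ i j S)) * X S ^ (2 * q + 1)).trace) := by
    rw [← srsMean_const_mul, show 2 * (q + 1) = 2 * q + 1 + 1 by ring]
    simp_rw [← srsMean_sum]
    refine srsMean_congr fun S hS => ?_
    simp_rw [← Matrix.trace_sum, ← Finset.sum_mul]
    rw [hdrift S hS, Matrix.smul_mul, Matrix.trace_smul, smul_eq_mul, ← pow_succ']
  have hright : ∑ i, ∑ j, srsMean n n₁ (fun S => ((X S - X (σ i j S)) ^ 2 * X S ^ (2 * q)).trace)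
      ≤ 16 * K ^ 2 * κ * n * srsMean n n₁ (fun S => (X S ^ (2 * q)).trace) := by
    rw [← srsMean_const_mul]
    simp_rw [← srsMean_sum]
    refine srsMean_mono fun S _ => ?_
    refine (Finset.sum_le_sum fun i _ => Finset.sum_le_sum fun j _ => hsq i j S).trans
      (le_of_eq ?_)
    simp_rw [← Finset.mul_sum, Finset.sum_add_distrib, hAtr, Finset.sum_const, Finset.card_univ,
      Fintype.card_fin, nsmul_eq_mul, ← Finset.mul_sum, hAtr]
    ring
  have htot : (2 * n : ℝ) * srsMean n n₁ (fun S => (X S ^ (2 * (q + 1))).trace)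
      ≤ (2 * q + 1) / 2 * (16 * K ^ 2 * κ * n * srsMean n n₁ (fun S => (X S ^ (2 * q)).trace)) := by
    rw [hleft]
    refine (Finset.sum_le_sum fun i _ => Finset.sum_le_sum fun j _ => hpair i j).trans ?_
    simp_rw [← Finset.mul_sum]
    exact mul_le_mul_of_nonneg_left hright (by positivity)
  have hnpos : (0 : ℝ) < 2 * n := by positivity
  refine le_of_mul_le_mul_left (htot.trans (le_of_eq ?_)) hnpos
  ring

/-- A matrix Khintchine inequality for sampling without replacement: the even trace moments of the
weighted Gram matrix of an orthonormal design are at most Gaussian. -/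
theorem srsMean_trace_pow_le (hw : IsSamplingWeight n n₁ w K) (hn : 0 < n) (h₁ : n₁ ≤ n)
    {U : Matrix (Fin n) (Fin k) ℝ} (hU : Uᵀ * U = 1) {κ : ℝ} (hκ0 : 0 ≤ κ)
    (hκ : ∀ i, U i ⬝ᵥ U i ≤ κ) (Q : ℕ) :
    ∀ q ≤ Q, srsMean n n₁ (fun S => (weightedGram U (w S) ^ (2 * q)).trace)
      ≤ k * (8 * K ^ 2 * κ * Q) ^ q := by
  intro q
  induction q with
  | zero => intro _; simp [srsMean_const h₁]
  | succ q ih =>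
    intro hq
    have hq' : (2 * q + 1 : ℝ) ≤ 2 * Q := by
      have : 2 * q + 1 ≤ 2 * Q := by omega
      exact_mod_cast this
    calc _ ≤ (2 * q + 1) * (4 * K ^ 2 * κ)
          * srsMean n n₁ (fun S => (weightedGram U (w S) ^ (2 * q)).trace) :=
          hw.srsMean_trace_pow_step hn hU hκ q
      _ ≤ (2 * Q) * (4 * K ^ 2 * κ) * (k * (8 * K ^ 2 * κ * Q) ^ q) := by
          have : 0 ≤ srsMean n n₁ (fun S => (weightedGram U (w S) ^ (2 * q)).trace) := by
            refine srsMean_nonneg fun S _ => ?_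
            have := trace_sq_mul_pow_nonneg (weightedGram_transpose U (w S))
              (Matrix.transpose_one (n := Fin k) (α := ℝ)) q
            simpa using this
          have := ih (by omega)
          gcongr
      _ = _ := by ring

end IsSamplingWeight

/-! ### Least squares in an orthonormal design -/

section Orthonormal

variable {n k : ℕ} {U : Matrix (Fin n) (Fin k) ℝ}

lemma sum_smul_row_eq_mulVec (U : Matrix (Fin n) (Fin k) ℝ) (c : Fin n → ℝ) :
    ∑ i, c i • U i = Uᵀ *ᵥ c := by
  ext a
  simp [Matrix.mulVec, dotProduct, mul_comm]

lemma euNorm_dotProduct_row (hU : Uᵀ * U = 1) (v : Fin k → ℝ) :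
    euNorm (fun i => U i ⬝ᵥ v) = euNorm v := by
  have h : euNorm (U *ᵥ v) ^ 2 = euNorm v ^ 2 := by
    rw [euNorm_sq', euNorm_sq', Matrix.dotProduct_mulVec, Matrix.vecMul_mulVec,
      ← Matrix.mulVec_transpose, Matrix.transpose_mul, Matrix.transpose_transpose, hU,
      Matrix.one_mulVec]
  exact (pow_left_inj₀ (euNorm_nonneg _) (euNorm_nonneg _) two_ne_zero).1 h

lemma euNorm_sum_smul_row_le (hU : Uᵀ * U = 1) (c : Fin n → ℝ) :
    euNorm (∑ i, c i • U i) ≤ euNorm c := by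
  set v := ∑ i, c i • U i with hv
  have h : euNorm v ^ 2 ≤ euNorm c * euNorm v := by
    have e : euNorm v ^ 2 = c ⬝ᵥ (fun i => U i ⬝ᵥ v) := by
      rw [euNorm_sq']
      conv_lhs => rw [hv]
      rw [sum_dotProduct, ← hv]
      simp [dotProduct, Finset.mul_sum, mul_assoc]
    rw [e]
    refine (le_abs_self _).trans ((abs_dotProduct_le _ _).trans ?_)
    rw [euNorm_dotProduct_row hU]
  rcases (euNorm_nonneg v).eq_or_lt with h0 | h0
  · rw [← h0]; exact euNorm_nonneg _
  · rw [sq] at h; exact le_of_mul_le_mul_right h h0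

lemma sum_leverage (hU : Uᵀ * U = 1) : ∑ i, U i ⬝ᵥ U i = k := by
  have h : ∑ i, U i ⬝ᵥ U i = (Uᵀ * U).trace := by
    simp only [Matrix.trace, Matrix.diag_apply, Matrix.mul_apply, dotProduct,
      Matrix.transpose_apply]
    exact Finset.sum_comm
  rw [h, hU]; simp

lemma leverage_nonneg (U : Matrix (Fin n) (Fin k) ℝ) (i : Fin n) : 0 ≤ U i ⬝ᵥ U i :=
  Finset.sum_nonneg fun _ _ => mul_self_nonneg _

lemma sum_sq_cross_leverage (hU : Uᵀ * U = 1) (i : Fin n) :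
    ∑ j, (U i ⬝ᵥ U j) ^ 2 = U i ⬝ᵥ U i := by
  rw [← euNorm_sq', ← euNorm_dotProduct_row hU (U i), euNorm_sq]
  exact Finset.sum_congr rfl fun j _ => by rw [dotProduct_comm]

lemma leverage_le_one (hU : Uᵀ * U = 1) (i : Fin n) : U i ⬝ᵥ U i ≤ 1 := by
  have h := Finset.single_le_sum (f := fun j => (U i ⬝ᵥ U j) ^ 2) (fun j _ => sq_nonneg _)
    (Finset.mem_univ i)
  rw [sum_sq_cross_leverage hU] at h
  nlinarith [leverage_nonneg U i]

lemma sum_leverage_sq_le (hU : Uᵀ * U = 1) {κ : ℝ} (hκ : ∀ i, U i ⬝ᵥ U i ≤ κ) :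
    ∑ i, (U i ⬝ᵥ U i) ^ 2 ≤ κ * k := by
  rw [← sum_leverage hU, Finset.mul_sum]
  exact Finset.sum_le_sum fun i _ => by
    rw [sq]; exact mul_le_mul_of_nonneg_right (hκ i) (leverage_nonneg U i)

lemma sum_leverage_mul_abs_le (hU : Uᵀ * U = 1) {κ : ℝ}
    (hκ : ∀ i, U i ⬝ᵥ U i ≤ κ) (c : Fin n → ℝ) :
    ∑ i, (U i ⬝ᵥ U i) * |c i| ≤ √(κ * k) * euNorm c := by
  have h := abs_dotProduct_le (fun i => U i ⬝ᵥ U i) (fun i => |c i|)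
  refine ((le_abs_self _).trans h).trans ?_
  refine mul_le_mul ?_ (le_of_eq ?_) (euNorm_nonneg _) (Real.sqrt_nonneg _)
  · refine Real.le_sqrt_of_sq_le ?_
    rw [euNorm_sq]; exact sum_leverage_sq_le hU hκ
  · refine (pow_left_inj₀ (euNorm_nonneg _) (euNorm_nonneg _) two_ne_zero).1 ?_
    rw [euNorm_sq, euNorm_sq]
    exact Finset.sum_congr rfl fun i _ => sq_abs _

/-- If `X` is at most one half, solutions of `(1 + X) v = y` are at most twice as long as `y`. -/
lemma euNorm_le_of_eq_sub_mulVec {X : Matrix (Fin k) (Fin k) ℝ} (hX : euOpNorm X ≤ 1 / 2)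
    {v y : Fin k → ℝ} (h : v = y - X *ᵥ v) : euNorm v ≤ 2 * euNorm y := by
  have h1 : euNorm v ≤ euNorm y + euNorm (X *ᵥ v) := by
    conv_lhs => rw [h]
    exact euNorm_sub_le _ _
  have h2 := (euNorm_mulVec_le X v).trans (mul_le_mul_of_nonneg_right hX (euNorm_nonneg v))
  linarith

lemma isUnit_one_add {X : Matrix (Fin k) (Fin k) ℝ} (hX : euOpNorm X ≤ 1 / 2) :
    IsUnit (1 + X) := by
  rw [← Matrix.mulVec_injective_iff_isUnit]
  refine (injective_iff_map_eq_zero (1 + X).mulVecLin).2 fun v hv => ?_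
  have h0 : v = 0 - X *ᵥ v := by
    have : v + X *ᵥ v = 0 := by simpa [Matrix.add_mulVec] using hv
    rw [zero_sub]; exact eq_neg_of_add_eq_zero_left this
  have h1 := euNorm_le_of_eq_sub_mulVec hX h0
  have h2 : euNorm v = 0 := le_antisymm (h1.trans (by simp [euNorm])) (euNorm_nonneg _)
  simpa [euNorm] using h2

/-- The average fitted value of a weighted least squares fit `b` with an intercept, whose normal
equations are `(1 + X) b = g`. The remainder of its second order expansion is `s' X b`, where
`s = ∑ w_i u_i` and where `X b` is at most twice as long as `X g`. -/
theorem abs_fitted_mean_sub_le (hint : ∀ i, U i ⬝ᵥ ∑ j, U j = 1) {w e : Fin n → ℝ}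
    (hX : euOpNorm (weightedGram U w) ≤ 1 / 2) {b : Fin k → ℝ}
    (hb : b = ∑ i, (w i * e i) • U i - weightedGram U w *ᵥ b) :
    |(∑ j, U j) ⬝ᵥ b - (∑ i, w i * e i - ∑ i, ∑ j, w i * w j * (U i ⬝ᵥ U j) * e j)|
      ≤ euNorm (∑ i, w i • U i) * (2 * euNorm (weightedGram U w *ᵥ ∑ i, (w i * e i) • U i)) := by
  set X := weightedGram U w with hXd
  set g := ∑ i, (w i * e i) • U i with hg
  set s := ∑ i, w i • U i with hs
  have hr : X *ᵥ b = X *ᵥ g - X *ᵥ (X *ᵥ b) := by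
    conv_lhs => rw [hb]
    rw [Matrix.mulVec_sub]
  have h1 : (∑ j, U j) ⬝ᵥ g = ∑ i, w i * e i := by
    rw [hg, dotProduct_sum]
    exact Finset.sum_congr rfl fun i _ => by
      rw [dotProduct_smul, dotProduct_comm, hint, smul_eq_mul, mul_one]
  have h2 : (∑ j, U j) ⬝ᵥ (X *ᵥ b) = s ⬝ᵥ b := by
    rw [hXd, weightedGram_mulVec, dotProduct_sum, hs, sum_dotProduct]
    exact Finset.sum_congr rfl fun i _ => by
      rw [dotProduct_smul, smul_dotProduct, dotProduct_comm (∑ j, U j), hint, smul_eq_mul,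
        smul_eq_mul, mul_one]
  have h3 : s ⬝ᵥ g = ∑ i, ∑ j, w i * w j * (U i ⬝ᵥ U j) * e j := by
    rw [hs, sum_dotProduct]
    refine Finset.sum_congr rfl fun i _ => ?_
    rw [hg, dotProduct_sum]
    refine Finset.sum_congr rfl fun j _ => ?_
    rw [smul_dotProduct, dotProduct_smul, smul_eq_mul, smul_eq_mul]; ring
  have h4 : (∑ j, U j) ⬝ᵥ b = ∑ i, w i * e i - s ⬝ᵥ b := by
    conv_lhs => rw [hb]
    rw [dotProduct_sub, h1, h2]
  have h5 : s ⬝ᵥ b = s ⬝ᵥ g - s ⬝ᵥ (X *ᵥ b) := by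
    conv_lhs => rw [hb]
    rw [dotProduct_sub]
  have h6 : (∑ j, U j) ⬝ᵥ b - (∑ i, w i * e i - ∑ i, ∑ j, w i * w j * (U i ⬝ᵥ U j) * e j)
      = s ⬝ᵥ (X *ᵥ b) := by
    rw [h4, h5, h3]; ring
  rw [h6]
  refine (abs_dotProduct_le _ _).trans ?_
  exact mul_le_mul_of_nonneg_left (euNorm_le_of_eq_sub_mulVec hX hr) (euNorm_nonneg _)

end Orthonormal

/-! ### Leave-one-out least squares -/

/-- The sum of a function of three indices, split according to which of them coincide. -/
lemma sum_triple_eq {ι : Type*} [Fintype ι] [DecidableEq ι] (f : ι → ι → ι → ℝ) :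
    ∑ i, ∑ j, ∑ l, f i j l
      = ∑ i, ∑ j, ∑ l, (if i = j ∨ j = l ∨ i = l then 0 else f i j l)
        + ∑ i, ∑ j, f i i j + ∑ i, ∑ j, f i j j + ∑ i, ∑ j, f i j i - 2 * ∑ i, f i i i := by
  have h : ∀ i j l, f i j l = (if i = j ∨ j = l ∨ i = l then 0 else f i j l)
      + (if i = j then f i j l else 0) + (if j = l then f i j l else 0)
      + (if i = l then f i j l else 0) - 2 * (if i = j then if i = l then f i j l else 0 else 0) := by
    intro i j l
    by_cases h1 : i = j
    · subst h1
      by_cases h2 : i = l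
      · subst h2; simp; ring
      · simp [h2]
    · by_cases h2 : j = l
      · subst h2; simp [h1]
      · by_cases h3 : i = l
        · subst h3; simp [h1, h2]
        · simp [h1, h2, h3]
  have e1 : ∑ i, ∑ j, ∑ l, (if i = j then f i j l else 0) = ∑ i, ∑ j, f i i j := by
    refine Finset.sum_congr rfl fun i _ => ?_
    rw [Finset.sum_comm]
    simp
  have e4 : ∑ i, ∑ j, ∑ l, (if i = j then if i = l then f i j l else 0 else 0)
      = ∑ i, f i i i := by
    refine Finset.sum_congr rfl fun i _ => ?_
    rw [Finset.sum_comm]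
    simp
  rw [Finset.sum_congr rfl fun i _ => Finset.sum_congr rfl fun j _ =>
    Finset.sum_congr rfl fun l _ => h i j l]
  simp only [Finset.sum_sub_distrib, Finset.sum_add_distrib, ← Finset.mul_sum, e1, e4]
  simp

section LeaveOneOut

variable {n k : ℕ} {U : Matrix (Fin n) (Fin k) ℝ}

/-- The coefficients of the linear chaos in the remainder of the cross-fitted estimator. -/
def cfLin (U : Matrix (Fin n) (Fin k) ℝ) (e : Fin n → ℝ) (a : ℝ) (i : Fin n) : ℝ :=
  (U i ⬝ᵥ U i) * e i + a * ∑ j, (U i ⬝ᵥ U j) * ((U j ⬝ᵥ U j) * e j)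

/-- The coefficients of the quadratic chaos in the remainder of the cross-fitted estimator. -/
def cfQuad (U : Matrix (Fin n) (Fin k) ℝ) (e : Fin n → ℝ) (a : ℝ) (i j : Fin n) : ℝ :=
  (U i ⬝ᵥ U i) * (U i ⬝ᵥ U j) * e j + (U i ⬝ᵥ U j) ^ 2 * e i
    - (a - 1) * ((U i ⬝ᵥ U j) * (U j ⬝ᵥ U j) * e j)

/-- The coefficients of the cubic chaos in the remainder of the cross-fitted estimator. -/
def cfCubic (U : Matrix (Fin n) (Fin k) ℝ) (e : Fin n → ℝ) (i j l : Fin n) : ℝ :=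
  if i = j ∨ j = l ∨ i = l then 0 else (U i ⬝ᵥ U j) * (U j ⬝ᵥ U l) * e l

/-- The leading terms of the remainder of the cross-fitted estimator. Leaving out unit `i`
cancels all contributions in which a weight occurs twice, up to a linear and a
quadratic chaos and terms of the order of the squared leverages. The weights take two values,
whence the relation `w² = a + (a - 1) w`. -/
lemma cf_leading_terms_eq {w e : Fin n → ℝ} {a : ℝ} (hw : ∀ i, w i ^ 2 = a + (a - 1) * w i) :
    ∑ i, w i ^ 2 * (U i ⬝ᵥ U i) * e i - ∑ i, w i * (1 + w i) * (U i ⬝ᵥ U i) * e i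
      - (∑ i, w i • U i) ⬝ᵥ (weightedGram U w *ᵥ ∑ i, (w i * e i) • U i)
      + ∑ i, w i * (1 + w i) * ((U i ⬝ᵥ U i) * (U i ⬝ᵥ ∑ j, (w j * e j) • U j))
      + ∑ i, w i * (1 + w i) * (e i * (U i ⬝ᵥ weightedGram U w *ᵥ U i))
    = - ∑ i, cfLin U e a i * w i
      - ∑ i, ∑ j, ∑ l, cfCubic U e i j l * (w i * w j * w l)
      + ∑ i, ∑ j, (if i = j then 0 else cfQuad U e a i j) * (w i * w j)
      + ∑ i, ((3 - a) * w i ^ 2 + 2 * w i ^ 3) * ((U i ⬝ᵥ U i) ^ 2 * e i) := by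
  have hg : ∀ v : Fin k → ℝ, v ⬝ᵥ ∑ j, (w j * e j) • U j = ∑ j, w j * e j * (v ⬝ᵥ U j) := by
    intro v
    rw [dotProduct_sum]
    exact Finset.sum_congr rfl fun j _ => by rw [dotProduct_smul, smul_eq_mul]
  have hX : ∀ u v : Fin k → ℝ,
      u ⬝ᵥ weightedGram U w *ᵥ v = ∑ j, w j * (U j ⬝ᵥ v) * (u ⬝ᵥ U j) := by
    intro u v
    rw [weightedGram_mulVec, dotProduct_sum]
    exact Finset.sum_congr rfl fun j _ => by rw [dotProduct_smul, smul_eq_mul]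
  have hcube : (∑ i, w i • U i) ⬝ᵥ (weightedGram U w *ᵥ ∑ i, (w i * e i) • U i)
      = ∑ i, ∑ j, ∑ l, (U i ⬝ᵥ U j) * (U j ⬝ᵥ U l) * e l * (w i * w j * w l) := by
    rw [sum_dotProduct]
    refine Finset.sum_congr rfl fun i _ => ?_
    rw [smul_dotProduct, hX, smul_eq_mul, Finset.mul_sum]
    refine Finset.sum_congr rfl fun j _ => ?_
    rw [hg, Finset.mul_sum, Finset.sum_mul, Finset.mul_sum]
    exact Finset.sum_congr rfl fun l _ => by ring
  have hoff : ∑ i, ∑ j, (if i = j then 0 else cfQuad U e a i j) * (w i * w j)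
      = ∑ i, ∑ j, cfQuad U e a i j * (w i * w j) - ∑ i, cfQuad U e a i i * (w i * w i) := by
    rw [← Finset.sum_sub_distrib]
    refine Finset.sum_congr rfl fun i _ => ?_
    have : cfQuad U e a i i * (w i * w i)
        = ∑ j, if i = j then cfQuad U e a i j * (w i * w j) else 0 := by simp
    rw [this, ← Finset.sum_sub_distrib]
    exact Finset.sum_congr rfl fun j _ => by split_ifs <;> ring
  have hcub : ∑ i, ∑ j, ∑ l, cfCubic U e i j l * (w i * w j * w l)
      = ∑ i, ∑ j, ∑ l, (if i = j ∨ j = l ∨ i = l then 0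
          else (U i ⬝ᵥ U j) * (U j ⬝ᵥ U l) * e l * (w i * w j * w l)) := by
    refine Finset.sum_congr rfl fun i _ => Finset.sum_congr rfl fun j _ =>
      Finset.sum_congr rfl fun l _ => ?_
    rw [cfCubic]; split_ifs <;> ring
  rw [hcube, sum_triple_eq, hcub, hoff]
  set CU := ∑ i, ∑ j, ∑ l, (if i = j ∨ j = l ∨ i = l then 0
          else (U i ⬝ᵥ U j) * (U j ⬝ᵥ U l) * e l * (w i * w j * w l))
  have hdouble : - ∑ i, ∑ j, (U i ⬝ᵥ U i) * (U i ⬝ᵥ U j) * e j * (w i * w i * w j)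
      - ∑ i, ∑ j, (U i ⬝ᵥ U j) * (U j ⬝ᵥ U j) * e j * (w i * w j * w j)
      - ∑ i, ∑ j, (U i ⬝ᵥ U j) * (U j ⬝ᵥ U i) * e i * (w i * w j * w i)
      + ∑ i, w i * (1 + w i) * ((U i ⬝ᵥ U i) * (U i ⬝ᵥ ∑ j, (w j * e j) • U j))
      + ∑ i, w i * (1 + w i) * (e i * (U i ⬝ᵥ weightedGram U w *ᵥ U i))
      = - ∑ i, (a * ∑ j, (U i ⬝ᵥ U j) * ((U j ⬝ᵥ U j) * e j)) * w i
        + ∑ i, ∑ j, cfQuad U e a i j * (w i * w j) := by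
    simp only [← Finset.sum_neg_distrib, ← Finset.sum_sub_distrib, ← Finset.sum_add_distrib]
    refine Finset.sum_congr rfl fun i _ => ?_
    rw [hg, hX]
    simp only [Finset.mul_sum, Finset.sum_mul]
    simp only [← Finset.sum_neg_distrib, ← Finset.sum_add_distrib]
    refine Finset.sum_congr rfl fun j _ => ?_
    rw [dotProduct_comm (U j) (U i), cfQuad]
    linear_combination (-(U i ⬝ᵥ U j) * (U j ⬝ᵥ U j) * e j * w i) * hw j
  have hsingle : ∑ i, w i ^ 2 * (U i ⬝ᵥ U i) * e i - ∑ i, w i * (1 + w i) * (U i ⬝ᵥ U i) * e i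
      + 2 * ∑ i, (U i ⬝ᵥ U i) * (U i ⬝ᵥ U i) * e i * (w i * w i * w i)
      = - ∑ i, (U i ⬝ᵥ U i) * e i * w i - ∑ i, cfQuad U e a i i * (w i * w i)
        + ∑ i, ((3 - a) * w i ^ 2 + 2 * w i ^ 3) * ((U i ⬝ᵥ U i) ^ 2 * e i) := by
    rw [Finset.mul_sum]
    simp only [← Finset.sum_neg_distrib, ← Finset.sum_sub_distrib, ← Finset.sum_add_distrib]
    refine Finset.sum_congr rfl fun i _ => ?_
    rw [cfQuad]; ring
  have hlin : ∑ i, cfLin U e a i * w i = ∑ i, (U i ⬝ᵥ U i) * e i * w i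
      + ∑ i, (a * ∑ j, (U i ⬝ᵥ U j) * ((U j ⬝ᵥ U j) * e j)) * w i := by
    rw [← Finset.sum_add_distrib]
    exact Finset.sum_congr rfl fun i _ => by rw [cfLin]; ring
  rw [hlin]
  linear_combination hdouble + hsingle

lemma abs_sum_mul_le_of_abs_le {c x y : Fin n → ℝ} {C : ℝ} (hc : ∀ i, |c i| ≤ C)
    (hxy : ∀ i, |x i| ≤ y i) : |∑ i, c i * x i| ≤ C * ∑ i, y i := by
  rw [Finset.mul_sum]
  refine (Finset.abs_sum_le_sum_abs _ _).trans (Finset.sum_le_sum fun i _ => ?_)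
  rw [abs_mul]
  exact mul_le_mul (hc i) (hxy i) (abs_nonneg _) ((abs_nonneg _).trans (hc i))

set_option maxHeartbeats 1000000 in
/-- The expansion of the leave-one-out fits. Here `b` solves the full normal equations
`(1 + X) b = g`, the vector `c i` is `(1 + X)⁻¹ u_i`, and the fit of unit `i` without that unit is
given by the Sherman-Morrison formula. The parameter `a` stands for the odds against the arm, and
the constant `40` is not sharp. -/
theorem abs_cf_remainder_le (hU : Uᵀ * U = 1) {w e : Fin n → ℝ} {a K κ : ℝ}
    (ha0 : 0 ≤ a) (haK : a ≤ K) (hK : 1 ≤ K)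
    (hw : ∀ i, w i ^ 2 = a + (a - 1) * w i) (hwK : ∀ i, |w i| ≤ K) (hκ0 : 0 ≤ κ)
    (hκ : ∀ i, U i ⬝ᵥ U i ≤ κ) (hκK : (1 + K) * (2 * κ) ≤ 1 / 2)
    (hX : euOpNorm (weightedGram U w) ≤ 1 / 2) {b : Fin k → ℝ} {c : Fin n → Fin k → ℝ}
    (hb : b = ∑ i, (w i * e i) • U i - weightedGram U w *ᵥ b)
    (hc : ∀ i, c i = U i - weightedGram U w *ᵥ c i) :
    |∑ i, w i * ((U i ⬝ᵥ b - (1 + w i) * (U i ⬝ᵥ c i) * e i) / (1 - (1 + w i) * (U i ⬝ᵥ c i)))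
        - (∑ i, ∑ j, w i * w j * (U i ⬝ᵥ U j) * e j - ∑ i, w i ^ 2 * (U i ⬝ᵥ U i) * e i)|
      ≤ |∑ i, cfLin U e a i * w i| + |∑ i, ∑ j, ∑ l, cfCubic U e i j l * (w i * w j * w l)|
        + |∑ i, ∑ j, (if i = j then 0 else cfQuad U e a i j) * (w i * w j)|
        + 40 * (1 + K) ^ 3 * (euNorm (∑ i, w i • U i) * euOpNorm (weightedGram U w)
              * euNorm (weightedGram U w *ᵥ ∑ i, (w i * e i) • U i)
            + √(κ * k) * (euNorm (weightedGram U w *ᵥ ∑ i, (w i * e i) • U i)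
              + euOpNorm (weightedGram U w) * euNorm (∑ i, (w i * e i) • U i)
              + euOpNorm (weightedGram U w) ^ 2 * euNorm e
              + κ * euNorm (∑ i, (w i * e i) • U i) + κ * euNorm e)) := by
  have hlead := cf_leading_terms_eq (U := U) (e := e) hw
  set X := weightedGram U w with hXd
  set g := ∑ i, (w i * e i) • U i with hg
  set s := ∑ i, w i • U i with hs
  set ρ := euOpNorm X with hρ
  have hρ0 : 0 ≤ ρ := euOpNorm_nonneg _
  set h : Fin n → ℝ := fun i => U i ⬝ᵥ c i with hh
  set q : Fin n → ℝ := fun i => U i ⬝ᵥ b with hq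
  set p : Fin n → ℝ := fun i => U i ⬝ᵥ U i with hp
  have hp0 : ∀ i, 0 ≤ p i := fun i => leverage_nonneg U i
  set r := X *ᵥ b with hrd
  have hbr : b = g - r := hb
  have hr : r = X *ᵥ g - X *ᵥ r := by
    conv_lhs => rw [hrd, hbr]
    rw [Matrix.mulVec_sub]
  have hrn : euNorm r ≤ 2 * euNorm (X *ᵥ g) := euNorm_le_of_eq_sub_mulVec hX hr
  have hbn : euNorm b ≤ 2 * euNorm g := euNorm_le_of_eq_sub_mulVec hX hb
  set d : Fin n → Fin k → ℝ := fun i => X *ᵥ c i with hdd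
  have hcd : ∀ i, c i = U i - d i := hc
  have hd : ∀ i, d i = X *ᵥ U i - X *ᵥ d i := by
    intro i
    conv_lhs => rw [hdd]; dsimp only; rw [hcd]
    rw [Matrix.mulVec_sub]
  have hUn : ∀ i, euNorm (U i) ^ 2 = p i := fun i => euNorm_sq' _
  have hdn : ∀ i, euNorm (d i) ≤ 2 * (ρ * euNorm (U i)) := fun i =>
    (euNorm_le_of_eq_sub_mulVec hX (hd i)).trans
      (mul_le_mul_of_nonneg_left (euNorm_mulVec_le _ _) (by norm_num))
  -- the leverages `h i` in the weighted regression
  have hhp : ∀ i, |h i - p i| ≤ 2 * ρ * p i := by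
    intro i
    have e1 : h i - p i = - (U i ⬝ᵥ d i) := by
      rw [hh, hp]; dsimp only; rw [hcd i, dotProduct_sub]; ring
    rw [e1, abs_neg]
    refine (abs_dotProduct_le _ _).trans ?_
    refine (mul_le_mul_of_nonneg_left (hdn i) (euNorm_nonneg _)).trans (le_of_eq ?_)
    rw [← hUn]; ring
  set δ : Fin n → ℝ := fun i => U i ⬝ᵥ X *ᵥ d i with hδ
  have hδn : ∀ i, |δ i| ≤ 2 * ρ ^ 2 * p i := by
    intro i
    refine (abs_dotProduct_le _ _).trans ?_
    have h1 : euNorm (X *ᵥ d i) ≤ ρ * (2 * (ρ * euNorm (U i))) :=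
      (euNorm_mulVec_le _ _).trans (mul_le_mul_of_nonneg_left (hdn i) hρ0)
    refine (mul_le_mul_of_nonneg_left h1 (euNorm_nonneg _)).trans (le_of_eq ?_)
    rw [← hUn]; ring
  have hhδ : ∀ i, h i = p i - U i ⬝ᵥ X *ᵥ U i + δ i := by
    intro i
    rw [hh, hp, hδ]; dsimp only
    have e1 : U i ⬝ᵥ d i = U i ⬝ᵥ X *ᵥ U i - U i ⬝ᵥ X *ᵥ d i := by
      conv_lhs => rw [hd i]
      rw [dotProduct_sub]
    rw [hcd i, dotProduct_sub, e1]; ring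
  have hh2 : ∀ i, |h i| ≤ 2 * p i := by
    intro i
    have h1 := hhp i
    have h2 : |h i| ≤ |h i - p i| + |p i| := by
      simpa using abs_add_le (h i - p i) (p i)
    rw [abs_of_nonneg (hp0 i)] at h2
    nlinarith [hp0 i]
  have hθ : ∀ i, |1 + w i| ≤ 1 + K := fun i =>
    (abs_add_le _ _).trans (by rw [abs_one]; linarith [hwK i])
  have hθh : ∀ i, |(1 + w i) * h i| ≤ 1 / 2 := by
    intro i
    rw [abs_mul]
    refine le_trans ?_ hκK
    exact mul_le_mul (hθ i) ((hh2 i).trans (by linarith [hκ i])) (abs_nonneg _) (by linarith)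
  have hden : ∀ i, 1 / 2 ≤ 1 - (1 + w i) * h i := fun i => by
    have := (abs_le.1 (hθh i)).2
    linarith
  -- expansion of the Sherman-Morrison formula
  have hSM : ∀ i, w i * ((q i - (1 + w i) * h i * e i) / (1 - (1 + w i) * h i))
      = w i * q i + w i * (1 + w i) * ((h i - p i) * q i) + w i * (1 + w i) * (p i * q i)
        - w i * (1 + w i) * (h i * e i)
        + w i * (1 + w i) ^ 2 * (h i ^ 2 * (q i - e i) / (1 - (1 + w i) * h i)) := by
    intro i
    have : 1 - (1 + w i) * h i ≠ 0 := by linarith [hden i]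
    field_simp
    ring
  have hsb : ∑ i, w i * q i = s ⬝ᵥ b := by
    rw [hs, sum_dotProduct]
    exact Finset.sum_congr rfl fun i _ => by rw [smul_dotProduct, smul_eq_mul]
  have hsg : s ⬝ᵥ g = ∑ i, ∑ j, w i * w j * (U i ⬝ᵥ U j) * e j := by
    rw [hs, sum_dotProduct]
    refine Finset.sum_congr rfl fun i _ => ?_
    rw [hg, dotProduct_sum]
    refine Finset.sum_congr rfl fun j _ => ?_
    rw [smul_dotProduct, dotProduct_smul, smul_eq_mul, smul_eq_mul]; ring
  have hsb' : s ⬝ᵥ b = s ⬝ᵥ g - s ⬝ᵥ X *ᵥ g + s ⬝ᵥ X *ᵥ r := by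
    have e1 : s ⬝ᵥ r = s ⬝ᵥ X *ᵥ g - s ⬝ᵥ X *ᵥ r := by
      conv_lhs => rw [hr]
      rw [dotProduct_sub]
    rw [hbr, dotProduct_sub, e1]; ring
  set R₁ := s ⬝ᵥ X *ᵥ r with hR₁
  set R₂ := ∑ i, w i * (1 + w i) * (p i * (U i ⬝ᵥ r)) with hR₂
  set R₃ := ∑ i, w i * (1 + w i) * ((h i - p i) * q i) with hR₃
  set R₄ := ∑ i, w i * (1 + w i) * (e i * δ i) with hR₄
  set R₅ := ∑ i, w i * (1 + w i) ^ 2 * (h i ^ 2 * (q i - e i) / (1 - (1 + w i) * h i)) with hR₅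
  set R₆ := ∑ i, ((3 - a) * w i ^ 2 + 2 * w i ^ 3) * (p i ^ 2 * e i) with hR₆
  have hpq : ∑ i, w i * (1 + w i) * (p i * q i)
      = ∑ i, w i * (1 + w i) * (p i * (U i ⬝ᵥ g)) - R₂ := by
    rw [hR₂, ← Finset.sum_sub_distrib]
    refine Finset.sum_congr rfl fun i _ => ?_
    rw [hq]; dsimp only
    rw [hbr, dotProduct_sub]; ring
  have hhe : ∑ i, w i * (1 + w i) * (h i * e i)
      = ∑ i, w i * (1 + w i) * p i * e i - ∑ i, w i * (1 + w i) * (e i * (U i ⬝ᵥ X *ᵥ U i))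
        + R₄ := by
    rw [hR₄, ← Finset.sum_sub_distrib, ← Finset.sum_add_distrib]
    exact Finset.sum_congr rfl fun i _ => by rw [hhδ i]; ring
  have htot : ∑ i, w i * ((q i - (1 + w i) * h i * e i) / (1 - (1 + w i) * h i))
        - (∑ i, ∑ j, w i * w j * (U i ⬝ᵥ U j) * e j - ∑ i, w i ^ 2 * p i * e i)
      = - ∑ i, cfLin U e a i * w i
      - ∑ i, ∑ j, ∑ l, cfCubic U e i j l * (w i * w j * w l)
      + ∑ i, ∑ j, (if i = j then 0 else cfQuad U e a i j) * (w i * w j)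
      + (R₁ - R₂ + R₃ - R₄ + R₅ + R₆) := by
    simp only [hSM, Finset.sum_add_distrib, Finset.sum_sub_distrib]
    rw [hsb, hsb', hsg, hpq, hhe]
    linear_combination hlead
  -- bounds for the remainders
  have hKn : 0 ≤ 1 + K := by linarith
  set N := √(κ * k) with hN
  have hN0 : 0 ≤ N := Real.sqrt_nonneg _
  have hww : ∀ i, |w i * (1 + w i)| ≤ (1 + K) ^ 2 := by
    intro i
    rw [abs_mul, sq]
    exact mul_le_mul ((hwK i).trans (by linarith)) (hθ i) (abs_nonneg _) hKn
  have hqn : euNorm q = euNorm b := euNorm_dotProduct_row hU b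
  have hpc : ∀ x : Fin n → ℝ, ∑ i, p i * |x i| ≤ N * euNorm x := fun x =>
    sum_leverage_mul_abs_le hU hκ x
  have hppc : ∀ x : Fin n → ℝ, ∑ i, p i ^ 2 * |x i| ≤ κ * (N * euNorm x) := fun x => by
    refine le_trans ?_ (mul_le_mul_of_nonneg_left (hpc x) hκ0)
    rw [Finset.mul_sum]
    refine Finset.sum_le_sum fun i _ => ?_
    have := mul_le_mul_of_nonneg_right (hκ i) (mul_nonneg (hp0 i) (abs_nonneg (x i)))
    calc p i ^ 2 * |x i| = p i * (p i * |x i|) := by ring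
      _ ≤ _ := this
  set g' := euNorm g with hg'
  set x' := euNorm (X *ᵥ g) with hx'
  set e' := euNorm e with he'
  set s' := euNorm s with hs'
  have hg0 : 0 ≤ g' := euNorm_nonneg _
  have hx0 : 0 ≤ x' := euNorm_nonneg _
  have he0 : 0 ≤ e' := euNorm_nonneg _
  have hs0 : 0 ≤ s' := euNorm_nonneg _
  have b1 : |R₁| ≤ 2 * (s' * ρ * x') := by
    refine (abs_dotProduct_le _ _).trans ?_
    have := (euNorm_mulVec_le X r).trans (mul_le_mul_of_nonneg_left hrn hρ0)
    refine (mul_le_mul_of_nonneg_left this hs0).trans (le_of_eq (by ring))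
  have b2 : |R₂| ≤ (1 + K) ^ 2 * (2 * (N * x')) := by
    refine (abs_sum_mul_le_of_abs_le hww (y := fun i => p i * |U i ⬝ᵥ r|) fun i => ?_).trans ?_
    · rw [abs_mul, abs_of_nonneg (hp0 i)]
    · refine mul_le_mul_of_nonneg_left ((hpc fun i => U i ⬝ᵥ r).trans ?_) (by positivity)
      rw [euNorm_dotProduct_row hU]
      exact (mul_le_mul_of_nonneg_left hrn hN0).trans (le_of_eq (by ring))
  have b3 : |R₃| ≤ (1 + K) ^ 2 * (4 * (N * (ρ * g'))) := by
    refine (abs_sum_mul_le_of_abs_le hww (y := fun i => 2 * ρ * (p i * |q i|)) fun i => ?_).trans ?_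
    · rw [abs_mul, ← mul_assoc]
      exact mul_le_mul_of_nonneg_right (hhp i) (abs_nonneg _)
    · refine mul_le_mul_of_nonneg_left ?_ (by positivity)
      rw [← Finset.mul_sum]
      refine (mul_le_mul_of_nonneg_left (hpc q) (by positivity)).trans ?_
      rw [hqn]
      calc 2 * ρ * (N * euNorm b) ≤ 2 * ρ * (N * (2 * g')) := by gcongr
        _ = _ := by ring
  have b4 : |R₄| ≤ (1 + K) ^ 2 * (2 * (N * (ρ ^ 2 * e'))) := by
    refine (abs_sum_mul_le_of_abs_le hww (y := fun i => 2 * ρ ^ 2 * (p i * |e i|)) fun i => ?_).trans ?_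
    · rw [abs_mul]
      calc |e i| * |δ i| ≤ |e i| * (2 * ρ ^ 2 * p i) :=
            mul_le_mul_of_nonneg_left (hδn i) (abs_nonneg _)
        _ = _ := by ring
    · refine mul_le_mul_of_nonneg_left ?_ (by positivity)
      rw [← Finset.mul_sum]
      exact (mul_le_mul_of_nonneg_left (hpc e) (by positivity)).trans (le_of_eq (by ring))
  have b5 : |R₅| ≤ (1 + K) ^ 3 * (8 * (N * (κ * (2 * g' + e')))) := by
    refine (abs_sum_mul_le_of_abs_le (C := (1 + K) ^ 3)
      (y := fun i => 8 * (p i ^ 2 * |q i| + p i ^ 2 * |e i|)) (fun i => ?_) fun i => ?_).trans ?_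
    · rw [abs_mul, abs_pow]
      calc |w i| * |1 + w i| ^ 2 ≤ (1 + K) * (1 + K) ^ 2 := by
            have := hθ i
            have := hwK i
            gcongr
            linarith
        _ = _ := by ring
    · have hd0 : 0 < 1 - (1 + w i) * h i := by linarith [hden i]
      rw [abs_div, abs_of_pos hd0, div_le_iff₀ hd0, abs_mul, abs_pow]
      have h1 : |q i - e i| ≤ |q i| + |e i| := abs_sub _ _
      have h2 : |h i| ^ 2 ≤ (2 * p i) ^ 2 := pow_le_pow_left₀ (abs_nonneg _) (hh2 i) 2
      calc |h i| ^ 2 * |q i - e i| ≤ (2 * p i) ^ 2 * (|q i| + |e i|) := by gcongr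
        _ = 8 * (p i ^ 2 * |q i| + p i ^ 2 * |e i|) * (1 / 2) := by ring
        _ ≤ _ := by
          refine mul_le_mul_of_nonneg_left (hden i) ?_
          positivity
    · refine mul_le_mul_of_nonneg_left ?_ (by positivity)
      rw [← Finset.mul_sum, Finset.sum_add_distrib]
      have h1 := hppc q
      have h2 := hppc e
      rw [hqn] at h1
      have h3 : κ * (N * euNorm b) ≤ κ * (N * (2 * g')) := by gcongr
      calc 8 * (∑ i, p i ^ 2 * |q i| + ∑ i, p i ^ 2 * |e i|)
          ≤ 8 * (κ * (N * (2 * g')) + κ * (N * e')) := by gcongr; exact h1.trans h3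
        _ = _ := by ring
  have b6 : |R₆| ≤ (1 + K) ^ 3 * (3 * (N * (κ * e'))) := by
    refine (abs_sum_mul_le_of_abs_le (C := 3 * (1 + K) ^ 3)
      (y := fun i => p i ^ 2 * |e i|) (fun i => ?_) fun i => ?_).trans ?_
    · have h1 : |3 - a| ≤ 3 + K := by rw [abs_le]; constructor <;> linarith
      have h2 : |w i| ^ 2 ≤ K ^ 2 := pow_le_pow_left₀ (abs_nonneg _) (hwK i) 2
      have h3 : |w i| ^ 3 ≤ K ^ 3 := pow_le_pow_left₀ (abs_nonneg _) (hwK i) 3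
      calc |(3 - a) * w i ^ 2 + 2 * w i ^ 3| ≤ |(3 - a) * w i ^ 2| + |2 * w i ^ 3| := abs_add_le _ _
        _ = |3 - a| * |w i| ^ 2 + 2 * |w i| ^ 3 := by
          rw [abs_mul, abs_mul, abs_pow, abs_pow, abs_two]
        _ ≤ (3 + K) * K ^ 2 + 2 * K ^ 3 := by gcongr
        _ ≤ 3 * (1 + K) ^ 3 := by nlinarith [sq_nonneg K]
    · rw [abs_mul, abs_of_nonneg (sq_nonneg (p i))]
    · refine (mul_le_mul_of_nonneg_left (hppc e) (by positivity)).trans (le_of_eq (by ring))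
  change |∑ i, w i * ((q i - (1 + w i) * h i * e i) / (1 - (1 + w i) * h i))
        - (∑ i, ∑ j, w i * w j * (U i ⬝ᵥ U j) * e j - ∑ i, w i ^ 2 * p i * e i)| ≤ _
  rw [htot]
  set A₁ := ∑ i, cfLin U e a i * w i
  set A₂ := ∑ i, ∑ j, ∑ l, cfCubic U e i j l * (w i * w j * w l)
  set A₃ := ∑ i, ∑ j, (if i = j then 0 else cfQuad U e a i j) * (w i * w j)
  have hsum : |-A₁ - A₂ + A₃ + (R₁ - R₂ + R₃ - R₄ + R₅ + R₆)|
      ≤ |A₁| + |A₂| + |A₃| + (|R₁| + |R₂| + |R₃| + |R₄| + |R₅| + |R₆|) := by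
    rw [abs_le]
    constructor <;>
    linarith [neg_abs_le A₁, le_abs_self A₁, neg_abs_le A₂, le_abs_self A₂, neg_abs_le A₃,
      le_abs_self A₃, neg_abs_le R₁, le_abs_self R₁, neg_abs_le R₂, le_abs_self R₂, neg_abs_le R₃,
      le_abs_self R₃, neg_abs_le R₄, le_abs_self R₄, neg_abs_le R₅, le_abs_self R₅, neg_abs_le R₆,
      le_abs_self R₆]
  refine hsum.trans (add_le_add le_rfl ?_)
  have hL1 : (1 : ℝ) ≤ (1 + K) ^ 3 := one_le_pow₀ (by linarith)
  have hL2 : (1 + K) ^ 2 ≤ (1 + K) ^ 3 := pow_le_pow_right₀ (by linarith) (by norm_num)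
  set L := (1 + K) ^ 3
  have t1 : 0 ≤ s' * ρ * x' := by positivity
  have t2 : 0 ≤ N * x' := by positivity
  have t3 : 0 ≤ N * (ρ * g') := by positivity
  have t4 : 0 ≤ N * (ρ ^ 2 * e') := by positivity
  have t5 : 0 ≤ N * (κ * g') := by positivity
  have t6 : 0 ≤ N * (κ * e') := by positivity
  have c1 : |R₁| ≤ L * (2 * (s' * ρ * x')) := b1.trans (le_mul_of_one_le_left (by positivity) hL1)
  have c2 : |R₂| ≤ L * (2 * (N * x')) := b2.trans (mul_le_mul_of_nonneg_right hL2 (by positivity))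
  have c3 : |R₃| ≤ L * (4 * (N * (ρ * g'))) :=
    b3.trans (mul_le_mul_of_nonneg_right hL2 (by positivity))
  have c4 : |R₄| ≤ L * (2 * (N * (ρ ^ 2 * e'))) :=
    b4.trans (mul_le_mul_of_nonneg_right hL2 (by positivity))
  calc |R₁| + |R₂| + |R₃| + |R₄| + |R₅| + |R₆|
      ≤ L * (2 * (s' * ρ * x') + 2 * (N * x') + 4 * (N * (ρ * g')) + 2 * (N * (ρ ^ 2 * e'))
          + 16 * (N * (κ * g')) + 11 * (N * (κ * e'))) := by linarith
    _ ≤ L * (40 * (s' * ρ * x') + 40 * (N * x') + 40 * (N * (ρ * g')) + 40 * (N * (ρ ^ 2 * e'))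
          + 40 * (N * (κ * g')) + 40 * (N * (κ * e'))) := by
        refine mul_le_mul_of_nonneg_left ?_ (by positivity)
        linarith
    _ = _ := by ring

end LeaveOneOut

/-! ### Reduction of the estimators to an orthonormal design -/

namespace RCT

/-- A change of coordinates makes the regressors orthonormal: `Z = U B` with `U'U = 1` and `B`
invertible. -/
lemma exists_orthonormal_design (E : RCT) :
    ∃ (U : Matrix (Fin E.n) (Fin (E.d + 1)) ℝ) (B : Matrix (Fin (E.d + 1)) (Fin (E.d + 1)) ℝ),
      Uᵀ * U = 1 ∧ IsUnit B ∧ E.Z = U * B := by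
  obtain ⟨B, hB⟩ : ∃ B : Matrix (Fin (E.d + 1)) (Fin (E.d + 1)) ℝ, E.Zᵀ * E.Z = Bᵀ * B := by
    obtain ⟨V, a, hV₁, -, hV⟩ := exists_spectral (X := E.Zᵀ * E.Z) (by simp)
    have hdiag : (E.Z * V)ᵀ * (E.Z * V) = Matrix.diagonal a := by
      rw [Matrix.transpose_mul, Matrix.mul_assoc, ← Matrix.mul_assoc E.Zᵀ, hV, Matrix.mul_assoc,
        Matrix.mul_assoc, hV₁, Matrix.mul_one, ← Matrix.mul_assoc, hV₁, Matrix.one_mul]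
    have ha : ∀ i, 0 ≤ a i := fun i => by
      have h := congrFun (congrFun hdiag i) i
      rw [Matrix.diagonal_apply_eq, Matrix.mul_apply] at h
      rw [← h]
      exact Finset.sum_nonneg fun j _ => mul_self_nonneg _
    refine ⟨Matrix.diagonal (fun i => √(a i)) * Vᵀ, ?_⟩
    have hsq : Matrix.diagonal a
        = Matrix.diagonal (fun i => √(a i)) * Matrix.diagonal (fun i => √(a i)) := by
      rw [Matrix.diagonal_mul_diagonal]
      simp only [Real.mul_self_sqrt (ha _)]
    rw [hV, Matrix.transpose_mul, Matrix.transpose_transpose, Matrix.diagonal_transpose, hsq]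
    simp only [Matrix.mul_assoc]
  have hunit : IsUnit (E.Zᵀ * E.Z) := E.gram_isUnit
  have hBu : IsUnit B := by
    rw [hB] at hunit
    rw [Matrix.isUnit_iff_isUnit_det] at hunit ⊢
    rw [Matrix.det_mul, Matrix.det_transpose] at hunit
    exact isUnit_of_mul_isUnit_left hunit
  have hdet := (Matrix.isUnit_iff_isUnit_det B).1 hBu
  refine ⟨E.Z * B⁻¹, B, ?_, hBu, ?_⟩
  · rw [Matrix.transpose_mul, Matrix.mul_assoc, ← Matrix.mul_assoc E.Zᵀ, hB, Matrix.mul_assoc,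
      Matrix.mul_nonsing_inv _ hdet, Matrix.mul_one, ← Matrix.transpose_mul,
      Matrix.mul_nonsing_inv _ hdet, Matrix.transpose_one]
  · rw [Matrix.mul_assoc, Matrix.nonsing_inv_mul _ hdet, Matrix.mul_one]

/-- A design matrix with orthonormal columns spanning the same space as `Z`. -/
noncomputable def orthoDesign (E : RCT) : Matrix (Fin E.n) (Fin (E.d + 1)) ℝ :=
  E.exists_orthonormal_design.choose

/-- The change of coordinates `B` in `Z = U B`, where `U` is the orthonormal design. -/
noncomputable def orthoCoord (E : RCT) : Matrix (Fin (E.d + 1)) (Fin (E.d + 1)) ℝ :=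
  E.exists_orthonormal_design.choose_spec.choose

/-- The weights `w_i = 1{T_i = t} / P(T_i = t) - 1`. -/
noncomputable def weight (E : RCT) (t : Fin 2) (S : E.Assignment) (i : Fin E.n) : ℝ :=
  E.ind t S i / E.share t - 1

/-- The odds against arm `t`, that is `n₀ / n₁` for `t = 1` and `n₁ / n₀` for `t = 0`. -/
noncomputable def odds (E : RCT) (t : Fin 2) : ℝ := 1 / E.share t - 1

section

variable (E : RCT)

lemma orthoDesign_orthonormal : E.orthoDesignᵀ * E.orthoDesign = 1 :=
  E.exists_orthonormal_design.choose_spec.choose_spec.1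

lemma orthoCoord_isUnit : IsUnit E.orthoCoord :=
  E.exists_orthonormal_design.choose_spec.choose_spec.2.1

lemma Z_eq_mul : E.Z = E.orthoDesign * E.orthoCoord :=
  E.exists_orthonormal_design.choose_spec.choose_spec.2.2

lemma n_pos : 0 < E.n := E.n₁_pos.trans E.n₁_lt

lemma n₀_pos : 0 < E.n₀ := Nat.sub_pos_of_lt E.n₁_lt

lemma cast_n_pos : (0 : ℝ) < E.n := by exact_mod_cast E.n_pos

lemma cast_n₁_pos : (0 : ℝ) < E.n₁ := by exact_mod_cast E.n₁_pos

lemma cast_n₀_pos : (0 : ℝ) < E.n₀ := by exact_mod_cast E.n₀_pos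

lemma cast_n₀ : (E.n₀ : ℝ) = E.n - E.n₁ := by rw [n₀, Nat.cast_sub E.n₁_lt.le]

lemma armSize_pos (t : Fin 2) : 0 < E.armSize t := by
  unfold armSize; split_ifs
  · exact E.cast_n₁_pos
  · exact E.cast_n₀_pos

lemma share_eq (t : Fin 2) : E.share t = E.armSize t / E.n := by
  have := E.cast_n_pos.ne'
  unfold share armSize π; split_ifs
  · rfl
  · rw [cast_n₀]; field_simp

lemma share_pos (t : Fin 2) : 0 < E.share t := by
  rw [share_eq]; exact div_pos (E.armSize_pos t) E.cast_n_pos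

lemma odds_nonneg (t : Fin 2) : 0 ≤ E.odds t := by
  rw [odds, share_eq, one_div_div, sub_nonneg, le_div_iff₀ (E.armSize_pos t), one_mul]
  unfold armSize; split_ifs
  · exact_mod_cast E.n₁_lt.le
  · rw [cast_n₀]; linarith [E.cast_n₁_pos]

lemma ind_eq_zero_or_one (t : Fin 2) (S : E.Assignment) (i : Fin E.n) :
    E.ind t S i = 0 ∨ E.ind t S i = 1 := by
  unfold ind T; split_ifs <;> simp

lemma weight_sq (t : Fin 2) (S : E.Assignment) (i : Fin E.n) :
    E.weight t S i ^ 2 = E.odds t + (E.odds t - 1) * E.weight t S i := by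
  unfold weight odds
  rcases E.ind_eq_zero_or_one t S i with h | h <;> rw [h] <;> ring

lemma one_add_weight (t : Fin 2) (S : E.Assignment) (i : Fin E.n) :
    1 + E.weight t S i = E.ind t S i / E.share t := by unfold weight; ring

lemma ind_eq_share_mul (t : Fin 2) (S : E.Assignment) (i : Fin E.n) :
    E.ind t S i = E.share t * (1 + E.weight t S i) := by
  rw [one_add_weight, mul_div_cancel₀ _ (E.share_pos t).ne']

lemma isSamplingWeight (t : Fin 2) {K : ℝ} (hK : 1 ≤ K) (h : 1 / E.share t ≤ K) :
    IsSamplingWeight E.n E.n₁ (E.weight t) K where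
  map_swap i j S l := by
    have : ∀ l, l ∈ S.map (Equiv.swap i j).toEmbedding ↔ Equiv.swap i j l ∈ S := fun l => by
      rw [Finset.mem_map_equiv, Equiv.symm_swap]
    simp only [weight, ind, T, this]
  sum_eq_zero S hS := by
    have h1 : ∑ i, E.ind t S i = E.armSize t := by
      have hT : ∑ i, E.T S i = E.n₁ := by simp [T, hS]
      unfold ind armSize; split_ifs
      · exact hT
      · rw [Finset.sum_sub_distrib, hT, cast_n₀]; simp
    simp only [weight]
    rw [Finset.sum_sub_distrib, ← Finset.sum_div, h1, share_eq, div_div_cancel₀ (E.armSize_pos t).ne']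
    simp
  abs_le S i := by
    have h0 := E.odds_nonneg t
    unfold weight
    unfold odds at h0
    rcases E.ind_eq_zero_or_one t S i with h' | h' <;> rw [h']
    · simpa using hK
    · rw [abs_of_nonneg h0]; linarith

lemma z_dotProduct (i : Fin E.n) (v : Fin (E.d + 1) → ℝ) :
    E.z i ⬝ᵥ v = E.orthoDesign i ⬝ᵥ E.orthoCoord *ᵥ v := by
  have h : E.z i = E.orthoDesign i ᵥ* E.orthoCoord := by
    unfold z
    conv_lhs => rw [Z_eq_mul]
    rfl
  rw [h, Matrix.dotProduct_mulVec]

lemma z_eq (i : Fin E.n) : E.z i = E.orthoCoordᵀ *ᵥ E.orthoDesign i := by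
  rw [Matrix.mulVec_transpose]
  unfold z
  conv_lhs => rw [Z_eq_mul]
  rfl

lemma gram_inv : (E.Zᵀ * E.Z)⁻¹ = E.orthoCoord⁻¹ * (E.orthoCoord⁻¹)ᵀ := by
  have h : E.Zᵀ * E.Z = E.orthoCoordᵀ * E.orthoCoord := by
    rw [Z_eq_mul, Matrix.transpose_mul, Matrix.mul_assoc, ← Matrix.mul_assoc E.orthoDesignᵀ,
      orthoDesign_orthonormal, Matrix.one_mul]
  rw [h, Matrix.mul_inv_rev, Matrix.transpose_nonsing_inv]

lemma z_gram_inv_z (i j : Fin E.n) :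
    E.z i ⬝ᵥ (E.Zᵀ * E.Z)⁻¹ *ᵥ E.z j = E.orthoDesign i ⬝ᵥ E.orthoDesign j := by
  have hdet := (Matrix.isUnit_iff_isUnit_det _).1 E.orthoCoord_isUnit
  have h : E.orthoCoord * (E.Zᵀ * E.Z)⁻¹ * E.orthoCoordᵀ = 1 := by
    rw [gram_inv, ← Matrix.mul_assoc, Matrix.mul_nonsing_inv _ hdet, Matrix.one_mul,
      ← Matrix.transpose_mul, Matrix.mul_nonsing_inv _ hdet, Matrix.transpose_one]
  rw [z_dotProduct, z_eq, Matrix.mulVec_mulVec, Matrix.mulVec_mulVec, h,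
    Matrix.one_mulVec]

lemma P_apply (i j : Fin E.n) : E.P i j = E.orthoDesign i ⬝ᵥ E.orthoDesign j := by
  rw [← z_gram_inv_z, P, Matrix.mul_assoc, Matrix.mul_apply_eq_vecMul, Matrix.dotProduct_mulVec]
  rw [← Matrix.vecMul_vecMul]
  rfl

lemma z_Sig_inv_z (i j : Fin E.n) :
    E.z i ⬝ᵥ E.Sig⁻¹ *ᵥ E.z j = E.n * (E.orthoDesign i ⬝ᵥ E.orthoDesign j) := by
  have hn := E.cast_n_pos.ne'
  have hdet := (Matrix.isUnit_iff_isUnit_det _).1 E.gram_isUnit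
  have h : E.Sig⁻¹ = (E.n : ℝ) • (E.Zᵀ * E.Z)⁻¹ := by
    refine Matrix.inv_eq_left_inv ?_
    rw [Sig, Matrix.smul_mul, Matrix.mul_smul, smul_smul, mul_one_div_cancel hn, one_smul]
    exact Matrix.nonsing_inv_mul _ hdet
  rw [h, Matrix.smul_mulVec, dotProduct_smul, z_gram_inv_z, smul_eq_mul]

lemma leverage_le_kappa (i : Fin E.n) : E.orthoDesign i ⬝ᵥ E.orthoDesign i ≤ E.kappa := by
  rw [← P_apply]
  exact le_ciSup (f := fun i => E.P i i) (Set.finite_range _).bddAbove i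

lemma kappa_nonneg : 0 ≤ E.kappa :=
  (leverage_nonneg _ ⟨0, E.n_pos⟩).trans (E.leverage_le_kappa ⟨0, E.n_pos⟩)

lemma kappa_le_one : E.kappa ≤ 1 := by
  have : Nonempty (Fin E.n) := ⟨⟨0, E.n_pos⟩⟩
  exact ciSup_le fun i => by rw [P_apply]; exact leverage_le_one E.orthoDesign_orthonormal i

lemma z_zero (i : Fin E.n) : E.z i 0 = 1 := by
  simp [z, Z, designMatrix]

/-- The intercept lies in the span of the regressors. -/
lemma orthoDesign_dotProduct_sum (i : Fin E.n) :
    E.orthoDesign i ⬝ᵥ ∑ j, E.orthoDesign j = 1 := by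
  have h1 : ∑ j, E.orthoDesign j = E.orthoDesignᵀ *ᵥ fun _ => 1 := by
    rw [← sum_smul_row_eq_mulVec]; simp
  have h2 : (fun _ => 1 : Fin E.n → ℝ) = E.orthoDesign *ᵥ (E.orthoCoord *ᵥ Pi.single 0 1) := by
    rw [Matrix.mulVec_mulVec, ← Z_eq_mul]
    ext j
    have := E.z_zero j
    simpa [z] using this.symm
  have h3 : E.orthoDesign *ᵥ (∑ j, E.orthoDesign j) = fun _ => 1 := by
    rw [h1, h2, Matrix.mulVec_mulVec _ E.orthoDesignᵀ, orthoDesign_orthonormal, Matrix.one_mulVec]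
  exact congrFun h3 i

lemma sum_e_smul_z (t : Fin 2) : ∑ i, E.e t i • E.z i = 0 := by
  have hdet := (Matrix.isUnit_iff_isUnit_det _).1 E.gram_isUnit
  have h1 : ∑ i, E.e t i • E.z i = E.Zᵀ *ᵥ E.e t := sum_smul_row_eq_mulVec E.Z _
  have h2 : E.e t = E.y t - E.Z *ᵥ E.beta t := rfl
  rw [h1, h2, Matrix.mulVec_sub, Matrix.mulVec_mulVec, beta, Matrix.mulVec_mulVec,
    show E.Zᵀ * E.Z * (E.Zᵀ * E.Z)⁻¹ = 1 from Matrix.mul_nonsing_inv _ hdet, Matrix.one_mulVec,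
    sub_self]

lemma sum_e_smul_orthoDesign (t : Fin 2) : ∑ i, E.e t i • E.orthoDesign i = 0 := by
  have h := E.sum_e_smul_z t
  simp only [z_eq, ← Matrix.mulVec_smul] at h
  rw [← Matrix.mulVec_sum] at h
  have hB : IsUnit E.orthoCoordᵀ := by
    rw [Matrix.isUnit_iff_isUnit_det, Matrix.det_transpose, ← Matrix.isUnit_iff_isUnit_det]
    exact E.orthoCoord_isUnit
  exact Matrix.mulVec_injective_iff_isUnit.2 hB (by rw [h, Matrix.mulVec_zero])

lemma sum_e (t : Fin 2) : ∑ i, E.e t i = 0 := by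
  have h := congrFun (E.sum_e_smul_z t) 0
  simpa [z_zero] using h

lemma mu_eq (t : Fin 2) : E.mu t = (1 / (E.n : ℝ)) * ∑ i, E.z i ⬝ᵥ E.beta t := by
  have h : ∀ i, E.y t i = E.e t i + E.z i ⬝ᵥ E.beta t := fun i => by unfold e; ring
  rw [mu]
  simp only [h]
  rw [Finset.sum_add_distrib, sum_e, zero_add]

lemma sum_smul_vecMulVec_z (ω : Fin E.n → ℝ) :
    ∑ j, ω j • Matrix.vecMulVec (E.z j) (E.z j)
      = E.orthoCoordᵀ * weightedGram E.orthoDesign ω * E.orthoCoord := by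
  rw [weightedGram_eq_mul]
  change weightedGram E.Z ω = _
  rw [weightedGram_eq_mul, Z_eq_mul, Matrix.transpose_mul]
  simp only [Matrix.mul_assoc]

/-- The weighted least squares fit in the orthonormal design: in the coordinates of the latter, the
error of the coefficient solves the normal equations for the residuals. -/
lemma wls_normal_equations {ω : Fin E.n → ℝ} (hω : IsUnit (weightedGram E.orthoDesign ω))
    (v : Fin E.n → ℝ) (β : Fin (E.d + 1) → ℝ) :
    weightedGram E.orthoDesign ω *ᵥ (E.orthoCoord *ᵥ
        ((∑ j, ω j • Matrix.vecMulVec (E.z j) (E.z j))⁻¹ *ᵥ (∑ j, (ω j * v j) • E.z j) - β))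
      = ∑ j, (ω j * (v j - E.z j ⬝ᵥ β)) • E.orthoDesign j := by
  have hB : IsUnit E.orthoCoordᵀ := by
    rw [Matrix.isUnit_iff_isUnit_det, Matrix.det_transpose, ← Matrix.isUnit_iff_isUnit_det]
    exact E.orthoCoord_isUnit
  have hM : IsUnit (∑ j, ω j • Matrix.vecMulVec (E.z j) (E.z j)) := by
    rw [sum_smul_vecMulVec_z]
    exact (hB.mul hω).mul E.orthoCoord_isUnit
  refine Matrix.mulVec_injective_iff_isUnit.2 hB ?_
  set M := ∑ j, ω j • Matrix.vecMulVec (E.z j) (E.z j) with hMd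
  rw [Matrix.mulVec_mulVec, Matrix.mulVec_mulVec, ← sum_smul_vecMulVec_z, ← hMd,
    Matrix.mulVec_sub, Matrix.mulVec_mulVec,
    Matrix.mul_nonsing_inv _ ((Matrix.isUnit_iff_isUnit_det _).1 hM), Matrix.one_mulVec,
    Matrix.mulVec_sum]
  have h1 : M *ᵥ β = ∑ j, (ω j * (E.z j ⬝ᵥ β)) • E.z j := weightedGram_mulVec E.Z ω β
  rw [h1, ← Finset.sum_sub_distrib]
  refine Finset.sum_congr rfl fun j _ => ?_
  rw [Matrix.mulVec_smul, ← z_eq, ← sub_smul, mul_sub]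

lemma weightedGram_ind (t : Fin 2) (S : E.Assignment) :
    weightedGram E.orthoDesign (E.ind t S)
      = E.share t • (1 + weightedGram E.orthoDesign (E.weight t S)) := by
  rw [← E.orthoDesign_orthonormal, ← weightedGram_one]
  simp only [weightedGram]
  rw [← Finset.sum_add_distrib, Finset.smul_sum]
  refine Finset.sum_congr rfl fun i _ => ?_
  rw [← add_smul, smul_smul, ← ind_eq_share_mul]

lemma isUnit_weightedGram_ind {t : Fin 2} {S : E.Assignment}
    (hX : euOpNorm (weightedGram E.orthoDesign (E.weight t S)) ≤ 1 / 2) :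
    IsUnit (weightedGram E.orthoDesign (E.ind t S)) := by
  rw [weightedGram_ind, Matrix.isUnit_iff_isUnit_det, Matrix.det_smul]
  exact ((E.share_pos t).ne'.isUnit.pow _).mul
    ((Matrix.isUnit_iff_isUnit_det _).1 (isUnit_one_add hX))

/-- The error of `β̂_t` in the coordinates of the orthonormal design. -/
noncomputable def fitError (t : Fin 2) (S : E.Assignment) : Fin (E.d + 1) → ℝ :=
  E.orthoCoord *ᵥ (E.betaHat t S - E.beta t)

lemma ind_mul_Y (t : Fin 2) (S : E.Assignment) (i : Fin E.n) :
    E.ind t S i * E.Y S i = E.ind t S i * E.y t i := by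
  unfold ind T Y
  fin_cases t <;> by_cases h : i ∈ S <;> simp [h]

lemma sum_ind_mul_e_smul (t : Fin 2) (S : E.Assignment) :
    ∑ j, (E.ind t S j * E.e t j) • E.orthoDesign j
      = E.share t • ∑ j, (E.weight t S j * E.e t j) • E.orthoDesign j := by
  have h : ∀ j, (E.ind t S j * E.e t j) • E.orthoDesign j
      = E.share t • (E.e t j • E.orthoDesign j)
        + E.share t • ((E.weight t S j * E.e t j) • E.orthoDesign j) := by
    intro j
    rw [ind_eq_share_mul, smul_smul, smul_smul, ← add_smul]
    congr 1; ring
  rw [Finset.sum_congr rfl fun j _ => h j, Finset.sum_add_distrib, ← Finset.smul_sum,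
    ← Finset.smul_sum, sum_e_smul_orthoDesign, smul_zero, zero_add]

lemma fitError_eq {t : Fin 2} {S : E.Assignment}
    (hX : euOpNorm (weightedGram E.orthoDesign (E.weight t S)) ≤ 1 / 2) :
    E.fitError t S = ∑ i, (E.weight t S i * E.e t i) • E.orthoDesign i
      - weightedGram E.orthoDesign (E.weight t S) *ᵥ E.fitError t S := by
  have h := E.wls_normal_equations (E.isUnit_weightedGram_ind hX) (E.Y S) (E.beta t)
  have h2 : ∑ j, (E.ind t S j * (E.Y S j - E.z j ⬝ᵥ E.beta t)) • E.orthoDesign j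
      = ∑ j, (E.ind t S j * E.e t j) • E.orthoDesign j :=
    Finset.sum_congr rfl fun j _ => by rw [mul_sub, ind_mul_Y, ← mul_sub]; rfl
  rw [h2, sum_ind_mul_e_smul, weightedGram_ind, Matrix.smul_mulVec] at h
  have h3 := smul_right_injective _ (E.share_pos t).ne' h
  rw [Matrix.add_mulVec, Matrix.one_mulVec] at h3
  exact eq_sub_of_add_eq h3

lemma z_dotProduct_betaHat (t : Fin 2) (S : E.Assignment) (i : Fin E.n) :
    E.z i ⬝ᵥ E.betaHat t S = E.z i ⬝ᵥ E.beta t + E.orthoDesign i ⬝ᵥ E.fitError t S := by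
  rw [fitError, ← z_dotProduct, dotProduct_sub]; ring

lemma muAdj_sub_mu (t : Fin 2) (S : E.Assignment) :
    E.muAdj t S - E.mu t = (1 / (E.n : ℝ)) * ((∑ i, E.orthoDesign i) ⬝ᵥ E.fitError t S) := by
  rw [muAdj, mu_eq, ← mul_sub, ← Finset.sum_sub_distrib,
    show (∑ i, E.orthoDesign i) ⬝ᵥ E.fitError t S = ∑ i, E.orthoDesign i ⬝ᵥ E.fitError t S
      from sum_dotProduct _ _ _]
  congr 1
  exact Finset.sum_congr rfl fun i _ => by rw [z_dotProduct_betaHat]; ring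

/-- The interacted regression is solved by the separate regressions in the two arms. -/
lemma tauAdj_eq {S : E.Assignment}
    (hX : ∀ t, euOpNorm (weightedGram E.orthoDesign (E.weight t S)) ≤ 1 / 2) :
    E.tauAdj S = E.muAdj 1 S - E.muAdj 0 S := by
  set M : Fin 2 → Matrix (Fin (E.d + 1)) (Fin (E.d + 1)) ℝ := fun t =>
    ∑ j, E.ind t S j • Matrix.vecMulVec (E.z j) (E.z j) with hM
  have hBt : IsUnit E.orthoCoordᵀ := by
    rw [Matrix.isUnit_iff_isUnit_det, Matrix.det_transpose, ← Matrix.isUnit_iff_isUnit_det]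
    exact E.orthoCoord_isUnit
  have hMu : ∀ t, IsUnit (M t) := fun t => by
    rw [hM]; dsimp only; rw [sum_smul_vecMulVec_z]
    exact (hBt.mul (E.isUnit_weightedGram_ind (hX t))).mul E.orthoCoord_isUnit
  have hMv : ∀ t v, M t *ᵥ v = ∑ j, (E.ind t S j * (E.z j ⬝ᵥ v)) • E.z j := fun t v =>
    weightedGram_mulVec E.Z _ v
  have hMβ : ∀ t, M t *ᵥ E.betaHat t S = ∑ j, (E.ind t S j * E.Y S j) • E.z j := fun t => by
    rw [betaHat, Matrix.mulVec_mulVec,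
      Matrix.mul_nonsing_inv _ ((Matrix.isUnit_iff_isUnit_det _).1 (hMu t)), Matrix.one_mulVec]
  have hind : ∀ j, E.ind 0 S j + E.ind 1 S j = 1 := fun j => by simp [ind]
  have hT : ∀ j, E.T S j = E.ind 1 S j := fun j => by simp [ind]
  have hTT : ∀ j, E.T S j * E.T S j = E.T S j := fun j => by unfold T; split_ifs <;> simp
  set D := E.interacted S with hD
  have hDv : ∀ x : Fin (E.d + 1) ⊕ Fin (E.d + 1) → ℝ, ∀ j, (D *ᵥ x) j
      = E.z j ⬝ᵥ (x ∘ Sum.inl) + E.T S j * (E.z j ⬝ᵥ (x ∘ Sum.inr)) := by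
    intro x j
    simp [hD, interacted, Matrix.mulVec, dotProduct, Fintype.sum_sum_type, Finset.mul_sum,
      mul_assoc]
  have hDt : ∀ u : Fin E.n → ℝ, Dᵀ *ᵥ u
      = Sum.elim (∑ j, u j • E.z j) (∑ j, (E.T S j * u j) • E.z j) := by
    intro u
    ext a
    rcases a with a | a
    · simp [hD, interacted, Matrix.mulVec, dotProduct, mul_comm]
    · simp only [hD, interacted, Matrix.mulVec, dotProduct, Sum.elim_inr, Matrix.transpose_apply,
        Matrix.of_apply, Finset.sum_apply, Pi.smul_apply, smul_eq_mul]
      exact Finset.sum_congr rfl fun j _ => by ring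
  have hDD : ∀ x : Fin (E.d + 1) ⊕ Fin (E.d + 1) → ℝ, (Dᵀ * D) *ᵥ x
      = Sum.elim (M 0 *ᵥ (x ∘ Sum.inl) + M 1 *ᵥ (x ∘ Sum.inl + x ∘ Sum.inr))
        (M 1 *ᵥ (x ∘ Sum.inl + x ∘ Sum.inr)) := by
    intro x
    rw [← Matrix.mulVec_mulVec, hDt]
    congr 1
    · rw [hMv, hMv, ← Finset.sum_add_distrib]
      refine Finset.sum_congr rfl fun j _ => ?_
      rw [hDv, ← add_smul, dotProduct_add, hT]
      congr 1
      linear_combination (-(E.z j ⬝ᵥ (x ∘ Sum.inl))) * hind j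
    · rw [hMv]
      refine Finset.sum_congr rfl fun j _ => ?_
      rw [hDv, dotProduct_add, ← hT]
      congr 1
      linear_combination (E.z j ⬝ᵥ (x ∘ Sum.inr)) * hTT j
  have hDu : IsUnit (Dᵀ * D) := by
    rw [← Matrix.mulVec_injective_iff_isUnit]
    refine (injective_iff_map_eq_zero (Dᵀ * D).mulVecLin).2 fun x hx => ?_
    rw [Matrix.mulVecLin_apply, hDD] at hx
    have h2 : M 1 *ᵥ (x ∘ Sum.inl + x ∘ Sum.inr) = 0 := funext fun a => congrFun hx (Sum.inr a)
    have h1 : M 0 *ᵥ (x ∘ Sum.inl) = 0 := by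
      have : M 0 *ᵥ (x ∘ Sum.inl) + M 1 *ᵥ (x ∘ Sum.inl + x ∘ Sum.inr) = 0 :=
        funext fun a => congrFun hx (Sum.inl a)
      rwa [h2, add_zero] at this
    have h3 : x ∘ Sum.inl = 0 :=
      Matrix.mulVec_injective_iff_isUnit.2 (hMu 0) (by rw [h1, Matrix.mulVec_zero])
    have h4 : x ∘ Sum.inl + x ∘ Sum.inr = 0 :=
      Matrix.mulVec_injective_iff_isUnit.2 (hMu 1) (by rw [h2, Matrix.mulVec_zero])
    rw [h3, zero_add] at h4
    ext (a | a)
    · exact congrFun h3 a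
    · exact congrFun h4 a
  have hsol : (Dᵀ * D) *ᵥ Sum.elim (E.betaHat 0 S) (E.betaHat 1 S - E.betaHat 0 S)
      = Dᵀ *ᵥ E.Y S := by
    rw [hDD, hDt, Sum.elim_comp_inl, Sum.elim_comp_inr, add_sub_cancel, hMβ, hMβ]
    congr 1
    rw [← Finset.sum_add_distrib]
    exact Finset.sum_congr rfl fun j _ => by rw [← add_smul, ← add_mul, hind, one_mul]
  have hols : ols D (E.Y S) = Sum.elim (E.betaHat 0 S) (E.betaHat 1 S - E.betaHat 0 S) := by
    rw [ols, ← hsol, Matrix.mulVec_mulVec,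
      Matrix.nonsing_inv_mul _ ((Matrix.isUnit_iff_isUnit_det _).1 hDu), Matrix.one_mulVec]
  -- the covariates are centered, so the mean fitted value is the intercept
  have hmu : ∀ t, E.muAdj t S = E.betaHat t S 0 := by
    intro t
    have hn := E.cast_n_pos.ne'
    have h1 : ∀ i, E.z i ⬝ᵥ E.betaHat t S
        = E.betaHat t S 0 + ∑ a, E.x i a * E.betaHat t S a.succ := by
      intro i
      simp [dotProduct, z, Z, designMatrix, Fin.sum_univ_succ]
    rw [muAdj]
    simp only [h1]
    rw [Finset.sum_add_distrib, Finset.sum_comm]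
    simp only [← Finset.sum_mul, E.x_centered, zero_mul, Finset.sum_const_zero, add_zero]
    rw [Finset.sum_const, Finset.card_univ, Fintype.card_fin, nsmul_eq_mul]
    field_simp
  rw [tauAdj, hols, hmu, hmu]
  simp

end

end RCT

/-! ### Leave-one-out fits and the decomposition over the arms -/

namespace RCT

section

variable (E : RCT)

/-- The vector `(1 + X)⁻¹ u_i`, where `X` is the weighted Gram matrix of arm `t`. -/
noncomputable def resolventRow (t : Fin 2) (S : E.Assignment) (i : Fin E.n) :
    Fin (E.d + 1) → ℝ :=
  (1 + weightedGram E.orthoDesign (E.weight t S))⁻¹ *ᵥ E.orthoDesign i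

lemma resolventRow_eq {t : Fin 2} {S : E.Assignment}
    (hX : euOpNorm (weightedGram E.orthoDesign (E.weight t S)) ≤ 1 / 2) (i : Fin E.n) :
    E.resolventRow t S i = E.orthoDesign i
      - weightedGram E.orthoDesign (E.weight t S) *ᵥ E.resolventRow t S i := by
  have h : (1 + weightedGram E.orthoDesign (E.weight t S)) *ᵥ E.resolventRow t S i
      = E.orthoDesign i := by
    rw [resolventRow, Matrix.mulVec_mulVec, Matrix.mul_nonsing_inv _
      ((Matrix.isUnit_iff_isUnit_det _).1 (isUnit_one_add hX)), Matrix.one_mulVec]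
  rw [Matrix.add_mulVec, Matrix.one_mulVec] at h
  exact eq_sub_of_add_eq h

lemma abs_dotProduct_resolventRow_le {t : Fin 2} {S : E.Assignment}
    (hX : euOpNorm (weightedGram E.orthoDesign (E.weight t S)) ≤ 1 / 2) (i : Fin E.n) :
    |E.orthoDesign i ⬝ᵥ E.resolventRow t S i| ≤ 2 * (E.orthoDesign i ⬝ᵥ E.orthoDesign i) := by
  refine (abs_dotProduct_le _ _).trans ?_
  refine (mul_le_mul_of_nonneg_left (euNorm_le_of_eq_sub_mulVec hX (E.resolventRow_eq hX i))
    (euNorm_nonneg _)).trans (le_of_eq ?_)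
  rw [← euNorm_sq']; ring

/-- The Sherman-Morrison formula for the leave-one-out fit of unit `i`. -/
lemma z_dotProduct_betaLoo {t : Fin 2} {S : E.Assignment}
    (hX : euOpNorm (weightedGram E.orthoDesign (E.weight t S)) ≤ 1 / 2) (i : Fin E.n)
    (hden : 1 - (1 + E.weight t S i) * (E.orthoDesign i ⬝ᵥ E.resolventRow t S i) ≠ 0) :
    E.z i ⬝ᵥ E.betaLoo t S i = E.z i ⬝ᵥ E.beta t
      + (E.orthoDesign i ⬝ᵥ E.fitError t S
          - (1 + E.weight t S i) * (E.orthoDesign i ⬝ᵥ E.resolventRow t S i) * E.e t i)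
        / (1 - (1 + E.weight t S i) * (E.orthoDesign i ⬝ᵥ E.resolventRow t S i)) := by
  set U := E.orthoDesign with hU
  set X := weightedGram U (E.weight t S) with hXd
  set c := E.resolventRow t S i with hc
  set θ := 1 + E.weight t S i with hθ
  set h := U i ⬝ᵥ c with hh
  set b := E.fitError t S with hb
  set s := E.share t with hs
  have hs0 : s ≠ 0 := (E.share_pos t).ne'
  set ω : Fin E.n → ℝ := fun j => if j = i then 0 else E.ind t S j with hω
  have hωs : ∀ (f : Fin E.n → Fin (E.d + 1) → ℝ),
      ∑ j, ω j • f j = ∑ j, E.ind t S j • f j - E.ind t S i • f i := by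
    intro f
    rw [eq_sub_iff_add_eq, ← Finset.sum_erase_add _ _ (Finset.mem_univ i),
      ← Finset.sum_erase_add (a := i) _ (fun j => E.ind t S j • f j) (Finset.mem_univ i)]
    rw [show ω i = 0 by simp [hω], zero_smul, add_zero]
    congr 1
    exact Finset.sum_congr rfl fun j hj => by simp [hω, Finset.ne_of_mem_erase hj]
  -- `1 + X` is symmetric, so `c` represents `u_i` against it
  have hcv : ∀ v, c ⬝ᵥ ((1 + X) *ᵥ v) = U i ⬝ᵥ v := by
    intro v
    have h1 : (1 + X)ᵀ = 1 + X := by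
      rw [Matrix.transpose_add, Matrix.transpose_one, hXd, weightedGram_transpose]
    have h2 : (1 + X) *ᵥ c = U i := by
      have := E.resolventRow_eq hX i
      rw [Matrix.add_mulVec, Matrix.one_mulVec]
      exact eq_sub_iff_add_eq.1 this
    rw [Matrix.dotProduct_mulVec, ← Matrix.mulVec_transpose, h1, h2]
  have hGv : ∀ v, weightedGram U ω *ᵥ v = s • ((1 + X) *ᵥ v - (θ * (U i ⬝ᵥ v)) • U i) := by
    intro v
    have h1 : weightedGram U ω *ᵥ v = ∑ j, ω j • ((U j ⬝ᵥ v) • U j) := by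
      rw [weightedGram_mulVec]
      exact Finset.sum_congr rfl fun j _ => (smul_smul _ _ _).symm
    have h2 : ∑ j, E.ind t S j • ((U j ⬝ᵥ v) • U j) = weightedGram U (E.ind t S) *ᵥ v := by
      rw [weightedGram_mulVec]
      exact Finset.sum_congr rfl fun j _ => smul_smul _ _ _
    rw [h1, hωs, h2, weightedGram_ind, Matrix.smul_mulVec, smul_sub, smul_smul s, smul_smul,
      ind_eq_share_mul]
    congr 2
    rw [hθ, hs]; ring
  have hωu : IsUnit (weightedGram U ω) := by
    rw [← Matrix.mulVec_injective_iff_isUnit]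
    refine (injective_iff_map_eq_zero (weightedGram U ω).mulVecLin).2 fun v hv => ?_
    rw [Matrix.mulVecLin_apply, hGv, smul_eq_zero_iff_right hs0, sub_eq_zero] at hv
    have h1 := hcv v
    rw [hv, dotProduct_smul, smul_eq_mul, dotProduct_comm c] at h1
    have h2 : (U i ⬝ᵥ v) * (1 - θ * h) = 0 := by rw [hh]; linear_combination -h1
    have h3 : U i ⬝ᵥ v = 0 := (mul_eq_zero.1 h2).resolve_right hden
    rw [h3, mul_zero, zero_smul] at hv
    exact Matrix.mulVec_injective_iff_isUnit.2 (isUnit_one_add hX) (by rw [hv, Matrix.mulVec_zero])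
  have hloo : E.betaLoo t S i = (∑ j, ω j • Matrix.vecMulVec (E.z j) (E.z j))⁻¹ *ᵥ
      (∑ j, (ω j * E.Y S j) • E.z j) := by
    rw [betaLoo, ← Finset.sum_erase_add (a := i) _ (fun j => ω j • Matrix.vecMulVec (E.z j) (E.z j))
      (Finset.mem_univ i), ← Finset.sum_erase_add (a := i) _ (fun j => (ω j * E.Y S j) • E.z j)
      (Finset.mem_univ i)]
    rw [show ω i = 0 by simp [hω], zero_smul, add_zero, zero_mul, zero_smul, add_zero]
    congr 1
    · congr 1
      exact Finset.sum_congr rfl fun j hj => by simp [hω, Finset.ne_of_mem_erase hj]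
    · exact Finset.sum_congr rfl fun j hj => by simp [hω, Finset.ne_of_mem_erase hj]
  set b' := E.orthoCoord *ᵥ (E.betaLoo t S i - E.beta t) with hb'
  have hne := E.wls_normal_equations hωu (E.Y S) (E.beta t)
  rw [← hloo, ← hb', ← hU, hGv] at hne
  have hrhs : ∑ j, (ω j * (E.Y S j - E.z j ⬝ᵥ E.beta t)) • U j
      = s • ((1 + X) *ᵥ b - (θ * E.e t i) • U i) := by
    have h1 : ∀ j, (ω j * (E.Y S j - E.z j ⬝ᵥ E.beta t)) • U j = ω j • (E.e t j • U j) := by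
      intro j
      rw [smul_smul]
      by_cases hj : j = i
      · simp [hω, hj]
      · rw [hω]; dsimp only
        rw [if_neg hj, mul_sub, ind_mul_Y, ← mul_sub]; rfl
    have h2 : ∑ j, E.ind t S j • (E.e t j • U j) = s • ((1 + X) *ᵥ b) := by
      have h3 := E.sum_ind_mul_e_smul t S
      simp only [← smul_smul] at h3 ⊢
      rw [hU, h3]
      congr 1
      rw [Matrix.add_mulVec, Matrix.one_mulVec]
      simp only [smul_smul]
      exact (eq_sub_iff_add_eq.1 (E.fitError_eq hX)).symm
    rw [Finset.sum_congr rfl fun j _ => h1 j, hωs, h2, smul_sub, smul_smul, smul_smul,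
      ind_eq_share_mul]
    congr 2
    rw [hθ, hs]; ring
  rw [hrhs] at hne
  have hne' := smul_right_injective _ hs0 hne
  have hfin := congrArg (fun v => c ⬝ᵥ v) hne'
  simp only [dotProduct_sub, dotProduct_smul, hcv, smul_eq_mul, dotProduct_comm c (U i)] at hfin
  have hz : E.z i ⬝ᵥ E.betaLoo t S i - E.z i ⬝ᵥ E.beta t = U i ⬝ᵥ b' := by
    rw [hb', ← z_dotProduct, dotProduct_sub]
  rw [← sub_eq_iff_eq_add', hz, eq_div_iff hden]
  linear_combination hfin

lemma muCf_sub_mu {t : Fin 2} {S : E.Assignment}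
    (hX : euOpNorm (weightedGram E.orthoDesign (E.weight t S)) ≤ 1 / 2)
    (hden : ∀ i, 1 - (1 + E.weight t S i) * (E.orthoDesign i ⬝ᵥ E.resolventRow t S i) ≠ 0) :
    E.muCf t S - E.mu t = (1 / (E.n : ℝ)) * (∑ i, E.weight t S i * E.e t i
      - ∑ i, E.weight t S i * ((E.orthoDesign i ⬝ᵥ E.fitError t S
          - (1 + E.weight t S i) * (E.orthoDesign i ⬝ᵥ E.resolventRow t S i) * E.e t i)
        / (1 - (1 + E.weight t S i) * (E.orthoDesign i ⬝ᵥ E.resolventRow t S i)))) := by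
  have h : ∀ i, E.ind t S i / E.share t * E.Y S i
      - (E.ind t S i / E.share t - 1) * (E.z i ⬝ᵥ E.betaLoo t S i)
      = E.z i ⬝ᵥ E.beta t + E.e t i + (E.weight t S i * E.e t i
      - E.weight t S i * ((E.orthoDesign i ⬝ᵥ E.fitError t S
          - (1 + E.weight t S i) * (E.orthoDesign i ⬝ᵥ E.resolventRow t S i) * E.e t i)
        / (1 - (1 + E.weight t S i) * (E.orthoDesign i ⬝ᵥ E.resolventRow t S i)))) := by
    intro i
    have h1 : E.ind t S i / E.share t * E.Y S i
        = (1 + E.weight t S i) * (E.e t i + E.z i ⬝ᵥ E.beta t) := by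
      rw [div_mul_eq_mul_div, ind_mul_Y, one_add_weight, e]; ring
    rw [h1, z_dotProduct_betaLoo E hX i (hden i)]
    rw [show E.ind t S i / E.share t - 1 = E.weight t S i from rfl]
    ring
  rw [muCf, Finset.sum_congr rfl fun i _ => h i, mu_eq, Finset.sum_add_distrib,
    Finset.sum_add_distrib, sum_e, Finset.sum_sub_distrib]
  ring

/-- The contribution of arm `t` to the linear and quadratic terms of the expansion. -/
noncomputable def armStochasticPart (t : Fin 2) (S : E.Assignment) : ℝ :=
  (1 / (E.n : ℝ)) * (∑ i, E.weight t S i * E.e t i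
    - (∑ i, ∑ j, E.weight t S i * E.weight t S j * (E.orthoDesign i ⬝ᵥ E.orthoDesign j) * E.e t j
      - ∑ i, E.weight t S i ^ 2 * (E.orthoDesign i ⬝ᵥ E.orthoDesign i) * E.e t i))

/-- The contribution of arm `t` to `B^adj`. -/
noncomputable def armBias (t : Fin 2) (S : E.Assignment) : ℝ :=
  -((1 / (E.n : ℝ)) * ∑ i, E.weight t S i ^ 2 * (E.orthoDesign i ⬝ᵥ E.orthoDesign i) * E.e t i)

lemma weight_one (S : E.Assignment) (i : Fin E.n) : E.weight 1 S i = E.T S i / E.π - 1 := by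
  simp [weight, ind, share]

lemma weight_zero (S : E.Assignment) (i : Fin E.n) :
    E.weight 0 S i = (1 - E.T S i) / (1 - E.π) - 1 := by
  simp [weight, ind, share]

lemma biasAdj_eq (S : E.Assignment) : E.biasAdj S = E.armBias 1 S - E.armBias 0 S := by
  simp only [biasAdj, armBias, weight_one, weight_zero, P_apply]
  ring

lemma L_eq (S : E.Assignment) (i : Fin E.n) :
    E.L S i = E.weight 1 S i * E.e 1 i - E.weight 0 S i * E.e 0 i := by
  have h1 : E.π ≠ 0 := (E.share_pos 1).ne'
  have h0 : 1 - E.π ≠ 0 := (E.share_pos 0).ne'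
  rw [L, weight_one, weight_zero]
  field_simp
  ring

lemma stochasticPart_eq (S : E.Assignment) :
    E.stochasticPart S = E.armStochasticPart 1 S - E.armStochasticPart 0 S := by
  have hn := E.cast_n_pos.ne'
  set f : Fin 2 → Fin E.n → Fin E.n → ℝ := fun t i j =>
    E.weight t S i * E.weight t S j * (E.orthoDesign i ⬝ᵥ E.orthoDesign j) * E.e t j with hf
  have hsum : ∀ t, ∑ i, ∑ j ∈ Finset.Ioi i, (f t j i + f t i j)
      = ∑ i, ∑ j, f t i j
        - ∑ i, E.weight t S i ^ 2 * (E.orthoDesign i ⬝ᵥ E.orthoDesign i) * E.e t i := by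
    intro t
    rw [Finset.sum_sum_Ioi_add_eq_sum_sum_off_diag, Finset.sum_comm (f := fun i j => f t i j),
      ← Finset.sum_sub_distrib]
    refine Finset.sum_congr rfl fun i _ => ?_
    rw [eq_sub_iff_add_eq, add_comm, show E.weight t S i ^ 2
      * (E.orthoDesign i ⬝ᵥ E.orthoDesign i) * E.e t i = f t i i by rw [hf]; ring]
    rw [← Finset.sum_compl_add_sum {i}, Finset.sum_singleton, add_comm]
  have hW : ∀ i j, E.W S i j = E.n * ((f 0 j i + f 0 i j) - (f 1 j i + f 1 i j)) := by
    intro i j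
    rw [W, z_Sig_inv_z, ← weight_one, ← weight_one, ← weight_zero, ← weight_zero, hf]
    dsimp only
    rw [dotProduct_comm (E.orthoDesign j) (E.orthoDesign i)]
    ring
  have hWs : ∑ i, ∑ j ∈ Finset.Ioi i, E.W S i j
      = E.n * (∑ i, ∑ j ∈ Finset.Ioi i, (f 0 j i + f 0 i j)
        - ∑ i, ∑ j ∈ Finset.Ioi i, (f 1 j i + f 1 i j)) := by
    simp only [hW, ← Finset.mul_sum, Finset.sum_sub_distrib]
  rw [stochasticPart, hWs, hsum, hsum, Finset.sum_congr rfl fun i _ => E.L_eq S i,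
    Finset.sum_sub_distrib, armStochasticPart, armStochasticPart]
  field_simp
  ring

/-- The contribution of arm `t` to `B^bc`. -/
noncomputable def armBiasBc (t : Fin 2) (S : E.Assignment) : ℝ :=
  (1 / (E.n : ℝ)) * (∑ i, E.weight t S i * ((E.orthoDesign i ⬝ᵥ E.orthoDesign i) * E.e t i)
    - E.odds t * ∑ i, (1 + E.weight t S i) * ((E.orthoDesign i ⬝ᵥ E.orthoDesign i)
      * (E.orthoDesign i ⬝ᵥ E.fitError t S)))

lemma deltaHat_eq (t : Fin 2) (S : E.Assignment) :
    E.odds t * E.deltaHat t S = E.armBiasBc t S - E.armBias t S := by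
  have hn := E.cast_n_pos.ne'
  have hN := (E.armSize_pos t).ne'
  have h : ∀ i, E.ind t S i * E.P i i * E.eHat S i
      = E.share t * ((1 + E.weight t S i) * ((E.orthoDesign i ⬝ᵥ E.orthoDesign i) * E.e t i)
        - (1 + E.weight t S i) * ((E.orthoDesign i ⬝ᵥ E.orthoDesign i)
          * (E.orthoDesign i ⬝ᵥ E.fitError t S))) := by
    intro i
    have h1 : E.ind t S i * E.eHat S i
        = E.ind t S i * (E.e t i - E.orthoDesign i ⬝ᵥ E.fitError t S) := by
      have h2 : E.ind t S i * E.eHat S i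
          = E.ind t S i * (E.Y S i - E.z i ⬝ᵥ E.betaHat t S) := by
        unfold ind T eHat
        fin_cases t <;> by_cases h : i ∈ S <;> simp [h]
      rw [h2, mul_sub, ind_mul_Y, ← mul_sub, z_dotProduct_betaHat, e]
      ring
    calc E.ind t S i * E.P i i * E.eHat S i = E.P i i * (E.ind t S i * E.eHat S i) := by ring
      _ = _ := by rw [h1, P_apply, ind_eq_share_mul]; ring
  rw [deltaHat, Finset.sum_congr rfl fun i _ => h i, ← Finset.mul_sum, Finset.sum_sub_distrib,
    armBiasBc, armBias]
  have hsq : ∑ i, E.weight t S i ^ 2 * (E.orthoDesign i ⬝ᵥ E.orthoDesign i) * E.e t i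
      = E.odds t * ∑ i, (1 + E.weight t S i) * ((E.orthoDesign i ⬝ᵥ E.orthoDesign i) * E.e t i)
        - ∑ i, E.weight t S i * ((E.orthoDesign i ⬝ᵥ E.orthoDesign i) * E.e t i) := by
    rw [Finset.mul_sum, ← Finset.sum_sub_distrib]
    exact Finset.sum_congr rfl fun i _ => by rw [weight_sq]; ring
  have hshare : 1 / E.armSize t * E.share t = 1 / E.n := by rw [share_eq]; field_simp
  rw [hsq, ← mul_assoc (1 / E.armSize t), hshare]
  ring

/-- The correction in `B^bc` is the contribution of the estimation error of the coefficients to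
the averages of `P_ii ê_i`. -/
lemma bc_correction_eq {t : Fin 2} {S : E.Assignment}
    (hX : euOpNorm (weightedGram E.orthoDesign (E.weight t S)) ≤ 1 / 2) :
    ((1 / E.armSize t) • ∑ i, (E.ind t S i * E.P i i) • E.z i) ⬝ᵥ
        ((1 / E.armSize t) • ∑ i, E.ind t S i • Matrix.vecMulVec (E.z i) (E.z i))⁻¹ *ᵥ
          ((1 / E.armSize t) • ∑ i, (E.ind t S i * E.e t i) • E.z i)
      = (1 / (E.n : ℝ)) * ∑ i, (1 + E.weight t S i) * ((E.orthoDesign i ⬝ᵥ E.orthoDesign i)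
          * (E.orthoDesign i ⬝ᵥ E.fitError t S)) := by
  have hn := E.cast_n_pos.ne'
  have hN := (E.armSize_pos t).ne'
  have hu := E.isUnit_weightedGram_ind hX
  set M := ∑ i, E.ind t S i • Matrix.vecMulVec (E.z i) (E.z i) with hM
  have hMu : IsUnit M := by
    have hB : IsUnit E.orthoCoordᵀ := by
      rw [Matrix.isUnit_iff_isUnit_det, Matrix.det_transpose, ← Matrix.isUnit_iff_isUnit_det]
      exact E.orthoCoord_isUnit
    rw [hM, sum_smul_vecMulVec_z]
    exact (hB.mul hu).mul E.orthoCoord_isUnit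
  have hMdet := (Matrix.isUnit_iff_isUnit_det M).1 hMu
  have hinv : ((1 / E.armSize t) • M)⁻¹ = E.armSize t • M⁻¹ := by
    refine Matrix.inv_eq_left_inv ?_
    rw [Matrix.smul_mul, Matrix.mul_smul, smul_smul, mul_one_div_cancel hN, one_smul,
      Matrix.nonsing_inv_mul _ hMdet]
  have hcoef : M⁻¹ *ᵥ ∑ i, (E.ind t S i * E.e t i) • E.z i = E.betaHat t S - E.beta t := by
    have h1 : ∑ i, (E.ind t S i * E.e t i) • E.z i
        = ∑ i, (E.ind t S i * E.Y S i) • E.z i - M *ᵥ E.beta t := by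
      have h2 : M *ᵥ E.beta t = ∑ j, (E.ind t S j * (E.z j ⬝ᵥ E.beta t)) • E.z j :=
        weightedGram_mulVec E.Z _ _
      rw [h2, ← Finset.sum_sub_distrib]
      exact Finset.sum_congr rfl fun i _ => by rw [ind_mul_Y, ← sub_smul, e]; ring_nf
    rw [h1, Matrix.mulVec_sub, Matrix.mulVec_mulVec, Matrix.nonsing_inv_mul _ hMdet,
      Matrix.one_mulVec]
    rfl
  rw [hinv, Matrix.smul_mulVec, Matrix.mulVec_smul, smul_smul, mul_one_div_cancel hN, one_smul,
    hcoef, smul_dotProduct, smul_eq_mul, sum_dotProduct]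
  have h3 : ∀ i, ((E.ind t S i * E.P i i) • E.z i) ⬝ᵥ (E.betaHat t S - E.beta t)
      = E.share t * ((1 + E.weight t S i) * ((E.orthoDesign i ⬝ᵥ E.orthoDesign i)
          * (E.orthoDesign i ⬝ᵥ E.fitError t S))) := by
    intro i
    rw [smul_dotProduct, dotProduct_sub, z_dotProduct_betaHat, P_apply, ind_eq_share_mul,
      smul_eq_mul]
    ring
  rw [Finset.sum_congr rfl fun i _ => h3 i, ← Finset.mul_sum, ← mul_assoc, share_eq]
  congr 1
  field_simp

lemma odds_one : E.odds 1 = (E.n₀ : ℝ) / E.n₁ := by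
  have h1 := E.cast_n₁_pos.ne'
  have hn := E.cast_n_pos.ne'
  rw [odds, share_eq, cast_n₀]
  simp only [armSize, if_true]
  field_simp

lemma odds_zero : E.odds 0 = (E.n₁ : ℝ) / E.n₀ := by
  have h0 := E.cast_n₀_pos.ne'
  have hn := E.cast_n_pos.ne'
  have h := E.cast_n₀
  rw [odds, share_eq]
  simp only [armSize, Fin.zero_eq_one_iff, OfNat.ofNat_ne_one, if_false]
  field_simp
  linarith

lemma biasBc_eq {S : E.Assignment}
    (hX : ∀ t, euOpNorm (weightedGram E.orthoDesign (E.weight t S)) ≤ 1 / 2) :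
    E.biasBc S = E.armBiasBc 1 S - E.armBiasBc 0 S := by
  have h1 := E.bc_correction_eq (hX 1)
  have h0 := E.bc_correction_eq (hX 0)
  have hi1 : E.ind 1 S = E.T S := by ext i; simp [ind]
  have hi0 : E.ind 0 S = fun i => 1 - E.T S i := by ext i; simp [ind]
  have ha1 : E.armSize 1 = E.n₁ := by simp [armSize]
  have ha0 : E.armSize 0 = E.n₀ := by simp [armSize]
  rw [hi1, ha1] at h1
  rw [hi0, ha0] at h0
  have hs1 : ∀ i, ((E.T S i / E.π - 1) ^ 2 - (E.n₀ : ℝ) / E.n₁ * (E.T S i / E.π))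
      * E.P i i * E.e 1 i
      = -(E.weight 1 S i * ((E.orthoDesign i ⬝ᵥ E.orthoDesign i) * E.e 1 i)) := by
    intro i
    have h2 : E.T S i / E.π = 1 + E.weight 1 S i := by rw [weight_one]; ring
    rw [← weight_one, weight_sq, h2, ← odds_one, P_apply]; ring
  have hs0 : ∀ i, (((1 - E.T S i) / (1 - E.π) - 1) ^ 2
      - (E.n₁ : ℝ) / E.n₀ * ((1 - E.T S i) / (1 - E.π))) * E.P i i * E.e 0 i
      = -(E.weight 0 S i * ((E.orthoDesign i ⬝ᵥ E.orthoDesign i) * E.e 0 i)) := by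
    intro i
    have h2 : (1 - E.T S i) / (1 - E.π) = 1 + E.weight 0 S i := by rw [weight_zero]; ring
    rw [← weight_zero, weight_sq, h2, ← odds_zero, P_apply]; ring
  rw [biasBc, h1, h0, Finset.sum_congr rfl fun i _ => hs1 i, Finset.sum_congr rfl fun i _ => hs0 i,
    Finset.sum_neg_distrib, Finset.sum_neg_distrib, ← odds_one, ← odds_zero, armBiasBc, armBiasBc]
  ring

/-- The remainder of arm `t` in the expansion of the regression adjustment estimator. -/
noncomputable def adjRemainder (t : Fin 2) (S : E.Assignment) : ℝ :=
  E.muAdj t S - E.mu t - (E.armBias t S + E.armStochasticPart t S)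

/-- The remainder of arm `t` in the expansion of the cross-fitted estimator. -/
noncomputable def cfRemainder (t : Fin 2) (S : E.Assignment) : ℝ :=
  E.muCf t S - E.mu t - E.armStochasticPart t S

lemma tauAdj_remainder_eq {S : E.Assignment}
    (hX : ∀ t, euOpNorm (weightedGram E.orthoDesign (E.weight t S)) ≤ 1 / 2) :
    E.tauAdj S - E.tau - (E.biasAdj S + E.stochasticPart S)
      = E.adjRemainder 1 S - E.adjRemainder 0 S := by
  rw [E.tauAdj_eq hX, tau, biasAdj_eq, stochasticPart_eq, adjRemainder, adjRemainder]
  ring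

lemma tauBc_remainder_eq {S : E.Assignment}
    (hX : ∀ t, euOpNorm (weightedGram E.orthoDesign (E.weight t S)) ≤ 1 / 2) :
    E.tauBc S - E.tau - (E.biasBc S + E.stochasticPart S)
      = E.adjRemainder 1 S - E.adjRemainder 0 S := by
  rw [tauBc, ← odds_one, ← odds_zero, deltaHat_eq, deltaHat_eq, tau, E.biasBc_eq hX,
    stochasticPart_eq, adjRemainder, adjRemainder]
  ring

lemma tauCf_remainder_eq (S : E.Assignment) :
    E.tauCf S - E.tau - (E.biasCf S + E.stochasticPart S)
      = E.cfRemainder 1 S - E.cfRemainder 0 S := by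
  rw [tauCf, tau, biasCf, stochasticPart_eq, cfRemainder, cfRemainder]
  ring

end

end RCT

/-! ### Second moments of the chaos terms -/

namespace IsSamplingWeight

variable {n n₁ k : ℕ} {w : Finset (Fin n) → Fin n → ℝ} {K κ : ℝ} {U : Matrix (Fin n) (Fin k) ℝ}

lemma chaosConst_nonneg (hK : 1 ≤ K) (r : ℕ) : 0 ≤ chaosConst K r := by
  unfold chaosConst; positivity

lemma srsMean_euNorm_linear_sq_le (hw : IsSamplingWeight n n₁ w K) (hK : 1 ≤ K) (hn : 12 ≤ n)
    (c : Fin n → ℝ) :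
    srsMean n n₁ (fun S => euNorm (∑ i, (w S i * c i) • U i) ^ 2)
      ≤ chaosConst K 1 * ∑ i, c i ^ 2 * (U i ⬝ᵥ U i) := by
  have e : ∀ S, euNorm (∑ i, (w S i * c i) • U i) ^ 2
      = ∑ a, (∑ i, (c i * U i a) * w S i) ^ 2 := by
    intro S
    rw [euNorm_sq]
    refine Finset.sum_congr rfl fun a _ => ?_
    congr 1
    simp only [Finset.sum_apply, Pi.smul_apply, smul_eq_mul]
    exact Finset.sum_congr rfl fun i _ => by ring
  simp only [e]
  rw [srsMean_sum]
  refine (Finset.sum_le_sum fun a _ =>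
    hw.srsMean_linear_sq_le hK hn (fun i => c i * U i a)).trans (le_of_eq ?_)
  rw [← Finset.mul_sum, Finset.sum_comm]
  congr 1
  refine Finset.sum_congr rfl fun i _ => ?_
  rw [dotProduct, Finset.mul_sum]
  exact Finset.sum_congr rfl fun a _ => by ring

lemma sum_cross_leverage_sq_mul_le (hU : Uᵀ * U = 1) (hκ : ∀ i, U i ⬝ᵥ U i ≤ κ) (e : Fin n → ℝ) :
    ∑ i, ∑ j, (U i ⬝ᵥ U j) ^ 2 * e j ^ 2 ≤ κ * ∑ j, e j ^ 2 := by
  rw [Finset.sum_comm, Finset.mul_sum]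
  refine Finset.sum_le_sum fun j _ => ?_
  rw [← Finset.sum_mul]
  refine mul_le_mul_of_nonneg_right ?_ (sq_nonneg _)
  simp only [dotProduct_comm _ (U j)]
  rw [sum_sq_cross_leverage hU]
  exact hκ j

/-- The part of `X g` in which the weights belong to distinct units. -/
def offDiagonalFit (U : Matrix (Fin n) (Fin k) ℝ) (w e : Fin n → ℝ) : Fin k → ℝ := fun a =>
  ∑ i, ∑ j, (if i = j then 0 else U i a * (U i ⬝ᵥ U j) * e j) * (w i * w j)

lemma srsMean_euNorm_offDiagonalFit_sq_le (hw : IsSamplingWeight n n₁ w K) (hK : 1 ≤ K)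
    (hn : 12 ≤ n) (hU : Uᵀ * U = 1) (hκ0 : 0 ≤ κ) (hκ : ∀ i, U i ⬝ᵥ U i ≤ κ) (e : Fin n → ℝ) :
    srsMean n n₁ (fun S => euNorm (offDiagonalFit U (w S) e) ^ 2)
      ≤ chaosConst K 2 * (κ ^ 2 * ∑ j, e j ^ 2) := by
  simp only [euNorm_sq]
  rw [srsMean_sum]
  refine (Finset.sum_le_sum fun a _ => hw.srsMean_quadratic_sq_le hK hn
    (fun i j => if i = j then 0 else U i a * (U i ⬝ᵥ U j) * e j) (by simp)).trans ?_
  rw [← Finset.mul_sum]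
  refine mul_le_mul_of_nonneg_left ?_ (chaosConst_nonneg hK 2)
  calc ∑ a, ∑ i, ∑ j, (if i = j then 0 else U i a * (U i ⬝ᵥ U j) * e j) ^ 2
      ≤ ∑ a, ∑ i, ∑ j, U i a ^ 2 * ((U i ⬝ᵥ U j) ^ 2 * e j ^ 2) := by
        refine Finset.sum_le_sum fun a _ => Finset.sum_le_sum fun i _ =>
          Finset.sum_le_sum fun j _ => ?_
        split_ifs
        · simp only [ne_eq, OfNat.ofNat_ne_zero, not_false_eq_true, zero_pow]; positivity
        · exact le_of_eq (by ring)
    _ = ∑ i, (U i ⬝ᵥ U i) * ∑ j, (U i ⬝ᵥ U j) ^ 2 * e j ^ 2 := by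
        rw [Finset.sum_comm]
        refine Finset.sum_congr rfl fun i _ => ?_
        simp only [← Finset.mul_sum]
        rw [← Finset.sum_mul]
        congr 1
        exact Finset.sum_congr rfl fun a _ => sq _
    _ ≤ ∑ i, κ * ∑ j, (U i ⬝ᵥ U j) ^ 2 * e j ^ 2 :=
        Finset.sum_le_sum fun i _ => mul_le_mul_of_nonneg_right (hκ i)
          (Finset.sum_nonneg fun j _ => by positivity)
    _ ≤ κ * (κ * ∑ j, e j ^ 2) := by
        rw [← Finset.mul_sum]
        exact mul_le_mul_of_nonneg_left (sum_cross_leverage_sq_mul_le hU hκ e) hκ0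
    _ = _ := by ring

lemma euNorm_mulVec_score_le (hU : Uᵀ * U = 1) (hκ0 : 0 ≤ κ) (hκ : ∀ i, U i ⬝ᵥ U i ≤ κ)
    {v : Fin n → ℝ} (hv : ∀ i, |v i| ≤ K) (hK : 1 ≤ K) (e : Fin n → ℝ) :
    euNorm (weightedGram U v *ᵥ ∑ i, (v i * e i) • U i)
      ≤ euNorm (offDiagonalFit U v e) + K ^ 2 * (κ * euNorm e) := by
  have h : weightedGram U v *ᵥ ∑ i, (v i * e i) • U i
      = offDiagonalFit U v e + ∑ i, (v i ^ 2 * ((U i ⬝ᵥ U i) * e i)) • U i := by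
    ext a
    rw [weightedGram_mulVec]
    simp only [offDiagonalFit, Finset.sum_apply, Pi.add_apply, Pi.smul_apply, smul_eq_mul]
    rw [← Finset.sum_add_distrib]
    refine Finset.sum_congr rfl fun i _ => ?_
    have h1 : U i ⬝ᵥ ∑ j, (v j * e j) • U j = ∑ j, v j * e j * (U i ⬝ᵥ U j) := by
      rw [dotProduct_sum]
      exact Finset.sum_congr rfl fun j _ => by rw [dotProduct_smul, smul_eq_mul]
    have h2 : v i ^ 2 * ((U i ⬝ᵥ U i) * e i) * U i a
        = ∑ j, if i = j then v i * v j * (U i ⬝ᵥ U j) * e j * U i a else 0 := by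
      rw [Finset.sum_ite_eq, if_pos (Finset.mem_univ i)]; ring
    rw [h1, h2, Finset.mul_sum, Finset.sum_mul, ← Finset.sum_add_distrib]
    refine Finset.sum_congr rfl fun j _ => ?_
    split_ifs <;> ring
  rw [h]
  refine (euNorm_add_le _ _).trans (add_le_add le_rfl ?_)
  refine (euNorm_sum_smul_row_le hU _).trans ?_
  refine euNorm_le_of_sq_le (mul_nonneg (by positivity) (mul_nonneg hκ0 (euNorm_nonneg _))) ?_
  rw [mul_pow, mul_pow, euNorm_sq, Finset.mul_sum, Finset.mul_sum]
  refine Finset.sum_le_sum fun i _ => ?_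
  have h3 : v i ^ 2 ≤ K ^ 2 := by
    rw [← sq_abs]; exact pow_le_pow_left₀ (abs_nonneg _) (hv i) 2
  have h4 := leverage_nonneg U i
  have h5 := hκ i
  rw [mul_pow, mul_pow]
  gcongr

lemma srsMean_cfLin_sq_le (hw : IsSamplingWeight n n₁ w K) (hK : 1 ≤ K)
    (hn : 12 ≤ n) (hU : Uᵀ * U = 1) (hκ : ∀ i, U i ⬝ᵥ U i ≤ κ) {a : ℝ}
    (ha0 : 0 ≤ a) (haK : a ≤ K) (e : Fin n → ℝ) :
    srsMean n n₁ (fun S => (∑ i, cfLin U e a i * w S i) ^ 2)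
      ≤ chaosConst K 1 * (2 * (1 + K ^ 2)) * (κ ^ 2 * ∑ j, e j ^ 2) := by
  refine (hw.srsMean_linear_sq_le hK hn _).trans ?_
  rw [mul_assoc]
  refine mul_le_mul_of_nonneg_left ?_ (chaosConst_nonneg hK 1)
  have h1 : ∑ i, ((U i ⬝ᵥ U i) * e i) ^ 2 ≤ κ ^ 2 * ∑ j, e j ^ 2 := by
    rw [Finset.mul_sum]
    refine Finset.sum_le_sum fun i _ => ?_
    have := leverage_nonneg U i
    have := hκ i
    rw [mul_pow]; gcongr
  have h2 : ∑ i, (∑ j, (U i ⬝ᵥ U j) * ((U j ⬝ᵥ U j) * e j)) ^ 2 ≤ κ ^ 2 * ∑ j, e j ^ 2 := by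
    refine le_trans (le_trans (le_of_eq ?_) (pow_le_pow_left₀ (euNorm_nonneg _)
      (euNorm_sum_smul_row_le hU fun j => (U j ⬝ᵥ U j) * e j) 2)) ((euNorm_sq _).le.trans h1)
    rw [← euNorm_dotProduct_row hU, euNorm_sq]
    refine Finset.sum_congr rfl fun i _ => ?_
    rw [dotProduct_sum]
    congr 1
    exact Finset.sum_congr rfl fun j _ => by rw [dotProduct_smul, smul_eq_mul, mul_comm]
  have ha2 : a ^ 2 ≤ K ^ 2 := pow_le_pow_left₀ ha0 haK 2
  calc ∑ i, cfLin U e a i ^ 2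
      ≤ ∑ i, (2 * ((U i ⬝ᵥ U i) * e i) ^ 2
        + 2 * a ^ 2 * (∑ j, (U i ⬝ᵥ U j) * ((U j ⬝ᵥ U j) * e j)) ^ 2) := by
        refine Finset.sum_le_sum fun i _ => ?_
        rw [cfLin]
        nlinarith [sq_nonneg ((U i ⬝ᵥ U i) * e i
          - a * ∑ j, (U i ⬝ᵥ U j) * ((U j ⬝ᵥ U j) * e j))]
    _ = 2 * ∑ i, ((U i ⬝ᵥ U i) * e i) ^ 2
        + 2 * a ^ 2 * ∑ i, (∑ j, (U i ⬝ᵥ U j) * ((U j ⬝ᵥ U j) * e j)) ^ 2 := by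
        rw [Finset.sum_add_distrib, ← Finset.mul_sum, ← Finset.mul_sum]
    _ ≤ 2 * (κ ^ 2 * ∑ j, e j ^ 2) + 2 * K ^ 2 * (κ ^ 2 * ∑ j, e j ^ 2) := by gcongr
    _ = _ := by ring

lemma srsMean_cfQuad_sq_le (hw : IsSamplingWeight n n₁ w K) (hK : 1 ≤ K)
    (hn : 12 ≤ n) (hU : Uᵀ * U = 1) (hκ0 : 0 ≤ κ) (hκ : ∀ i, U i ⬝ᵥ U i ≤ κ) {a : ℝ}
    (ha0 : 0 ≤ a) (haK : a ≤ K) (e : Fin n → ℝ) :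
    srsMean n n₁ (fun S => (∑ i, ∑ j, (if i = j then 0 else cfQuad U e a i j)
        * (w S i * w S j)) ^ 2)
      ≤ chaosConst K 2 * (3 * (2 + (1 + K) ^ 2)) * (κ ^ 2 * ∑ j, e j ^ 2) := by
  refine (hw.srsMean_quadratic_sq_le hK hn _ (by simp)).trans ?_
  rw [mul_assoc]
  refine mul_le_mul_of_nonneg_left ?_ (chaosConst_nonneg hK 2)
  have hone := sum_cross_leverage_sq_mul_le hU (leverage_le_one hU) e
  have hone' : ∑ i, ∑ j, (U i ⬝ᵥ U j) ^ 2 * e i ^ 2 ≤ 1 * ∑ j, e j ^ 2 := by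
    rw [Finset.sum_comm]
    simpa only [dotProduct_comm] using hone
  rw [one_mul] at hone hone'
  have ha2 : (a - 1) ^ 2 ≤ (1 + K) ^ 2 := by
    rw [← sq_abs]
    exact pow_le_pow_left₀ (abs_nonneg _) (by rw [_root_.abs_le]; constructor <;> linarith) 2
  have hcross : ∀ i j, (U i ⬝ᵥ U j) ^ 2 ≤ κ ^ 2 := by
    intro i j
    have h1 := abs_dotProduct_le (U i) (U j)
    have h2 : (U i ⬝ᵥ U j) ^ 2 ≤ (euNorm (U i) * euNorm (U j)) ^ 2 := by
      rw [← sq_abs]; exact pow_le_pow_left₀ (abs_nonneg _) h1 2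
    rw [mul_pow, euNorm_sq', euNorm_sq'] at h2
    refine h2.trans ?_
    rw [sq]
    exact mul_le_mul (hκ i) (hκ j) (leverage_nonneg U j) hκ0
  have hpp : ∀ i, (U i ⬝ᵥ U i) ^ 2 ≤ κ ^ 2 := fun i =>
    pow_le_pow_left₀ (leverage_nonneg U i) (hκ i) 2
  calc ∑ i, ∑ j, (if i = j then 0 else cfQuad U e a i j) ^ 2
      ≤ ∑ i, ∑ j, (3 * κ ^ 2 * ((U i ⬝ᵥ U j) ^ 2 * e j ^ 2)
        + 3 * κ ^ 2 * ((U i ⬝ᵥ U j) ^ 2 * e i ^ 2)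
        + 3 * (1 + K) ^ 2 * κ ^ 2 * ((U i ⬝ᵥ U j) ^ 2 * e j ^ 2)) := by
        refine Finset.sum_le_sum fun i _ => Finset.sum_le_sum fun j _ => ?_
        split_ifs
        · simp only [ne_eq, OfNat.ofNat_ne_zero, not_false_eq_true, zero_pow]; positivity
        · rw [cfQuad]
          set x := (U i ⬝ᵥ U i) * (U i ⬝ᵥ U j) * e j
          set y := (U i ⬝ᵥ U j) ^ 2 * e i
          set z := (a - 1) * ((U i ⬝ᵥ U j) * (U j ⬝ᵥ U j) * e j)
          have h1 : x ^ 2 ≤ κ ^ 2 * ((U i ⬝ᵥ U j) ^ 2 * e j ^ 2) := by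
            have := mul_le_mul_of_nonneg_right (hpp i)
              (show 0 ≤ (U i ⬝ᵥ U j) ^ 2 * e j ^ 2 by positivity)
            calc x ^ 2 = (U i ⬝ᵥ U i) ^ 2 * ((U i ⬝ᵥ U j) ^ 2 * e j ^ 2) := by ring
              _ ≤ _ := this
          have h2 : y ^ 2 ≤ κ ^ 2 * ((U i ⬝ᵥ U j) ^ 2 * e i ^ 2) := by
            have := mul_le_mul_of_nonneg_right (hcross i j)
              (show 0 ≤ (U i ⬝ᵥ U j) ^ 2 * e i ^ 2 by positivity)
            calc y ^ 2 = (U i ⬝ᵥ U j) ^ 2 * ((U i ⬝ᵥ U j) ^ 2 * e i ^ 2) := by ring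
              _ ≤ _ := this
          have h3 : z ^ 2 ≤ (1 + K) ^ 2 * κ ^ 2 * ((U i ⬝ᵥ U j) ^ 2 * e j ^ 2) := by
            have := mul_le_mul_of_nonneg_right
              (mul_le_mul ha2 (hpp j) (sq_nonneg _) (by positivity))
              (show 0 ≤ (U i ⬝ᵥ U j) ^ 2 * e j ^ 2 by positivity)
            calc z ^ 2 = (a - 1) ^ 2 * (U j ⬝ᵥ U j) ^ 2 * ((U i ⬝ᵥ U j) ^ 2 * e j ^ 2) := by ring
              _ ≤ _ := this
          have h4 : (x + y - z) ^ 2 ≤ 3 * (x ^ 2 + y ^ 2 + z ^ 2) := by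
            nlinarith [sq_nonneg (x - y), sq_nonneg (x + z), sq_nonneg (y + z)]
          linarith
    _ = 3 * κ ^ 2 * (∑ i, ∑ j, (U i ⬝ᵥ U j) ^ 2 * e j ^ 2)
        + 3 * κ ^ 2 * (∑ i, ∑ j, (U i ⬝ᵥ U j) ^ 2 * e i ^ 2)
        + 3 * (1 + K) ^ 2 * κ ^ 2 * (∑ i, ∑ j, (U i ⬝ᵥ U j) ^ 2 * e j ^ 2) := by
        simp only [Finset.sum_add_distrib, ← Finset.mul_sum]
    _ ≤ 3 * κ ^ 2 * (∑ j, e j ^ 2) + 3 * κ ^ 2 * (∑ j, e j ^ 2)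
        + 3 * (1 + K) ^ 2 * κ ^ 2 * (∑ j, e j ^ 2) := by gcongr
    _ = _ := by ring

lemma srsMean_cfCubic_sq_le (hw : IsSamplingWeight n n₁ w K) (hK : 1 ≤ K)
    (hn : 12 ≤ n) (hU : Uᵀ * U = 1) (hκ0 : 0 ≤ κ) (hκ : ∀ i, U i ⬝ᵥ U i ≤ κ) (e : Fin n → ℝ) :
    srsMean n n₁ (fun S => (∑ i, ∑ j, ∑ l, cfCubic U e i j l * (w S i * w S j * w S l)) ^ 2)
      ≤ chaosConst K 3 * (κ ^ 2 * ∑ j, e j ^ 2) := by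
  refine (hw.srsMean_cubic_sq_le hK hn _ (by simp [cfCubic]) (by simp [cfCubic])
    (by simp [cfCubic])).trans ?_
  refine mul_le_mul_of_nonneg_left ?_ (chaosConst_nonneg hK 3)
  calc ∑ i, ∑ j, ∑ l, cfCubic U e i j l ^ 2
      ≤ ∑ i, ∑ j, ∑ l, (U i ⬝ᵥ U j) ^ 2 * ((U j ⬝ᵥ U l) ^ 2 * e l ^ 2) := by
        refine Finset.sum_le_sum fun i _ => Finset.sum_le_sum fun j _ =>
          Finset.sum_le_sum fun l _ => ?_
        rw [cfCubic]
        split_ifs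
        · simp only [ne_eq, OfNat.ofNat_ne_zero, not_false_eq_true, zero_pow]; positivity
        · exact le_of_eq (by ring)
    _ = ∑ j, (U j ⬝ᵥ U j) * ∑ l, (U j ⬝ᵥ U l) ^ 2 * e l ^ 2 := by
        rw [Finset.sum_comm]
        refine Finset.sum_congr rfl fun j _ => ?_
        simp only [← Finset.mul_sum]
        rw [← Finset.sum_mul, ← sum_sq_cross_leverage hU]
        simp only [dotProduct_comm]
    _ ≤ ∑ j, κ * ∑ l, (U j ⬝ᵥ U l) ^ 2 * e l ^ 2 :=
        Finset.sum_le_sum fun i _ => mul_le_mul_of_nonneg_right (hκ i)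
          (Finset.sum_nonneg fun j _ => by positivity)
    _ ≤ κ * (κ * ∑ j, e j ^ 2) := by
        rw [← Finset.mul_sum]
        exact mul_le_mul_of_nonneg_left (sum_cross_leverage_sq_mul_le hU hκ e) hκ0
    _ = _ := by ring

end IsSamplingWeight

/-! ### Stochastic orders of the arm-wise terms -/

namespace RCT

section

variable (E : RCT)

/-- The weighted Gram matrix `X = ∑ w_i u_i u_i'` of arm `t` in the orthonormal design, which is
the deviation of the Gram matrix of the arm from the identity. -/
noncomputable abbrev gramError (t : Fin 2) (S : E.Assignment) :
    Matrix (Fin (E.d + 1)) (Fin (E.d + 1)) ℝ :=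
  weightedGram E.orthoDesign (E.weight t S)

/-- The score `g = ∑ w_i e_i u_i` of arm `t`. -/
noncomputable abbrev score (t : Fin 2) (S : E.Assignment) : Fin (E.d + 1) → ℝ :=
  ∑ i, (E.weight t S i * E.e t i) • E.orthoDesign i

/-- The imbalance `s = ∑ w_i u_i` of the regressors in arm `t`. -/
noncomputable abbrev imbalance (t : Fin 2) (S : E.Assignment) : Fin (E.d + 1) → ℝ :=
  ∑ i, E.weight t S i • E.orthoDesign i

/-- The size `√(n ℰ₂)` of the residual vectors. -/
noncomputable def residSize : ℝ := √(E.n * E.E2)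

lemma E2_nonneg : 0 ≤ E.E2 :=
  le_max_of_le_left (mul_nonneg (by positivity) (Finset.sum_nonneg fun i _ => sq_nonneg _))

lemma residSize_nonneg : 0 ≤ E.residSize := Real.sqrt_nonneg _

lemma residSize_sq : E.residSize ^ 2 = E.n * E.E2 :=
  Real.sq_sqrt (mul_nonneg (Nat.cast_nonneg _) E.E2_nonneg)

lemma sum_e_sq_le (t : Fin 2) : ∑ i, E.e t i ^ 2 ≤ E.residSize ^ 2 := by
  have hn := E.cast_n_pos
  have h : (1 / (E.n : ℝ)) * ∑ i, E.e t i ^ 2 ≤ E.E2 := by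
    fin_cases t
    · exact le_max_right _ _
    · exact le_max_left _ _
  rw [residSize_sq]
  rw [one_div, inv_mul_le_iff₀ hn] at h
  exact h

lemma euNorm_e_le (t : Fin 2) : euNorm (E.e t) ≤ E.residSize :=
  euNorm_le_of_sq_le E.residSize_nonneg (E.sum_e_sq_le t)

lemma one_le_p : (1 : ℝ) ≤ E.p := by
  have : 1 ≤ E.p := by unfold p; omega
  exact_mod_cast this

lemma log_p_nonneg : 0 ≤ Real.log E.p := Real.log_nonneg E.one_le_p

lemma p_le_n_mul_kappa : (E.p : ℝ) ≤ E.n * E.kappa := by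
  have h := sum_leverage E.orthoDesign_orthonormal
  have h2 : ∑ i, E.orthoDesign i ⬝ᵥ E.orthoDesign i ≤ ∑ _i : Fin E.n, E.kappa :=
    Finset.sum_le_sum fun i _ => E.leverage_le_kappa i
  rw [h, Finset.sum_const, Finset.card_univ, Fintype.card_fin, nsmul_eq_mul] at h2
  exact h2

lemma kappa_pos : 0 < E.kappa := by
  have h1 := E.p_le_n_mul_kappa
  have h2 := E.one_le_p
  have h3 := E.cast_n_pos
  by_contra hcon
  nlinarith [not_lt.1 hcon]

/-- Without covariates all leverages are equal. -/
lemma kappa_eq_of_d_eq_zero (h : E.d = 0) : E.kappa = 1 / E.n := by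
  have hn := E.cast_n_pos
  have hz : ∀ i j, E.z i = E.z j := by
    intro i j
    ext a
    have ha : a = 0 := by
      apply Fin.ext
      have := a.isLt
      rw [Fin.val_zero]
      omega
    rw [ha, z_zero, z_zero]
  have hP : ∀ i j, E.orthoDesign i ⬝ᵥ E.orthoDesign i = E.orthoDesign j ⬝ᵥ E.orthoDesign j := by
    intro i j
    rw [← z_gram_inv_z, ← z_gram_inv_z, hz i j]
  have hone : ∀ i, E.P i i = 1 / E.n := by
    intro i
    have h1 := sum_leverage E.orthoDesign_orthonormal
    rw [Finset.sum_congr rfl fun j _ => hP j i, Finset.sum_const, Finset.card_univ,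
      Fintype.card_fin, nsmul_eq_mul] at h1
    have h2 : ((E.d + 1 : ℕ) : ℝ) = 1 := by rw [h]; norm_num
    rw [P_apply, eq_div_iff hn.ne', mul_comm, h1, h2]
  have : Nonempty (Fin E.n) := ⟨⟨0, E.n_pos⟩⟩
  simp only [kappa, hone, ciSup_const]

lemma half_le_log_p (h : 0 < E.d) : 1 / 2 ≤ Real.log E.p := by
  have h2 : (2 : ℝ) ≤ E.p := by
    have : 2 ≤ E.p := by unfold p; omega
    exact_mod_cast this
  exact (by linarith [Real.log_two_gt_d9] : (1 / 2 : ℝ) ≤ Real.log 2).trans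
    (Real.log_le_log (by norm_num) h2)

/-- For `p ≥ 2` the leverages are controlled by `κ log p`. For `p = 1` the logarithm vanishes, and
`κ = 1 / n`. -/
lemma kappa_le : E.kappa ≤ 1 / E.n + 2 * (E.kappa * Real.log E.p) := by
  have hκ := E.kappa_nonneg
  rcases Nat.eq_zero_or_pos E.d with h | h
  · have := mul_nonneg hκ E.log_p_nonneg
    linarith [E.kappa_eq_of_d_eq_zero h]
  · have h3 := E.half_le_log_p h
    have h4 : 0 ≤ 1 / (E.n : ℝ) := by positivity
    nlinarith

lemma one_div_share_one : 1 / E.share 1 = (E.n : ℝ) / E.n₁ := by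
  rw [share_eq, one_div_div]; simp [armSize]

lemma one_div_share_zero : 1 / E.share 0 = (E.n : ℝ) / E.n₀ := by
  rw [share_eq, one_div_div]; simp [armSize]

end

/-- The asymptotic regime, in the form in which it is used: the population size diverges, the
leverages and `κ log p` vanish and the weights are eventually bounded by `K`. -/
structure IsRegular (E : ℕ → RCT) (K : ℝ) : Prop where
  one_le : 1 ≤ K
  tendsto_n : Tendsto (fun m => (E m).n) atTop atTop
  eventually_share : ∀ᶠ m in atTop, ∀ t, 1 / (E m).share t ≤ K
  tendsto_kappa : Tendsto (fun m => (E m).kappa) atTop (𝓝 0)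
  tendsto_kappa_log : Tendsto (fun m => (E m).kappa * Real.log (E m).p) atTop (𝓝 0)

lemma exists_isRegular {E : ℕ → RCT} (hn : Tendsto (fun m => (E m).n) atTop atTop)
    (h₁ : (fun m => ((E m).n : ℝ) / (E m).n₁) =O[atTop] (fun _ => (1 : ℝ)))
    (h₀ : (fun m => ((E m).n : ℝ) / (E m).n₀) =O[atTop] (fun _ => (1 : ℝ)))
    (hκ : (fun m => (E m).kappa * Real.log (E m).p) =o[atTop] (fun _ => (1 : ℝ))) :
    ∃ K, IsRegular E K := by
  obtain ⟨c₁, hc₁⟩ := h₁.bound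
  obtain ⟨c₀, hc₀⟩ := h₀.bound
  have hκl : Tendsto (fun m => (E m).kappa * Real.log (E m).p) atTop (𝓝 0) :=
    (isLittleO_one_iff ℝ).1 hκ
  refine ⟨max 1 (max c₁ c₀), le_max_left _ _, hn, ?_, ?_, hκl⟩
  · filter_upwards [hc₁, hc₀] with m h1 h0 t
    rw [norm_one, mul_one] at h1 h0
    fin_cases t
    · exact ((E m).one_div_share_zero.le.trans ((le_abs_self _).trans h0)).trans
        ((le_max_right _ _).trans (le_max_right _ _))
    · exact ((E m).one_div_share_one.le.trans ((le_abs_self _).trans h1)).trans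
        ((le_max_left _ _).trans (le_max_right _ _))
  · have hlim : Tendsto (fun m => 1 / ((E m).n : ℝ) + 2 * ((E m).kappa * Real.log (E m).p)) atTop
        (𝓝 (0 + 2 * 0)) :=
      ((tendsto_const_div_atTop_nhds_zero_nat (1 : ℝ)).comp hn).add (hκl.const_mul 2)
    rw [mul_zero, add_zero] at hlim
    exact squeeze_zero (fun m => (E m).kappa_nonneg) (fun m => (E m).kappa_le) hlim

namespace IsRegular

variable {E : ℕ → RCT} {K : ℝ}

lemma eventually_weight (h : IsRegular E K) : ∀ᶠ m in atTop, 12 ≤ (E m).n ∧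
    ∀ t, IsSamplingWeight (E m).n (E m).n₁ ((E m).weight t) K := by
  filter_upwards [h.tendsto_n.eventually_ge_atTop 12, h.eventually_share] with m h1 h2
  exact ⟨h1, fun t => (E m).isSamplingWeight t h.one_le (h2 t)⟩

lemma isBigOp_imbalance (h : IsRegular E K) (t : Fin 2) :
    IsBigOp (fun m => (E m).law) (fun m S => euNorm ((E m).imbalance t S))
      (fun m => √((E m).p : ℝ)) := by
  refine isBigOp_of_srsMean_sq_le (C := IsSamplingWeight.chaosConst K 1) ?_
    fun m => Real.sqrt_nonneg _
  filter_upwards [h.eventually_weight] with m hm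
  have := (hm.2 t).srsMean_euNorm_linear_sq_le (U := (E m).orthoDesign) h.one_le hm.1 fun _ => 1
  simp only [one_pow, one_mul, mul_one] at this
  rw [sum_leverage (E m).orthoDesign_orthonormal] at this
  rw [Real.sq_sqrt (Nat.cast_nonneg _)]
  exact this

lemma isBigOp_score (h : IsRegular E K) (t : Fin 2) :
    IsBigOp (fun m => (E m).law) (fun m S => euNorm ((E m).score t S))
      (fun m => √(E m).kappa * (E m).residSize) := by
  refine isBigOp_of_srsMean_sq_le (C := IsSamplingWeight.chaosConst K 1) ?_
    fun m => mul_nonneg (Real.sqrt_nonneg _) (E m).residSize_nonneg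
  filter_upwards [h.eventually_weight] with m hm
  refine ((hm.2 t).srsMean_euNorm_linear_sq_le (U := (E m).orthoDesign) h.one_le hm.1 _).trans ?_
  refine mul_le_mul_of_nonneg_left ?_ (IsSamplingWeight.chaosConst_nonneg h.one_le 1)
  rw [mul_pow, Real.sq_sqrt (E m).kappa_nonneg]
  refine le_trans ?_ (mul_le_mul_of_nonneg_left ((E m).sum_e_sq_le t) (E m).kappa_nonneg)
  rw [Finset.mul_sum]
  refine Finset.sum_le_sum fun i _ => ?_
  rw [mul_comm]
  exact mul_le_mul_of_nonneg_right ((E m).leverage_le_kappa i) (sq_nonneg _)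

/-- A chaos whose second moment is of the order of `κ² ∑ e_i²`. -/
lemma isBigOp_of_srsMean_sq_le_kappa (t : Fin 2) {X : ∀ m, (E m).Assignment → ℝ} {C : ℝ}
    (hC : 0 ≤ C)
    (hX : ∀ᶠ m in atTop, srsMean (E m).n (E m).n₁ (fun S => X m S ^ 2)
      ≤ C * ((E m).kappa ^ 2 * ∑ i, (E m).e t i ^ 2)) :
    IsBigOp (fun m => (E m).law) X (fun m => (E m).kappa * (E m).residSize) := by
  refine isBigOp_of_srsMean_sq_le (C := C) ?_
    fun m => mul_nonneg (E m).kappa_nonneg (E m).residSize_nonneg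
  filter_upwards [hX] with m hm
  refine hm.trans (mul_le_mul_of_nonneg_left ?_ hC)
  rw [mul_pow]
  exact mul_le_mul_of_nonneg_left ((E m).sum_e_sq_le t) (sq_nonneg _)

lemma isBigOp_offDiagonalFit (h : IsRegular E K) (t : Fin 2) :
    IsBigOp (fun m => (E m).law) (fun m S => euNorm (IsSamplingWeight.offDiagonalFit
        (E m).orthoDesign ((E m).weight t S) ((E m).e t)))
      (fun m => (E m).kappa * (E m).residSize) := by
  refine isBigOp_of_srsMean_sq_le_kappa t (IsSamplingWeight.chaosConst_nonneg h.one_le 2) ?_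
  filter_upwards [h.eventually_weight] with m hm
  exact (hm.2 t).srsMean_euNorm_offDiagonalFit_sq_le h.one_le hm.1 (E m).orthoDesign_orthonormal
    (E m).kappa_nonneg (E m).leverage_le_kappa _

lemma isBigOp_leverage_score (h : IsRegular E K) (t : Fin 2) :
    IsBigOp (fun m => (E m).law) (fun m S => ∑ i, (E m).weight t S i
        * (((E m).orthoDesign i ⬝ᵥ (E m).orthoDesign i) * (E m).e t i))
      (fun m => (E m).kappa * (E m).residSize) := by
  refine isBigOp_of_srsMean_sq_le_kappa t (IsSamplingWeight.chaosConst_nonneg h.one_le 1) ?_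
  filter_upwards [h.eventually_weight] with m hm
  have h1 := (hm.2 t).srsMean_linear_sq_le h.one_le hm.1
    fun i => ((E m).orthoDesign i ⬝ᵥ (E m).orthoDesign i) * (E m).e t i
  simp only [mul_comm _ ((E m).weight t _ _)] at h1
  refine h1.trans (mul_le_mul_of_nonneg_left ?_ (IsSamplingWeight.chaosConst_nonneg h.one_le 1))
  rw [Finset.mul_sum]
  refine Finset.sum_le_sum fun i _ => ?_
  rw [mul_pow]
  exact mul_le_mul_of_nonneg_right (pow_le_pow_left₀ (leverage_nonneg _ i)
    ((E m).leverage_le_kappa i) 2) (sq_nonneg _)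

lemma eventually_odds_le (h : IsRegular E K) : ∀ᶠ m in atTop, ∀ t, (E m).odds t ≤ K := by
  filter_upwards [h.eventually_share] with m hm t
  unfold odds
  linarith [hm t]

lemma isBigOp_cfLin (h : IsRegular E K) (t : Fin 2) :
    IsBigOp (fun m => (E m).law) (fun m S => ∑ i, cfLin (E m).orthoDesign ((E m).e t)
        ((E m).odds t) i * (E m).weight t S i)
      (fun m => (E m).kappa * (E m).residSize) := by
  have hC := IsSamplingWeight.chaosConst_nonneg h.one_le 1
  refine isBigOp_of_srsMean_sq_le_kappa t
    (C := IsSamplingWeight.chaosConst K 1 * (2 * (1 + K ^ 2))) (by positivity) ?_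
  filter_upwards [h.eventually_weight, h.eventually_odds_le] with m hm hodds
  exact (hm.2 t).srsMean_cfLin_sq_le h.one_le hm.1 (E m).orthoDesign_orthonormal
    (E m).leverage_le_kappa ((E m).odds_nonneg t) (hodds t) _

lemma isBigOp_cfQuad (h : IsRegular E K) (t : Fin 2) :
    IsBigOp (fun m => (E m).law) (fun m S => ∑ i, ∑ j, (if i = j then 0 else
        cfQuad (E m).orthoDesign ((E m).e t) ((E m).odds t) i j)
          * ((E m).weight t S i * (E m).weight t S j))
      (fun m => (E m).kappa * (E m).residSize) := by
  have hC := IsSamplingWeight.chaosConst_nonneg h.one_le 2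
  refine isBigOp_of_srsMean_sq_le_kappa t
    (C := IsSamplingWeight.chaosConst K 2 * (3 * (2 + (1 + K) ^ 2))) (by positivity) ?_
  filter_upwards [h.eventually_weight, h.eventually_odds_le] with m hm hodds
  exact (hm.2 t).srsMean_cfQuad_sq_le h.one_le hm.1 (E m).orthoDesign_orthonormal
    (E m).kappa_nonneg (E m).leverage_le_kappa ((E m).odds_nonneg t) (hodds t) _

lemma isBigOp_cfCubic (h : IsRegular E K) (t : Fin 2) :
    IsBigOp (fun m => (E m).law) (fun m S => ∑ i, ∑ j, ∑ l,
        cfCubic (E m).orthoDesign ((E m).e t) i j l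
          * ((E m).weight t S i * (E m).weight t S j * (E m).weight t S l))
      (fun m => (E m).kappa * (E m).residSize) := by
  refine isBigOp_of_srsMean_sq_le_kappa t (IsSamplingWeight.chaosConst_nonneg h.one_le 3) ?_
  filter_upwards [h.eventually_weight] with m hm
  exact (hm.2 t).srsMean_cfCubic_sq_le h.one_le hm.1 (E m).orthoDesign_orthonormal
    (E m).kappa_nonneg (E m).leverage_le_kappa _

/-- The operator norm of the Gram matrix error, by Markov's inequality for a trace moment of order
about `2 log p`. -/
lemma isBigOp_gramError (h : IsRegular E K) (t : Fin 2) :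
    IsBigOp (fun m => (E m).law) (fun m S => euOpNorm ((E m).gramError t S))
      (fun m => √((E m).kappa * (1 + Real.log (E m).p))) := by
  intro ε hε
  have hK := h.one_le
  -- `δ ≤ 1` lets the power `2 q` of the norm absorb the factor `1 / δ` of Markov's inequality, and
  -- `exp 1` absorbs `p ≤ exp q`
  set δ : ℝ := min ε 1 with hδ
  have hδ0 : 0 < δ := lt_min hε one_pos
  set M : ℝ := 16 * K ^ 2 * (Real.exp 1 / δ) with hM
  have hM0 : 0 < M := by positivity
  refine ⟨√M, Real.sqrt_pos.2 hM0, ?_⟩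
  filter_upwards [h.eventually_weight] with m hm
  set κ := (E m).kappa with hκ
  set ℓ := Real.log (E m).p with hℓ
  have hκ0 : 0 < κ := (E m).kappa_pos
  have hℓ0 : 0 ≤ ℓ := (E m).log_p_nonneg
  have hp0 : (0 : ℝ) < (E m).p := lt_of_lt_of_le one_pos (E m).one_le_p
  -- the order of the moment
  set q : ℕ := ⌈ℓ⌉₊ + 1 with hq
  have hq1 : ℓ ≤ q := by
    rw [hq]; push_cast
    linarith [Nat.le_ceil ℓ]
  have hq2 : (q : ℝ) ≤ 2 * (1 + ℓ) := by
    rw [hq]; push_cast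
    linarith [(Nat.ceil_lt_add_one hℓ0).le]
  have hmom := (hm.2 t).srsMean_trace_pow_le (E m).n_pos (E m).n₁_lt.le
    (E m).orthoDesign_orthonormal hκ0.le (E m).leverage_le_kappa q q le_rfl
  set R : ℝ := 16 * K ^ 2 * (κ * (1 + ℓ)) with hR
  have hR0 : 0 < R := by positivity
  have hmom2 : srsMean (E m).n (E m).n₁
      (fun S => ((E m).gramError t S ^ (2 * q)).trace) ≤ (E m).p * R ^ q := by
    refine hmom.trans ?_
    refine mul_le_mul_of_nonneg_left (pow_le_pow_left₀ (by positivity) ?_ q) hp0.le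
    calc 8 * K ^ 2 * κ * q ≤ 8 * K ^ 2 * κ * (2 * (1 + ℓ)) := by gcongr
      _ = R := by rw [hR]; ring
  set c : ℝ := (M * (κ * (1 + ℓ))) ^ q with hc
  have hc_eq : c = R ^ q * (Real.exp 1 ^ q * (1 / δ) ^ q) := by
    rw [hc, hM, hR, ← mul_pow, ← mul_pow]; congr 1; ring
  have hexp : ((E m).p : ℝ) ≤ Real.exp 1 ^ q := by
    rw [← Real.exp_nat_mul, mul_one, ← Real.log_le_iff_le_exp hp0]
    exact hq1
  have hδq : 1 / δ ≤ (1 / δ) ^ q := by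
    refine le_self_pow₀ ?_ (by omega)
    rw [le_div_iff₀ hδ0, one_mul]; exact min_le_right _ _
  have hcge : R ^ q * ((E m).p * (1 / δ)) ≤ c := by
    rw [hc_eq]; gcongr
  have hc0 : 0 < c := by positivity
  have hsub : {S | √M * √(κ * (1 + ℓ)) < |euOpNorm ((E m).gramError t S)|}
      ⊆ {S | c < ((E m).gramError t S ^ (2 * q)).trace} := by
    intro S hS
    have h1 : √M * √(κ * (1 + ℓ)) < euOpNorm ((E m).gramError t S) := by
      have : √M * √(κ * (1 + ℓ)) < |euOpNorm ((E m).gramError t S)| := hS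
      rwa [abs_of_nonneg (euOpNorm_nonneg _)] at this
    have h2 : c = (√M * √(κ * (1 + ℓ))) ^ (2 * q) := by
      rw [hc, pow_mul]
      congr 1
      rw [mul_pow, Real.sq_sqrt hM0.le, Real.sq_sqrt (by positivity)]
    change c < _
    rw [h2]
    exact lt_of_lt_of_le (pow_lt_pow_left₀ h1 (by positivity) (by omega))
      (euOpNorm_pow_le_trace (weightedGram_transpose _ _) (by omega))
  have hmarkov := (E m).mul_law_real_le
    (V := fun S => ((E m).gramError t S ^ (2 * q)).trace) (fun S => by
      have := trace_sq_mul_pow_nonneg (weightedGram_transpose (E m).orthoDesign ((E m).weight t S))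
        (Matrix.transpose_one (n := Fin ((E m).d + 1)) (α := ℝ)) q
      simpa using this) c
  have hfin : c * (E m).law.real {S | c < ((E m).gramError t S ^ (2 * q)).trace} ≤ c * δ := by
    refine (hmarkov.trans hmom2).trans ?_
    calc ((E m).p : ℝ) * R ^ q = R ^ q * ((E m).p * (1 / δ)) * δ := by field_simp
      _ ≤ c * δ := mul_le_mul_of_nonneg_right hcge hδ0.le
  exact (measureReal_mono hsub).trans ((le_of_mul_le_mul_left hfin hc0).trans (min_le_left _ _))

/-- With probability tending to one, the Gram matrices of both arms are well conditioned. -/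
lemma tendsto_gramError (h : IsRegular E K) :
    Tendsto (fun m => (E m).law.real
      {S | ∀ t, euOpNorm ((E m).gramError t S) ≤ 1 / 2}ᶜ) atTop (𝓝 0) := by
  have hrate : Tendsto (fun m => √((E m).kappa * (1 + Real.log (E m).p))) atTop (𝓝 0) := by
    have h1 : Tendsto (fun m => (E m).kappa + (E m).kappa * Real.log (E m).p) atTop
        (𝓝 (0 + 0)) := h.tendsto_kappa.add h.tendsto_kappa_log
    have h2 := (Real.continuous_sqrt.tendsto _).comp h1
    rw [add_zero, Real.sqrt_zero] at h2
    refine h2.congr fun m => ?_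
    simp only [Function.comp]
    ring_nf
  have harm : ∀ t, Tendsto (fun m => (E m).law.real
      {S | 1 / 2 < euOpNorm ((E m).gramError t S)}) atTop (𝓝 0) := by
    intro t
    rw [Metric.tendsto_nhds]
    intro ε hε
    obtain ⟨M, hM, hev⟩ := h.isBigOp_gramError t (ε / 2) (by positivity)
    have hsmall : ∀ᶠ m in atTop, √((E m).kappa * (1 + Real.log (E m).p)) < 1 / (2 * M) :=
      hrate.eventually (gt_mem_nhds (by positivity))
    filter_upwards [hev, hsmall] with m h1 h2
    rw [Real.dist_eq, sub_zero, abs_of_nonneg measureReal_nonneg]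
    refine lt_of_le_of_lt ((measureReal_mono fun S hS => ?_).trans h1) (by linarith)
    have hS' : 1 / 2 < euOpNorm ((E m).gramError t S) := hS
    change M * √((E m).kappa * (1 + Real.log (E m).p)) < |euOpNorm ((E m).gramError t S)|
    rw [abs_of_nonneg (euOpNorm_nonneg _)]
    refine lt_of_le_of_lt ?_ hS'
    calc M * √((E m).kappa * (1 + Real.log (E m).p)) ≤ M * (1 / (2 * M)) := by gcongr
      _ = 1 / 2 := by field_simp
  have hsum := (harm 0).add (harm 1)
  rw [add_zero] at hsum
  refine squeeze_zero (fun m => measureReal_nonneg) (fun m => ?_) hsum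
  refine (measureReal_mono fun S hS => ?_).trans (measureReal_union_le _ _)
  by_contra hcon
  rw [Set.mem_union, not_or] at hcon
  refine hS fun t => ?_
  fin_cases t
  · exact not_lt.1 hcon.1
  · exact not_lt.1 hcon.2

end IsRegular

end RCT

/-! ### Rates of the remainders and of the bias terms -/

section

variable {Ω : ℕ → Type*} [∀ m, MeasurableSpace (Ω m)] {μ : ∀ m, Measure (Ω m)}
  [∀ m, IsProbabilityMeasure (μ m)]

lemma IsBigOp.congr_on {X Y : ∀ m, Ω m → ℝ} {a : ℕ → ℝ} {good : ∀ m, Set (Ω m)}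
    (hgood : Tendsto (fun m => (μ m).real (good m)ᶜ) atTop (𝓝 0)) (ha : ∀ m, 0 ≤ a m)
    (hY : IsBigOp μ Y a) (h : ∀ m, ∀ ω ∈ good m, X m ω = Y m ω) : IsBigOp μ X a :=
  IsBigOp.of_controlled (ι := Unit) (V := fun _ => Y) (r := fun _ => a) hgood (fun _ => ha)
    (fun _ => hY) fun M hM => ⟨M, by linarith, Eventually.of_forall fun m ω hω hb => by
      rw [h m ω hω]; exact hb ()⟩

end

namespace RCT

/-- The norms in the remainder of the cross-fitted estimator, at their stochastic orders. Here `s`,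
`g`, `ρ`, `x` and `η` stand for the norms of the imbalance, of the score, of the Gram matrix error,
of its product with the score, and of the residuals. -/
lemma cf_terms_le {M K κ q R ℓ s g ρ x η : ℝ} (hM : 1 ≤ M) (hK : 1 ≤ K) (hκ : 0 ≤ κ) (hκ1 : κ ≤ 1)
    (hR : 0 ≤ R) (hℓ : 0 ≤ ℓ) (hg0 : 0 ≤ g) (hx0 : 0 ≤ x) (hη0 : 0 ≤ η)
    (hρ0 : 0 ≤ ρ) (hs : s ≤ M * √q) (hg : g ≤ M * (√κ * R)) (hρ : ρ ≤ M * √(κ * (1 + ℓ)))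
    (hx : x ≤ (M + K ^ 2) * (κ * R)) (hη : η ≤ R) :
    s * ρ * x + √(κ * q) * (x + ρ * g + ρ ^ 2 * η + κ * g + κ * η)
      ≤ 6 * (M ^ 2 * (M + K ^ 2) * (κ * R * √(κ * q) * (1 + ℓ))) := by
  set N := √(κ * q) with hN
  have hN0 : 0 ≤ N := Real.sqrt_nonneg _
  set A : ℝ := M ^ 2 * (M + K ^ 2) with hA
  have hA0 : 0 < A := by positivity
  have hκκ : √κ * √κ = κ := Real.mul_self_sqrt hκ
  have hℓ1 : √(1 + ℓ) ≤ 1 + ℓ := by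
    rw [Real.sqrt_le_left (by linarith)]
    nlinarith
  have hℓℓ : √(1 + ℓ) ^ 2 = 1 + ℓ := Real.sq_sqrt (by linarith)
  rw [Real.sqrt_mul hκ] at hρ
  have hNq : N = √κ * √q := Real.sqrt_mul hκ _
  set Y : ℝ := κ * R * N * (1 + ℓ) with hY
  have hκRN0 : 0 ≤ κ * R * N := by positivity
  have hκRN : κ * R * N ≤ Y := le_mul_of_one_le_right hκRN0 (by linarith)
  have hY0 : 0 ≤ Y := hκRN0.trans hκRN
  have hκs : √κ ≤ 1 := Real.sqrt_le_one.2 hκ1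
  have hM2 : 1 ≤ M ^ 2 := one_le_pow₀ hM
  have hK2 : 1 ≤ K ^ 2 := one_le_pow₀ hK
  have hMK : 1 ≤ M + K ^ 2 := by linarith
  have hA1 : M + K ^ 2 ≤ A := le_mul_of_one_le_left (by linarith) hM2
  have hA2 : M ^ 2 ≤ A := le_mul_of_one_le_right (by positivity) hMK
  have t1 : s * ρ * x ≤ A * Y := by
    calc s * ρ * x ≤ (M * √q) * (M * (√κ * √(1 + ℓ))) * ((M + K ^ 2) * (κ * R)) := by gcongr
      _ = A * (κ * R * N * √(1 + ℓ)) := by rw [hNq, hA]; ring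
      _ ≤ A * Y := by rw [hY]; gcongr
  have t2 : N * x ≤ A * Y := by
    calc N * x ≤ N * ((M + K ^ 2) * (κ * R)) := by gcongr
      _ = (M + K ^ 2) * (κ * R * N) := by ring
      _ ≤ A * Y := by gcongr
  have t3 : N * (ρ * g) ≤ A * Y := by
    calc N * (ρ * g) ≤ N * ((M * (√κ * √(1 + ℓ))) * (M * (√κ * R))) := by gcongr
      _ = M ^ 2 * ((√κ * √κ) * R * N * √(1 + ℓ)) := by ring
      _ ≤ A * Y := by rw [hκκ, hY]; gcongr
  have t4 : N * (ρ ^ 2 * η) ≤ A * Y := by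
    calc N * (ρ ^ 2 * η) ≤ N * ((M * (√κ * √(1 + ℓ))) ^ 2 * R) := by gcongr
      _ = M ^ 2 * ((√κ * √κ) * R * N * √(1 + ℓ) ^ 2) := by ring
      _ ≤ A * Y := by rw [hκκ, hℓℓ]; gcongr
  have t5 : N * (κ * g) ≤ A * Y := by
    calc N * (κ * g) ≤ N * (κ * (M * (√κ * R))) := by gcongr
      _ ≤ N * (κ * (M * (1 * R))) := by gcongr
      _ = M * (κ * R * N) := by ring
      _ ≤ A * Y := mul_le_mul (by linarith) hκRN hκRN0 hA0.le
  have t6 : N * (κ * η) ≤ A * Y := by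
    calc N * (κ * η) ≤ N * (κ * R) := by gcongr
      _ = 1 * (κ * R * N) := by ring
      _ ≤ A * Y := mul_le_mul (by linarith) hκRN hκRN0 hA0.le
  linarith

section

variable (E : RCT)

/-- Since `√(n ℰ₂) / n = √(ℰ₂ / n)`, rates are compared by comparing the squares of the factors other
than the size of the residuals. -/
lemma residSize_mul_le {y c Y : ℝ} (hc : 0 ≤ c) (hY : 0 ≤ Y) (h : y ^ 2 ≤ c ^ 2 * Y) :
    (1 / (E.n : ℝ)) * (E.residSize * y) ≤ c * (1 / √(E.n : ℝ) * √(E.E2 * Y)) := by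
  have hn := E.cast_n_pos
  have hsn : 0 < √(E.n : ℝ) := Real.sqrt_pos.2 hn
  have h1 : y ≤ c * √Y := by
    refine (abs_le_of_sq_le_sq' (by rwa [mul_pow, Real.sq_sqrt hY]) (by positivity)).2
  have h2 : E.residSize = √(E.n : ℝ) * √E.E2 := Real.sqrt_mul hn.le _
  have h3 : 1 / (E.n : ℝ) * √(E.n : ℝ) = 1 / √(E.n : ℝ) := by
    rw [div_mul_eq_mul_div, one_mul, Real.sqrt_div_self', one_div]
  calc (1 / (E.n : ℝ)) * (E.residSize * y) ≤ (1 / (E.n : ℝ)) * (E.residSize * (c * √Y)) := by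
        have := E.residSize_nonneg; gcongr
    _ = (1 / (E.n : ℝ) * √(E.n : ℝ)) * (c * (√E.E2 * √Y)) := by rw [h2]; ring
    _ = c * (1 / √(E.n : ℝ) * √(E.E2 * Y)) := by
        rw [h3, Real.sqrt_mul E.E2_nonneg]; ring

lemma adjRate_nonneg : 0 ≤ 1 / √(E.n : ℝ) * √(E.E2 * (E.kappa ^ 2 * E.p
    + E.kappa ^ 3 * E.p * Real.log E.p ^ 2)) := by positivity

lemma abs_adjRemainder_le {t : Fin 2} {S : E.Assignment}
    (hX : euOpNorm (E.gramError t S) ≤ 1 / 2) :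
    |E.adjRemainder t S| ≤ (1 / (E.n : ℝ))
      * (euNorm (E.imbalance t S) * (2 * euNorm (E.gramError t S *ᵥ E.score t S))) := by
  have hn := E.cast_n_pos
  have h := abs_fitted_mean_sub_le E.orthoDesign_dotProduct_sum hX (E.fitError_eq hX)
  have heq : E.adjRemainder t S = (1 / (E.n : ℝ)) * ((∑ i, E.orthoDesign i) ⬝ᵥ E.fitError t S
      - (∑ i, E.weight t S i * E.e t i - ∑ i, ∑ j, E.weight t S i * E.weight t S j
        * (E.orthoDesign i ⬝ᵥ E.orthoDesign j) * E.e t j)) := by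
    rw [adjRemainder, muAdj_sub_mu, armBias, armStochasticPart]
    ring
  rw [heq, abs_mul, abs_of_pos (by positivity : 0 < 1 / (E.n : ℝ))]
  exact mul_le_mul_of_nonneg_left h (by positivity)

lemma cfRemainder_eq {t : Fin 2} {S : E.Assignment}
    (hX : euOpNorm (E.gramError t S) ≤ 1 / 2)
    (hden : ∀ i, 1 - (1 + E.weight t S i) * (E.orthoDesign i ⬝ᵥ E.resolventRow t S i) ≠ 0) :
    E.cfRemainder t S = -((1 / (E.n : ℝ)) * (∑ i, E.weight t S i * ((E.orthoDesign i ⬝ᵥ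
          E.fitError t S - (1 + E.weight t S i) * (E.orthoDesign i ⬝ᵥ E.resolventRow t S i)
            * E.e t i)
        / (1 - (1 + E.weight t S i) * (E.orthoDesign i ⬝ᵥ E.resolventRow t S i)))
      - (∑ i, ∑ j, E.weight t S i * E.weight t S j * (E.orthoDesign i ⬝ᵥ E.orthoDesign j)
          * E.e t j
        - ∑ i, E.weight t S i ^ 2 * (E.orthoDesign i ⬝ᵥ E.orthoDesign i) * E.e t i))) := by
  rw [cfRemainder, E.muCf_sub_mu hX hden, armStochasticPart]
  ring

lemma abs_armBias_le {K : ℝ} {t : Fin 2} {S : E.Assignment} (hw : ∀ i, |E.weight t S i| ≤ K) :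
    |E.armBias t S| ≤ K ^ 2 * ((1 / (E.n : ℝ)) * (E.residSize * √(E.kappa * E.p))) := by
  have hn := E.cast_n_pos
  have h1 := abs_sum_mul_le_of_abs_le (C := K ^ 2) (c := fun i => E.weight t S i ^ 2)
    (x := fun i => (E.orthoDesign i ⬝ᵥ E.orthoDesign i) * E.e t i)
    (y := fun i => (E.orthoDesign i ⬝ᵥ E.orthoDesign i) * |E.e t i|)
    (fun i => by rw [abs_pow]; exact pow_le_pow_left₀ (abs_nonneg _) (hw i) 2)
    (fun i => by rw [abs_mul, abs_of_nonneg (leverage_nonneg _ i)])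
  have h2 := sum_leverage_mul_abs_le E.orthoDesign_orthonormal E.leverage_le_kappa (E.e t)
  have h3 : ∑ i, (E.orthoDesign i ⬝ᵥ E.orthoDesign i) * |E.e t i|
      ≤ E.residSize * √(E.kappa * E.p) := by
    rw [mul_comm E.residSize]
    exact h2.trans (mul_le_mul_of_nonneg_left (E.euNorm_e_le t) (Real.sqrt_nonneg _))
  rw [armBias, abs_neg, abs_mul, abs_of_pos (by positivity : 0 < 1 / (E.n : ℝ)),
    mul_left_comm (K ^ 2)]
  refine mul_le_mul_of_nonneg_left ?_ (by positivity)
  simp only [mul_assoc]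
  exact h1.trans (mul_le_mul_of_nonneg_left h3 (sq_nonneg _))

lemma abs_armBiasBc_le {K : ℝ} {t : Fin 2} {S : E.Assignment} (hw : ∀ i, |E.weight t S i| ≤ K)
    (hodds : E.odds t ≤ K) (hX : euOpNorm (E.gramError t S) ≤ 1 / 2) :
    |E.armBiasBc t S| ≤ (1 / (E.n : ℝ))
      * (|∑ i, E.weight t S i * ((E.orthoDesign i ⬝ᵥ E.orthoDesign i) * E.e t i)|
        + K * ((1 + K) * (√(E.kappa * E.p) * (2 * euNorm (E.score t S))))) := by
  have hn := E.cast_n_pos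
  have hK : 0 ≤ K := (E.odds_nonneg t).trans hodds
  have h1 := abs_sum_mul_le_of_abs_le (C := 1 + K) (c := fun i => 1 + E.weight t S i)
    (x := fun i => (E.orthoDesign i ⬝ᵥ E.orthoDesign i) * (E.orthoDesign i ⬝ᵥ E.fitError t S))
    (y := fun i => (E.orthoDesign i ⬝ᵥ E.orthoDesign i) * |E.orthoDesign i ⬝ᵥ E.fitError t S|)
    (fun i => (abs_add_le _ _).trans (by rw [abs_one]; linarith [hw i]))
    (fun i => by rw [abs_mul, abs_of_nonneg (leverage_nonneg _ i)])
  have h2 := sum_leverage_mul_abs_le E.orthoDesign_orthonormal E.leverage_le_kappa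
    fun i => E.orthoDesign i ⬝ᵥ E.fitError t S
  rw [euNorm_dotProduct_row E.orthoDesign_orthonormal] at h2
  have h3 := h2.trans (mul_le_mul_of_nonneg_left
    (euNorm_le_of_eq_sub_mulVec hX (E.fitError_eq hX)) (Real.sqrt_nonneg _))
  rw [armBiasBc, abs_mul, abs_of_pos (by positivity : 0 < 1 / (E.n : ℝ))]
  refine mul_le_mul_of_nonneg_left ((abs_sub _ _).trans (add_le_add le_rfl ?_)) (by positivity)
  rw [abs_mul, abs_of_nonneg (E.odds_nonneg t)]
  exact mul_le_mul hodds (h1.trans (mul_le_mul_of_nonneg_left h3 (by linarith))) (abs_nonneg _) hK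

/-- The terms of the remainder of the cross-fitted estimator, which are of the orders `κ` and
`κ √(κ p) (1 + log p)`, match the stated rate. For `p = 1` the logarithm vanishes; for `p ≥ 2`
it is bounded away from zero. -/
lemma cf_rate_sq_le : (E.kappa + E.kappa * √(E.kappa * E.p) * (1 + Real.log E.p)) ^ 2
    ≤ 5 ^ 2 * (E.kappa ^ 2 * √(E.p : ℝ) + E.kappa ^ 3 * E.p * Real.log E.p ^ 2) := by
  have hκ := E.kappa_nonneg
  have hp := E.one_le_p
  have hℓ := E.log_p_nonneg
  have hs : 1 ≤ √(E.p : ℝ) := Real.one_le_sqrt.2 hp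
  have hN : √(E.kappa * E.p) ^ 2 = E.kappa * E.p := Real.sq_sqrt (by positivity)
  have h1 : (E.kappa + E.kappa * √(E.kappa * E.p) * (1 + Real.log E.p)) ^ 2
      ≤ 2 * E.kappa ^ 2 + 2 * (E.kappa ^ 3 * E.p * (1 + Real.log E.p) ^ 2) := by
    have h2 : E.kappa ^ 3 * E.p * (1 + Real.log E.p) ^ 2
        = (E.kappa * √(E.kappa * E.p) * (1 + Real.log E.p)) ^ 2 := by
      rw [mul_pow, mul_pow, hN]; ring
    rw [h2]
    linarith [add_sq_le (a := E.kappa)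
      (b := E.kappa * √(E.kappa * E.p) * (1 + Real.log E.p))]
  have hκs : E.kappa ^ 2 ≤ E.kappa ^ 2 * √(E.p : ℝ) := le_mul_of_one_le_right (sq_nonneg _) hs
  refine h1.trans ?_
  rcases Nat.eq_zero_or_pos E.d with h | h
  · have hp1 : (E.p : ℝ) = 1 := by unfold p; rw [h]; norm_num
    have h3 : E.kappa ^ 3 ≤ E.kappa ^ 2 := pow_le_pow_of_le_one hκ E.kappa_le_one (by norm_num)
    rw [hp1] at hκs ⊢
    simp only [Real.log_one, Real.sqrt_one]
    nlinarith [sq_nonneg E.kappa]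
  · have h3 := E.half_le_log_p h
    have h4 : (1 + Real.log E.p) ^ 2 ≤ 9 * Real.log E.p ^ 2 := by nlinarith
    have h5 : E.kappa ^ 3 * E.p * (1 + Real.log E.p) ^ 2
        ≤ E.kappa ^ 3 * E.p * (9 * Real.log E.p ^ 2) :=
      mul_le_mul_of_nonneg_left h4 (by positivity)
    have h6 : 0 ≤ E.kappa ^ 3 * E.p * Real.log E.p ^ 2 := by positivity
    have h7 : 0 ≤ E.kappa ^ 2 * √(E.p : ℝ) := by positivity
    linarith

end

namespace IsRegular

variable {E : ℕ → RCT} {K : ℝ}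

lemma isBigOp_adjRemainder (h : IsRegular E K) (t : Fin 2) :
    IsBigOp (fun m => (E m).law) (fun m S => (E m).adjRemainder t S)
      (fun m => 1 / √((E m).n : ℝ) * √((E m).E2 * ((E m).kappa ^ 2 * (E m).p
          + (E m).kappa ^ 3 * (E m).p * Real.log (E m).p ^ 2))) := by
  have hK := h.one_le
  refine IsBigOp.of_controlled (ι := Fin 2) (V := ![fun m S => euNorm ((E m).imbalance t S),
      fun m S => euNorm (IsSamplingWeight.offDiagonalFit
        (E m).orthoDesign ((E m).weight t S) ((E m).e t))])
    (r := ![fun m => √((E m).p : ℝ), fun m => (E m).kappa * (E m).residSize])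
    h.tendsto_gramError (fun k m => ?_) (fun k => ?_) (fun M hM => ?_)
  · fin_cases k
    · exact Real.sqrt_nonneg _
    · exact mul_nonneg (E m).kappa_nonneg (E m).residSize_nonneg
  · fin_cases k
    · exact h.isBigOp_imbalance t
    · exact h.isBigOp_offDiagonalFit t
  refine ⟨2 * M * (M + K ^ 2), by positivity, ?_⟩
  filter_upwards [h.eventually_weight] with m hm S hS hV
  have hκ := (E m).kappa_nonneg
  have hR := (E m).residSize_nonneg
  have hb0 : euNorm ((E m).imbalance t S) ≤ M * √((E m).p : ℝ) := (le_abs_self _).trans (hV 0)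
  have hb1 : euNorm (IsSamplingWeight.offDiagonalFit (E m).orthoDesign ((E m).weight t S)
      ((E m).e t)) ≤ M * ((E m).kappa * (E m).residSize) := (le_abs_self _).trans (hV 1)
  have hx := IsSamplingWeight.euNorm_mulVec_score_le (E m).orthoDesign_orthonormal hκ
    (E m).leverage_le_kappa ((hm.2 t).abs_le S) hK ((E m).e t)
  have hx2 : euNorm ((E m).gramError t S *ᵥ (E m).score t S)
      ≤ (M + K ^ 2) * ((E m).kappa * (E m).residSize) := by
    have := mul_le_mul_of_nonneg_left (mul_le_mul_of_nonneg_left ((E m).euNorm_e_le t) hκ)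
      (sq_nonneg K)
    linarith
  have hrate := (E m).residSize_mul_le (y := √((E m).p : ℝ) * (E m).kappa) (c := 1)
    (Y := (E m).kappa ^ 2 * (E m).p + (E m).kappa ^ 3 * (E m).p * Real.log (E m).p ^ 2)
    zero_le_one (by positivity) (by
      rw [mul_pow, Real.sq_sqrt (by positivity)]
      have : 0 ≤ (E m).kappa ^ 3 * (E m).p * Real.log (E m).p ^ 2 := by positivity
      linarith)
  rw [one_mul] at hrate
  refine ((E m).abs_adjRemainder_le (hS t)).trans ?_
  calc (1 / ((E m).n : ℝ)) * (euNorm ((E m).imbalance t S)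
        * (2 * euNorm ((E m).gramError t S *ᵥ (E m).score t S)))
      ≤ (1 / ((E m).n : ℝ)) * ((M * √((E m).p : ℝ))
        * (2 * ((M + K ^ 2) * ((E m).kappa * (E m).residSize)))) := by
        have := euNorm_nonneg ((E m).gramError t S *ᵥ (E m).score t S)
        gcongr
    _ = 2 * M * (M + K ^ 2)
        * ((1 / ((E m).n : ℝ)) * ((E m).residSize * (√((E m).p : ℝ) * (E m).kappa))) := by ring
    _ ≤ _ := mul_le_mul_of_nonneg_left hrate (by positivity)

lemma eventually_kappa_le (h : IsRegular E K) :
    ∀ᶠ m in atTop, (1 + K) * (2 * (E m).kappa) ≤ 1 / 2 := by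
  have hK := h.one_le
  have hlim : Tendsto (fun m => (1 + K) * (2 * (E m).kappa)) atTop (𝓝 ((1 + K) * (2 * 0))) :=
    (h.tendsto_kappa.const_mul 2).const_mul (1 + K)
  rw [mul_zero, mul_zero] at hlim
  exact (hlim.eventually (gt_mem_nhds (by norm_num : (0 : ℝ) < 1 / 2))).mono fun m hm => hm.le

lemma isBigOp_cfRemainder (h : IsRegular E K) (t : Fin 2) :
    IsBigOp (fun m => (E m).law) (fun m S => (E m).cfRemainder t S)
      (fun m => 1 / √((E m).n : ℝ) * √((E m).E2 * ((E m).kappa ^ 2 * √((E m).p : ℝ)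
          + (E m).kappa ^ 3 * (E m).p * Real.log (E m).p ^ 2))) := by
  have hK := h.one_le
  refine IsBigOp.of_controlled (ι := Fin 7) (V := ![fun m S => euNorm ((E m).imbalance t S),
      fun m S => euNorm ((E m).score t S),
      fun m S => euNorm (IsSamplingWeight.offDiagonalFit
        (E m).orthoDesign ((E m).weight t S) ((E m).e t)),
      fun m S => euOpNorm ((E m).gramError t S),
      fun m S => ∑ i, cfLin (E m).orthoDesign ((E m).e t) ((E m).odds t) i * (E m).weight t S i,
      fun m S => ∑ i, ∑ j, (if i = j then 0 else
        cfQuad (E m).orthoDesign ((E m).e t) ((E m).odds t) i j)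
          * ((E m).weight t S i * (E m).weight t S j),
      fun m S => ∑ i, ∑ j, ∑ l, cfCubic (E m).orthoDesign ((E m).e t) i j l
          * ((E m).weight t S i * (E m).weight t S j * (E m).weight t S l)])
    (r := ![fun m => √((E m).p : ℝ), fun m => √(E m).kappa * (E m).residSize,
      fun m => (E m).kappa * (E m).residSize,
      fun m => √((E m).kappa * (1 + Real.log (E m).p)),
      fun m => (E m).kappa * (E m).residSize, fun m => (E m).kappa * (E m).residSize,
      fun m => (E m).kappa * (E m).residSize])
    h.tendsto_gramError (fun k m => ?_) (fun k => ?_) (fun M hM => ?_)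
  · have hκR := mul_nonneg (E m).kappa_nonneg (E m).residSize_nonneg
    fin_cases k
    · exact Real.sqrt_nonneg _
    · exact mul_nonneg (Real.sqrt_nonneg _) (E m).residSize_nonneg
    · exact hκR
    · exact Real.sqrt_nonneg _
    · exact hκR
    · exact hκR
    · exact hκR
  · fin_cases k
    · exact h.isBigOp_imbalance t
    · exact h.isBigOp_score t
    · exact h.isBigOp_offDiagonalFit t
    · exact h.isBigOp_gramError t
    · exact h.isBigOp_cfLin t
    · exact h.isBigOp_cfQuad t
    · exact h.isBigOp_cfCubic t
  set A : ℝ := M ^ 2 * (M + K ^ 2) with hA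
  have hA0 : 0 < A := by positivity
  set C : ℝ := 3 * M + 240 * (1 + K) ^ 3 * A with hC
  have hC0 : 0 < C := by positivity
  refine ⟨C * 5, by positivity, ?_⟩
  filter_upwards [h.eventually_weight, h.eventually_odds_le, h.eventually_kappa_le]
    with m hm hodds hκK S hS hV
  have hX : euOpNorm ((E m).gramError t S) ≤ 1 / 2 := hS t
  have hwK := (hm.2 t).abs_le S
  have hn := (E m).cast_n_pos
  have hden : ∀ i, 1 - (1 + (E m).weight t S i)
      * ((E m).orthoDesign i ⬝ᵥ (E m).resolventRow t S i) ≠ 0 := by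
    intro i
    have h1 : |1 + (E m).weight t S i| ≤ 1 + K :=
      (abs_add_le _ _).trans (by rw [abs_one]; linarith [hwK i])
    have h2 := ((E m).abs_dotProduct_resolventRow_le hX i).trans
      (mul_le_mul_of_nonneg_left ((E m).leverage_le_kappa i) zero_le_two)
    have h3 : |(1 + (E m).weight t S i) * ((E m).orthoDesign i ⬝ᵥ (E m).resolventRow t S i)|
        ≤ 1 / 2 := by
      rw [abs_mul]
      exact (mul_le_mul h1 h2 (abs_nonneg _) (by linarith)).trans hκK
    have h4 := (abs_le.1 h3).2
    intro hcon
    linarith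
  have hmain := abs_cf_remainder_le (E m).orthoDesign_orthonormal (e := (E m).e t)
    ((E m).odds_nonneg t) (hodds t) hK ((E m).weight_sq t S) hwK (E m).kappa_nonneg
    (E m).leverage_le_kappa hκK hX ((E m).fitError_eq hX) ((E m).resolventRow_eq hX)
  rw [(E m).cfRemainder_eq hX hden, abs_neg, abs_mul, abs_of_pos (by positivity)]
  have hrate := (E m).residSize_mul_le (c := 5) (by norm_num) (by
    have := (E m).kappa_nonneg
    positivity) (E m).cf_rate_sq_le
  have hx := IsSamplingWeight.euNorm_mulVec_score_le (E m).orthoDesign_orthonormal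
    (E m).kappa_nonneg (E m).leverage_le_kappa hwK hK ((E m).e t)
  have hκ := (E m).kappa_nonneg
  have hR := (E m).residSize_nonneg
  have hℓ := (E m).log_p_nonneg
  have he := (E m).euNorm_e_le t
  have hpk : (((E m).d + 1 : ℕ) : ℝ) = (E m).p := rfl
  rw [hpk] at hmain
  have hb0 : euNorm ((E m).imbalance t S) ≤ M * √((E m).p : ℝ) := (le_abs_self _).trans (hV 0)
  have hb1 : euNorm ((E m).score t S) ≤ M * (√(E m).kappa * (E m).residSize) :=
    (le_abs_self _).trans (hV 1)
  have hb2 : euNorm (IsSamplingWeight.offDiagonalFit (E m).orthoDesign ((E m).weight t S)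
      ((E m).e t)) ≤ M * ((E m).kappa * (E m).residSize) := (le_abs_self _).trans (hV 2)
  have hb3 : euOpNorm ((E m).gramError t S) ≤ M * √((E m).kappa * (1 + Real.log (E m).p)) :=
    (le_abs_self _).trans (hV 3)
  have hb4 := hV 4
  have hb5 := hV 5
  have hb6 := hV 6
  dsimp only [Matrix.cons_val] at hb4 hb5 hb6
  change _ ≤ C * 5 * _
  have hxb : euNorm ((E m).gramError t S *ᵥ (E m).score t S)
      ≤ (M + K ^ 2) * ((E m).kappa * (E m).residSize) := by
    have := mul_le_mul_of_nonneg_left (mul_le_mul_of_nonneg_left he hκ) (sq_nonneg K)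
    linarith
  have hsum := cf_terms_le hM hK hκ (E m).kappa_le_one hR hℓ
    (euNorm_nonneg _) (euNorm_nonneg _) (euNorm_nonneg _) (euOpNorm_nonneg _)
    hb0 hb1 hb3 hxb he
  have htot := hmain.trans (add_le_add (add_le_add (add_le_add hb4 hb6) hb5)
    (mul_le_mul_of_nonneg_left hsum (by positivity : (0 : ℝ) ≤ 40 * (1 + K) ^ 3)))
  have hfin : M * ((E m).kappa * (E m).residSize) + M * ((E m).kappa * (E m).residSize)
      + M * ((E m).kappa * (E m).residSize) + 40 * (1 + K) ^ 3 * (6 * (A * ((E m).kappa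
        * (E m).residSize * √((E m).kappa * (E m).p) * (1 + Real.log (E m).p))))
      ≤ C * ((E m).residSize * ((E m).kappa
        + (E m).kappa * √((E m).kappa * (E m).p) * (1 + Real.log (E m).p))) := by
    set Y := (E m).kappa * (E m).residSize * √((E m).kappa * (E m).p) * (1 + Real.log (E m).p)
      with hY
    have h1 : 0 ≤ 3 * M * Y := by positivity
    have h2 : 0 ≤ 240 * (1 + K) ^ 3 * A * ((E m).kappa * (E m).residSize) := by positivity
    have h3 : C * ((E m).residSize * ((E m).kappa
        + (E m).kappa * √((E m).kappa * (E m).p) * (1 + Real.log (E m).p)))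
        = 3 * M * ((E m).kappa * (E m).residSize) + 240 * (1 + K) ^ 3 * A * Y
        + 3 * M * Y + 240 * (1 + K) ^ 3 * A * ((E m).kappa * (E m).residSize) := by
      rw [hC, hY]; ring
    linarith
  refine (mul_le_mul_of_nonneg_left (htot.trans hfin) (by positivity)).trans ?_
  rw [mul_left_comm, mul_assoc C]
  exact mul_le_mul_of_nonneg_left hrate hC0.le

lemma isBigOp_armBias (h : IsRegular E K) (t : Fin 2) :
    IsBigOp (fun m => (E m).law) (fun m S => (E m).armBias t S)
      (fun m => 1 / √((E m).n : ℝ) * √((E m).E2 * (E m).kappa * (E m).p)) := by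
  have hK := h.one_le
  refine IsBigOp.of_controlled (ι := Empty) (V := fun k => k.elim) (r := fun k => k.elim)
    (good := fun _ => Set.univ) (by simp) (fun k => k.elim) (fun k => k.elim)
    fun M _ => ⟨K ^ 2, by positivity, ?_⟩
  filter_upwards [h.eventually_weight] with m hm S _ _
  have hκ := (E m).kappa_nonneg
  refine ((E m).abs_armBias_le ((hm.2 t).abs_le S)).trans
    (mul_le_mul_of_nonneg_left ?_ (sq_nonneg K))
  have hrate := (E m).residSize_mul_le (y := √((E m).kappa * (E m).p)) (c := 1)
    (Y := (E m).kappa * (E m).p) zero_le_one (by positivity)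
    (by rw [Real.sq_sqrt (by positivity), one_pow, one_mul])
  rwa [one_mul, ← mul_assoc (E m).E2] at hrate

lemma isBigOp_armBiasBc (h : IsRegular E K) (t : Fin 2) :
    IsBigOp (fun m => (E m).law) (fun m S => (E m).armBiasBc t S)
      (fun m => 1 / √((E m).n : ℝ) * √((E m).E2 * (E m).kappa ^ 2 * (E m).p)) := by
  have hK := h.one_le
  refine IsBigOp.of_controlled (ι := Fin 2) (V := ![fun m S => euNorm ((E m).score t S),
      fun m S => ∑ i, (E m).weight t S i
        * (((E m).orthoDesign i ⬝ᵥ (E m).orthoDesign i) * (E m).e t i)])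
    (r := ![fun m => √(E m).kappa * (E m).residSize, fun m => (E m).kappa * (E m).residSize])
    h.tendsto_gramError (fun k m => ?_) (fun k => ?_) (fun M hM => ?_)
  · fin_cases k
    · exact mul_nonneg (Real.sqrt_nonneg _) (E m).residSize_nonneg
    · exact mul_nonneg (E m).kappa_nonneg (E m).residSize_nonneg
  · fin_cases k
    · exact h.isBigOp_score t
    · exact h.isBigOp_leverage_score t
  set C : ℝ := M + 2 * K * (1 + K) * M with hC
  refine ⟨C, by positivity, ?_⟩
  filter_upwards [h.eventually_weight, h.eventually_odds_le] with m hm hodds S hS hV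
  have hb0 : euNorm ((E m).score t S) ≤ M * (√(E m).kappa * (E m).residSize) :=
    (le_abs_self _).trans (hV 0)
  have hb1 : |∑ i, (E m).weight t S i
      * (((E m).orthoDesign i ⬝ᵥ (E m).orthoDesign i) * (E m).e t i)|
      ≤ M * ((E m).kappa * (E m).residSize) := hV 1
  have hκ := (E m).kappa_nonneg
  have hR := (E m).residSize_nonneg
  have hs : 1 ≤ √((E m).p : ℝ) := Real.one_le_sqrt.2 (E m).one_le_p
  have hrate := (E m).residSize_mul_le (y := (E m).kappa * √((E m).p : ℝ)) (c := 1)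
    (Y := (E m).kappa ^ 2 * (E m).p) zero_le_one (by positivity)
    (by rw [mul_pow, Real.sq_sqrt (by positivity), one_pow, one_mul])
  rw [one_mul, ← mul_assoc ((E m).E2)] at hrate
  refine ((E m).abs_armBiasBc_le ((hm.2 t).abs_le S) (hodds t) (hS t)).trans ?_
  refine le_trans ?_ (mul_le_mul_of_nonneg_left hrate (by positivity : 0 ≤ C))
  rw [mul_left_comm C]
  refine mul_le_mul_of_nonneg_left ?_ (by positivity)
  calc |∑ i, (E m).weight t S i
        * (((E m).orthoDesign i ⬝ᵥ (E m).orthoDesign i) * (E m).e t i)|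
        + K * ((1 + K) * (√((E m).kappa * (E m).p) * (2 * euNorm ((E m).score t S))))
      ≤ M * ((E m).kappa * (E m).residSize * √((E m).p : ℝ)) + K * ((1 + K)
        * ((√(E m).kappa * √((E m).p : ℝ))
          * (2 * (M * (√(E m).kappa * (E m).residSize))))) := by
        rw [Real.sqrt_mul hκ]
        refine add_le_add (hb1.trans (mul_le_mul_of_nonneg_left
          (le_mul_of_one_le_right (by positivity) hs) (by positivity))) ?_
        gcongr
    _ = M * ((E m).kappa * (E m).residSize * √((E m).p : ℝ)) + 2 * K * (1 + K) * M
        * ((√(E m).kappa * √(E m).kappa) * (E m).residSize * √((E m).p : ℝ)) := by ring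
    _ = C * ((E m).residSize * ((E m).kappa * √((E m).p : ℝ))) := by
        rw [Real.mul_self_sqrt hκ, hC]; ring

end IsRegular

end RCT

theorem theorem1 (E : ℕ → RCT)
    -- the population size diverges
    (hn : Tendsto (fun m => (E m).n) atTop atTop)
    -- the treated and control fractions are bounded away from zero
    (h₁ : (fun m => ((E m).n : ℝ) / (E m).n₁) =O[atTop] (fun _ => (1 : ℝ)))
    (h₀ : (fun m => ((E m).n : ℝ) / (E m).n₀) =O[atTop] (fun _ => (1 : ℝ)))
    -- the leverages are small
    (hκ : (fun m => (E m).kappa * Real.log (E m).p) =o[atTop] (fun _ => (1 : ℝ)))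
    -- the potential residuals are not perfectly negatively correlated
    (hη : ∃ η : ℝ, 0 < η ∧ ∀ᶠ m in atTop,
      (∑ i, (E m).e 1 i * (E m).e 0 i)
        / √((∑ i, (E m).e 1 i ^ 2) * ∑ i, (E m).e 0 i ^ 2) > -1 + η)
    -- no potential residual dominates
    (hLF : (fun m => (E m).Einf ^ 2 / ((E m).n * (E m).E2)) =o[atTop] (fun _ => (1 : ℝ))) :
    -- stochastic expansions
    (IsBigOp (fun m => (E m).law)
        (fun m S => (E m).tauAdj S - (E m).tau - ((E m).biasAdj S + (E m).stochasticPart S))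
        (fun m => 1 / √((E m).n : ℝ) * √((E m).E2 * ((E m).kappa ^ 2 * (E m).p
          + (E m).kappa ^ 3 * (E m).p * Real.log (E m).p ^ 2))) ∧
      IsBigOp (fun m => (E m).law)
        (fun m S => (E m).tauBc S - (E m).tau - ((E m).biasBc S + (E m).stochasticPart S))
        (fun m => 1 / √((E m).n : ℝ) * √((E m).E2 * ((E m).kappa ^ 2 * (E m).p
          + (E m).kappa ^ 3 * (E m).p * Real.log (E m).p ^ 2))) ∧
      IsBigOp (fun m => (E m).law)
        (fun m S => (E m).tauCf S - (E m).tau - ((E m).biasCf S + (E m).stochasticPart S))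
        (fun m => 1 / √((E m).n : ℝ) * √((E m).E2 * ((E m).kappa ^ 2 * √((E m).p : ℝ)
          + (E m).kappa ^ 3 * (E m).p * Real.log (E m).p ^ 2)))) ∧
    -- orders of the bias terms
    (IsBigOp (fun m => (E m).law) (fun m S => (E m).biasAdj S)
        (fun m => 1 / √((E m).n : ℝ) * √((E m).E2 * (E m).kappa * (E m).p)) ∧
      IsBigOp (fun m => (E m).law) (fun m S => (E m).biasBc S)
        (fun m => 1 / √((E m).n : ℝ) * √((E m).E2 * (E m).kappa ^ 2 * (E m).p)) ∧
      ∀ m S, (E m).biasCf S = 0) := by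
  obtain ⟨K, h⟩ := RCT.exists_isRegular hn h₁ h₀ hκ
  have hadj := IsBigOp.sub (fun m => (E m).adjRate_nonneg) (h.isBigOp_adjRemainder 1)
    (h.isBigOp_adjRemainder 0)
  have hbc := IsBigOp.sub (fun m => by positivity) (h.isBigOp_armBiasBc 1)
    (h.isBigOp_armBiasBc 0)
  refine ⟨⟨?_, ?_, ?_⟩, ?_, ?_, fun _ _ => rfl⟩
  · exact hadj.congr_on h.tendsto_gramError (fun m => (E m).adjRate_nonneg)
      fun m S hS => (E m).tauAdj_remainder_eq hS
  · exact hadj.congr_on h.tendsto_gramError (fun m => (E m).adjRate_nonneg)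
      fun m S hS => (E m).tauBc_remainder_eq hS
  · simp only [RCT.tauCf_remainder_eq]
    exact IsBigOp.sub (fun m => by positivity) (h.isBigOp_cfRemainder 1) (h.isBigOp_cfRemainder 0)
  · simp only [RCT.biasAdj_eq]
    exact IsBigOp.sub (fun m => by positivity) (h.isBigOp_armBias 1) (h.isBigOp_armBias 0)
  · exact hbc.congr_on h.tendsto_gramError (fun m => by positivity)
      fun m S hS => (E m).biasBc_eq hS
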